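/- Notation. Fix an integer $N\ge 2$ and $\ell\in\mathbb C$ with $\operatorname{Re}\ell<0$; put $q=e^{\ell}$ (so $0<|q|<1$) and $q^{\alpha}=e^{\alpha\ell}$. Let $(a;q)_\infty=\prod_{k\ge0}(1-aq^k)$ and $\theta(z;q)=(z;q)_\infty(q/z;q)_\infty$. If $N$ is even let $D=\mathbb C\setminus\{0\}$; if $N$ is odd let $D=\mathbb C\setminus(\{0\}\cup\{-q^u:u\in\mathbb R\})$ (for real $\ell$, i.e. $0<q<1$, this is the plane cut along $(-\infty,0]$). For $x\ne0$ write $x=q^{u}e^{iv}$ with $u\in\mathbb R$, $v\in(-\pi,\pi]$, and define powers of $x$ by $x^\alpha=e^{\alpha(u\ell+iv)}$ (the principal branch when $\ell$ is real). (A) Let $n>2$, let $U\subset\mathbb C\setminus\{0\}$ be open with $qU=U$ (for instance $U=\mathbb C\setminus\{0\}$), and let $g$ be holomorphic on $U$ with $g(qx)=g(x)/(q^{n-1}x^{2n-4})$ for $x\in U$. Put $e(x;y)=x^{-1}\theta(xy;q)\theta(x/y;q)$. Then there are symmetric holomorphic functions $h,h'$ on $U^n$ with $h=(x_1\cdots x_n)^{n-2}h'$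 such that, whenever $\theta(x_ix_j;q)\ne0$ and $\theta(x_i/x_j;q)\neq 0$ for all $i\ne j$, $$\prod_{i<j}e(x_i;x_j)\sum_{k=1}^n\frac{x_kg(x_k)}{\prod_{l\ne k}e(x_l;x_k)}=h'(x)\prod_{i<j}x_j\theta(x_i/x_j;q),$$ $$\sum_{k=1}^n\frac{g(x_k)}{\prod_{i\ne k}\theta(x_ix_k;q)\theta(x_i/x_k;q)}=\frac{h(x)}{\prod_{i<j}\theta(x_ix_j;q)}.$$ (B) There is a symmetric holomorphic function $f$ on $D^{N+2}$ such that $$\sum_{k=1}^{N+2}\frac{x_k^{N/2-1}\theta(x_k^{-N};q^{N/2})}{\prod_{i\ne k}\theta(x_ix_k;q)\theta(x_i/x_k;q)}=\frac{f(x_1,\dots,x_{N+2})}{\prod_{i<j}\theta(x_ix_j;q)}$$ for all $x\in D^{N+2}$ at which the denominators on the left do not vanish, and $$f(\dots,qx_i,\dots)=(-1)^{N+1}\frac{f(x_1,\dots,x_{N+2})}{(x_1\cdots x_{N+2})\,x_i^{N-2}}\qquad(1\le i\le N+2)$$ on $D^{N+2}$. This $f$, which depends only on $N$ and $\ell$,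 has the following property. Let $a_1,\dots,a_{2N}\in D$ with $|a_j|<1$ and $|q^{N-1}|<|a_1\cdots a_{2N}|$, let $s_j\in\mathbb C$ be any numbers with $q^{s_j}=a_j$, and assume that $\theta(a_ia_j;q)\ne0$ for $1\le i\neq j\le 2N$ and $\theta(a_i/a_j;q)\ne0$ for $1\le i\ne j\le N-1$. Let $$\Phi(z)=\frac{z-z^{-1}}{z^{N/2}-z^{-N/2}}\,\frac{(z^{N};q^{N/2})_\infty(z^{-N};q^{N/2})_\infty}{\prod_{j=1}^{2N}(a_jz;q)_\infty(a_jz^{-1};q)_\infty},\qquad I_N=\int_{C}\Phi(z)\frac{dz}{2\pi i z},$$ where $\Phi$ is regarded as a function of $w=\log z$ and $C$ runs from infinity along $w=-t\ell-i\pi$ to $t=0$, then along the unit circle $w=iv$ from $v=-\pi$ to $v=\pi$, then to infinity along $w=-t\ell+i\pi$. (For even $N$ the two tails cancel identically and $C$ is the unit circle; for odd $N$ and real $\ell$ the tails are the two sides of $(-\infty,-1]$.) Let $$Q(z)=(z^{-1}-z)\prod_{j=1}^{2N}z^{1/2-s_j}\frac{(qa_j^{-1}z;q)_\infty}{(a_jz;q)_\infty},\quad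 J_N(z)=\sum_{\nu\in\mathbb Z}Q(zq^\nu),\quad h(z)=z^{N-1-s_1-\cdots-s_{2N}}\frac{\theta(z^2;q)}{\prod_{j=1}^{2N}\theta(a_jz;q)},$$ also regarded as functions of $w=\log z$. Then the integral over the unit circle and the integral over $0<t<\infty$ of the difference of the two branches of $\Phi$ on the tails converge absolutely; the series $J_N(z)$ converges absolutely whenever $\theta(z^2;q)\ne0$ and all $\theta(a_jz;q)\neq0$, and there $J_N/h$ is the restriction of a (unique, single-valued) holomorphic function $\mathcal J_N$ on $\mathbb C\setminus\{0\}$; and $$I_N=\sum_{i=1}^{N-1}C_i\,\mathcal J_N(a_i),$$ $$C_i=\frac{f(a_i,a_N,a_{N+1},\dots,a_{2N})}{(q;q)_\infty^2\prod_{1\le j\le N-1,\,j\ne i}\theta(a_ja_i;q)\theta(a_j/a_i;q)\cdot\prod_{k=N}^{2N}\theta(a_ia_k;q)\cdot\prod_{N\le l<m\le2N}\theta(a_la_m;q)}.$$ -/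

import Mathlib

namespace QIntegral

noncomputable section

/-- The infinite `q`-shifted factorial `(a; q)_∞ = ∏_{k ≥ 0} (1 - a q^k)`. -/
def qPoch (a q : ℂ) : ℂ := ∏' k : ℕ, (1 - a * q ^ k)

/-- The theta function `θ(z; q) = (z; q)_∞ (q / z; q)_∞`. -/
def theta (z q : ℂ) : ℂ := qPoch z q * qPoch (q * z⁻¹) q

/-- The base `q = e^ℓ`. All powers of `q` are `q^α = e^{α ℓ}`. -/
def base (ℓ : ℂ) : ℂ := Complex.exp ℓ

/-- The base `q^{N/2}`. -/
def halfBase (N : ℕ) (ℓ : ℂ) : ℂ := Complex.exp ((N : ℂ) / 2 * ℓ)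

/-- The `q`-invariant logarithm: write `x = e^{u ℓ} e^{i v}` with `u` real and `v ∈ (-π, π]`;
the value is `u ℓ + i v`. For real `ℓ` it is the principal logarithm. -/
def qLog (ℓ x : ℂ) : ℂ :=
  ((Real.log ‖x‖ / ℓ.re : ℝ) : ℂ) * ℓ
    + Complex.log (x * Complex.exp (-(((Real.log ‖x‖ / ℓ.re : ℝ) : ℂ) * ℓ)))

/-- The power `x^α` on the branch given by `qLog`. -/
def qLogPow (ℓ x α : ℂ) : ℂ := Complex.exp (α * qLog ℓ x)

/-- The domain of the variables. For even `N` it is `ℂ \ {0}`. For odd `N`, where square roots of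
the variables occur, the branch cut `{-q^u : u ∈ ℝ}` is removed as well; for `0 < q < 1` (with
real `ℓ`) this cut is the negative real axis. -/
def varDomain (N : ℕ) (ℓ : ℂ) : Set ℂ :=
  {x : ℂ | x ≠ 0 ∧ (Odd N → ∀ u : ℝ, x ≠ -Complex.exp ((u : ℂ) * ℓ))}

/-- The integrand `Φ(z)` at `z = e^w`, where `z^{N/2} = e^{N w / 2}`. -/
def Phi (N : ℕ) (ℓ : ℂ) (a : ℕ → ℂ) (w : ℂ) : ℂ :=
  (Complex.exp w - Complex.exp (-w))
      / (Complex.exp ((N : ℂ) / 2 * w) - Complex.exp (-((N : ℂ) / 2 * w)))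
    * (qPoch (Complex.exp ((N : ℂ) * w)) (halfBase N ℓ)
        * qPoch (Complex.exp (-((N : ℂ) * w))) (halfBase N ℓ))
    / ∏ j ∈ Finset.Icc 1 (2 * N),
        (qPoch (a j * Complex.exp w) (base ℓ) * qPoch (a j * Complex.exp (-w)) (base ℓ))

/-- The two tails of the contour taken together: the branch of `Φ` on the upper side of the cut
minus the branch on its lower side, at `z = -q^{-t}`. It vanishes identically for even `N`. -/
def tailPhi (N : ℕ) (ℓ : ℂ) (a : ℕ → ℂ) (t : ℝ) : ℂ :=
  Phi N ℓ a (-((t : ℂ) * ℓ) + Real.pi * Complex.I)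
    - Phi N ℓ a (-((t : ℂ) * ℓ) - Real.pi * Complex.I)

/-- The integral `I_N = ∫_{𝕋 ∪ ℍ} Φ(z) dz / (2 π i z)`. With `z = e^w` the Hankel type contour
comes from infinity along `w = -t ℓ - i π`, follows the unit circle `w = i v`, `-π ≤ v ≤ π`,
and returns to infinity along `w = -t ℓ + i π`. -/
def integralI (N : ℕ) (ℓ : ℂ) (a : ℕ → ℂ) : ℂ :=
  1 / (2 * Real.pi * Complex.I)
    * ((∫ v in (-Real.pi)..Real.pi, Phi N ℓ a ((v : ℂ) * Complex.I) * Complex.I)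
        + ∫ t in Set.Ioi (0 : ℝ), tailPhi N ℓ a t * (-ℓ))

/-- The function `Q(z)` at `z = e^w`, where `z^{1/2 - s_j} = e^{(1/2 - s_j) w}`. -/
def Q (N : ℕ) (ℓ : ℂ) (a s : ℕ → ℂ) (w : ℂ) : ℂ :=
  (Complex.exp (-w) - Complex.exp w)
    * ∏ j ∈ Finset.Icc 1 (2 * N),
        (Complex.exp ((1 / 2 - s j) * w)
          * (qPoch (base ℓ * (a j)⁻¹ * Complex.exp w) (base ℓ)
              / qPoch (a j * Complex.exp w) (base ℓ)))

/-- The Jackson integral `J_N(z) = ∑_{ν ∈ ℤ} Q(z q^ν)` at `z = e^w`. -/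
def jackson (N : ℕ) (ℓ : ℂ) (a s : ℕ → ℂ) (w : ℂ) : ℂ :=
  ∑' ν : ℤ, Q N ℓ a s (w + (ν : ℂ) * ℓ)

/-- The function `h(z) = z^{N - 1 - s_1 - ⋯ - s_{2N}} θ(z²) / ∏_j θ(a_j z)` at `z = e^w`. -/
def hFactor (N : ℕ) (ℓ : ℂ) (a s : ℕ → ℂ) (w : ℂ) : ℂ :=
  Complex.exp (((N : ℂ) - 1 - ∑ j ∈ Finset.Icc 1 (2 * N), s j) * w)
    * (theta (Complex.exp w ^ 2) (base ℓ)
        / ∏ j ∈ Finset.Icc 1 (2 * N), theta (a j * Complex.exp w) (base ℓ))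

/-- `F` is the regularisation `𝒥_N` of the Jackson integral: the holomorphic function on
`ℂ \ {0}` that equals `J_N(z) / h(z)` wherever `h` has neither a zero nor a pole. (There is at most
one such function on `ℂ \ {0}`; this clause also asserts that the series `J_N(z)` converges.) -/
def IsRegularisation (N : ℕ) (ℓ : ℂ) (a s : ℕ → ℂ) (F : ℂ → ℂ) : Prop :=
  DifferentiableOn ℂ F {z : ℂ | z ≠ 0} ∧
    ∀ w : ℂ, theta (Complex.exp w ^ 2) (base ℓ) ≠ 0 →
      (∀ j ∈ Finset.Icc 1 (2 * N), theta (a j * Complex.exp w) (base ℓ) ≠ 0) →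
      Summable (fun ν : ℤ => Q N ℓ a s (w + (ν : ℂ) * ℓ)) ∧
        F (Complex.exp w) = jackson N ℓ a s w / hFactor N ℓ a s w

/-- `∑_k g(x_k) / ∏_{i ≠ k} θ(x_i x_k) θ(x_i / x_k)`. -/
def thetaSum {n : ℕ} (q : ℂ) (g : ℂ → ℂ) (x : Fin n → ℂ) : ℂ :=
  ∑ k, g (x k) / ∏ i ∈ Finset.univ.erase k, (theta (x i * x k) q * theta (x i / x k) q)

/-- `∏_{i < j} θ(x_i x_j)`. -/
def thetaPairs {n : ℕ} (q : ℂ) (x : Fin n → ℂ) : ℂ :=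
  ∏ i, ∏ j ∈ Finset.Ioi i, theta (x i * x j) q

/-- `e(x; y) = x⁻¹ θ(x y) θ(x / y)`. -/
def eFun (q x y : ℂ) : ℂ := x⁻¹ * theta (x * y) q * theta (x / y) q

/-- The skew-symmetric sum `∏_{i < j} e(x_i; x_j) ∑_k x_k g(x_k) / ∏_{l ≠ k} e(x_l; x_k)`. -/
def skewSum {n : ℕ} (q : ℂ) (g : ℂ → ℂ) (x : Fin n → ℂ) : ℂ :=
  (∏ i, ∏ j ∈ Finset.Ioi i, eFun q (x i) (x j))
    * ∑ k, x k * g (x k) / ∏ l ∈ Finset.univ.erase k, eFun q (x l) (x k)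

/-- No denominator in `thetaSum` vanishes at `x`. -/
def Generic {n : ℕ} (q : ℂ) (x : Fin n → ℂ) : Prop :=
  ∀ i j, i ≠ j → theta (x i * x j) q ≠ 0 ∧ theta (x i / x j) q ≠ 0

/-- `f` is a symmetric holomorphic function of `n` variables in `U`. -/
def IsSymmHolomorphic {n : ℕ} (U : Set ℂ) (f : (Fin n → ℂ) → ℂ) : Prop :=
  DifferentiableOn ℂ f {x | ∀ i, x i ∈ U} ∧
    ∀ x : Fin n → ℂ, (∀ i, x i ∈ U) → ∀ σ : Equiv.Perm (Fin n), f (fun i => x (σ i)) = f x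

/-- The function `g_N(x) = x^{N/2 - 1} θ(x^{-N}; q^{N/2})`. -/
def gFun (N : ℕ) (ℓ x : ℂ) : ℂ :=
  qLogPow ℓ x ((N : ℂ) / 2 - 1) * theta ((x ^ N)⁻¹) (halfBase N ℓ)

/-- The connection coefficient `C_i` attached to a function `f` of `N + 2` variables, which is
evaluated at `(a_i, a_N, a_{N+1}, …, a_{2N})`. -/
def connCoeff (N : ℕ) (ℓ : ℂ) (a : ℕ → ℂ) (f : (Fin (N + 2) → ℂ) → ℂ) (i : ℕ) : ℂ :=
  f (Fin.cons (a i) (fun k : Fin (N + 1) => a (N + k)))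
    / (qPoch (base ℓ) (base ℓ) ^ 2
        * (∏ j ∈ (Finset.Icc 1 (N - 1)).erase i,
            (theta (a j * a i) (base ℓ) * theta (a j / a i) (base ℓ)))
        * (∏ k ∈ Finset.Icc N (2 * N), theta (a i * a k) (base ℓ))
        * ∏ l ∈ Finset.Icc N (2 * N), ∏ m ∈ Finset.Ioc l (2 * N),
            theta (a l * a m) (base ℓ))

end

end QIntegral

open Filter Topology Complex

namespace QIntegral


/-! ### The `q`-shifted factorial and the theta function -/

section QPoch

variable {q : ℂ}

lemma summable_norm_mul_pow (hq : ‖q‖ < 1) (a : ℂ) : Summable fun k : ℕ => ‖-(a * q ^ k)‖ := by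
  simpa [norm_mul, norm_pow] using
    (summable_geometric_of_lt_one (norm_nonneg q) hq).mul_left ‖a‖

lemma multipliable_qPoch (hq : ‖q‖ < 1) (a : ℂ) : Multipliable fun k : ℕ => 1 - a * q ^ k := by
  simpa [sub_eq_add_neg] using multipliable_one_add_of_summable (summable_norm_mul_pow hq a)

lemma qPoch_eq_mul (hq : ‖q‖ < 1) (a : ℂ) : qPoch a q = (1 - a) * qPoch (a * q) q := by
  unfold qPoch
  rw [tprod_eq_zero_mul' (f := fun k : ℕ => 1 - a * q ^ k)]
  · simp [pow_succ', mul_assoc]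
  · simpa [pow_succ', mul_assoc] using multipliable_qPoch hq (a * q)

lemma qPoch_eq_prod_mul (hq : ‖q‖ < 1) (a : ℂ) (n : ℕ) :
    qPoch a q = (∏ k ∈ Finset.range n, (1 - a * q ^ k)) * qPoch (a * q ^ n) q := by
  induction n with
  | zero => simp
  | succ n ih =>
    rw [ih, Finset.prod_range_succ, qPoch_eq_mul hq (a * q ^ n), pow_succ]
    ring_nf

lemma qPoch_ne_zero (hq : ‖q‖ < 1) {a : ℂ} (h : ∀ k : ℕ, a * q ^ k ≠ 1) : qPoch a q ≠ 0 := by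
  have := tprod_one_add_ne_zero_of_summable (f := fun k : ℕ => -(a * q ^ k))
    (fun k => by
      rw [← sub_eq_add_neg]; exact sub_ne_zero.mpr (h k).symm) (summable_norm_mul_pow hq a)
  simpa [qPoch, sub_eq_add_neg] using this

lemma qPoch_eq_zero_iff (hq : ‖q‖ < 1) {a : ℂ} : qPoch a q = 0 ↔ ∃ k : ℕ, a * q ^ k = 1 := by
  constructor
  · intro h
    by_contra! h'
    exact qPoch_ne_zero hq h' h
  · rintro ⟨k, hk⟩
    rw [qPoch_eq_prod_mul hq a (k + 1), Finset.prod_range_succ, hk]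
    simp

lemma qPoch_ne_zero_of_norm_lt (hq : ‖q‖ < 1) {a : ℂ} (ha : ‖a‖ < 1) : qPoch a q ≠ 0 := by
  refine qPoch_ne_zero hq fun k hk => ?_
  have h1 : ‖a‖ * ‖q‖ ^ k = 1 := by simpa using congrArg norm hk
  have h2 : ‖q‖ ^ k ≤ 1 := pow_le_one₀ (norm_nonneg _) hq.le
  nlinarith [norm_nonneg a, pow_nonneg (norm_nonneg q) k]

lemma differentiable_qPoch (hq : ‖q‖ < 1) : Differentiable ℂ fun a => qPoch a q := by
  intro a
  have hU : IsOpen (Metric.ball (0 : ℂ) (‖a‖ + 1)) := Metric.isOpen_ball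
  have key := Summable.hasProdLocallyUniformlyOn_nat_one_add (f := fun (k : ℕ) (x : ℂ) => -(x * q ^ k)) hU
    ((summable_geometric_of_lt_one (norm_nonneg q) hq).mul_left (‖a‖ + 1))
    (Eventually.of_forall fun n x hx => by
      have : ‖x‖ < ‖a‖ + 1 := by simpa using hx
      rw [norm_neg, norm_mul, norm_pow]
      gcongr)
    (fun n => by fun_prop)
  have hd : DifferentiableOn ℂ (fun x => ∏' i : ℕ, (1 + -(x * q ^ i)))
      (Metric.ball (0 : ℂ) (‖a‖ + 1)) := by
    refine TendstoLocallyUniformlyOn.differentiableOn key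
      (Eventually.of_forall fun s => ?_) hU
    exact DifferentiableOn.fun_finsetProd fun i _ => by fun_prop
  have ha : a ∈ Metric.ball (0 : ℂ) (‖a‖ + 1) := by simp
  simpa [qPoch, sub_eq_add_neg] using hd.differentiableAt (hU.mem_nhds ha)

lemma continuous_qPoch (hq : ‖q‖ < 1) : Continuous fun a => qPoch a q :=
  (differentiable_qPoch hq).continuous

end QPoch

section Theta

variable {q : ℂ}

lemma theta_eq_one_sub_mul (hq : ‖q‖ < 1) (z : ℂ) :
    theta z q = (1 - z) * (qPoch (q * z) q * qPoch (q * z⁻¹) q) := by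
  rw [theta, qPoch_eq_mul hq z, mul_comm z q]; ring

lemma theta_mul_base (hq : ‖q‖ < 1) (hq0 : q ≠ 0) {z : ℂ} (hz : z ≠ 0) :
    theta (q * z) q = -z⁻¹ * theta z q := by
  have h1 : q * (q * z)⁻¹ = z⁻¹ := by field_simp
  rw [theta_eq_one_sub_mul hq z, theta, h1, qPoch_eq_mul hq z⁻¹, mul_comm z⁻¹ q]
  field_simp
  ring

lemma theta_inv (hq : ‖q‖ < 1) {z : ℂ} (hz : z ≠ 0) :
    theta z⁻¹ q = -z⁻¹ * theta z q := by
  rw [theta_eq_one_sub_mul hq z, theta_eq_one_sub_mul hq, inv_inv]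
  field_simp
  ring

lemma theta_eq_zero_iff (hq : ‖q‖ < 1) (hq0 : q ≠ 0) {z : ℂ} (hz : z ≠ 0) :
    theta z q = 0 ↔ ∃ m : ℤ, z = q ^ m := by
  rw [theta, mul_eq_zero, qPoch_eq_zero_iff hq, qPoch_eq_zero_iff hq]
  constructor
  · rintro (⟨k, hk⟩ | ⟨k, hk⟩)
    · refine ⟨-k, ?_⟩
      rw [zpow_neg, zpow_natCast]
      exact eq_inv_of_mul_eq_one_left hk
    · refine ⟨(k + 1 : ℕ), ?_⟩
      rw [zpow_natCast, pow_succ]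
      field_simp at hk
      rw [← hk]; ring
  · rintro ⟨m, rfl⟩
    rcases m with k | k
    · rcases k with _ | k
      · left; exact ⟨0, by simp⟩
      · right
        refine ⟨k, ?_⟩
        rw [Int.ofNat_eq_natCast, zpow_natCast, pow_succ]
        field_simp
    · left
      refine ⟨k + 1, ?_⟩
      rw [zpow_negSucc]
      field_simp

lemma theta_ne_zero_inv (hq : ‖q‖ < 1) {z : ℂ} (hz : z ≠ 0) :
    theta z⁻¹ q ≠ 0 ↔ theta z q ≠ 0 := by
  rw [theta_inv hq hz]; simp [hz]

lemma theta_mul_base_ne_zero (hq : ‖q‖ < 1) (hq0 : q ≠ 0) {z : ℂ} (hz : z ≠ 0) :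
    theta (q * z) q ≠ 0 ↔ theta z q ≠ 0 := by
  rw [theta_mul_base hq hq0 hz]; simp [hz]

lemma differentiableAt_theta (hq : ‖q‖ < 1) {z : ℂ} (hz : z ≠ 0) :
    DifferentiableAt ℂ (fun z => theta z q) z := by
  unfold theta
  have h := differentiable_qPoch hq
  refine (h z).mul (DifferentiableAt.comp z (h _) ?_)
  exact (differentiableAt_inv hz).const_mul q

lemma deriv_theta_mul_base (hq : ‖q‖ < 1) (hq0 : q ≠ 0) {z : ℂ} (hz : z ≠ 0)
    (h0 : theta z q = 0) :
    q * deriv (fun z => theta z q) (q * z) = -z⁻¹ * deriv (fun z => theta z q) z := by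
  have h1 : HasDerivAt (fun z => theta (q * z) q) (deriv (fun z => theta z q) (q * z) * q) z := by
    refine HasDerivAt.comp z (differentiableAt_theta hq (mul_ne_zero hq0 hz)).hasDerivAt ?_
    simpa using (hasDerivAt_id z).const_mul q
  have h2 : HasDerivAt (fun z => -z⁻¹ * theta z q)
      (-(-(z ^ 2)⁻¹) * theta z q + -z⁻¹ * deriv (fun z => theta z q) z) z :=
    (hasDerivAt_inv hz).neg.mul (differentiableAt_theta hq hz).hasDerivAt
  have h3 : (fun z => theta (q * z) q) =ᶠ[𝓝 z] fun z => -z⁻¹ * theta z q := by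
    filter_upwards [eventually_ne_nhds hz] with y hy using theta_mul_base hq hq0 hy
  have := h1.unique (h2.congr_of_eventuallyEq h3)
  rw [mul_comm, this, h0]; ring

lemma deriv_theta_one (hq : ‖q‖ < 1) : deriv (fun z => theta z q) 1 = -qPoch q q ^ 2 := by
  have h := differentiable_qPoch hq
  have h1 : DifferentiableAt ℂ (fun z : ℂ => qPoch (q * z) q * qPoch (q * z⁻¹) q) 1 :=
    (DifferentiableAt.comp (1 : ℂ) (h _) (by fun_prop)).mul
      (DifferentiableAt.comp (1 : ℂ) (h _)
        ((differentiableAt_inv one_ne_zero).const_mul q))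
  have h2 := ((hasDerivAt_id (1 : ℂ)).const_sub 1).mul h1.hasDerivAt
  have h3 : (fun z => theta z q)
      = (fun z : ℂ => 1 - id z) * fun z : ℂ => qPoch (q * z) q * qPoch (q * z⁻¹) q := by
    funext z; exact theta_eq_one_sub_mul hq z
  rw [h3, h2.deriv]
  simp; ring

lemma deriv_theta_ne_zero (hq : ‖q‖ < 1) (hq0 : q ≠ 0) {z : ℂ} (hz : z ≠ 0)
    (h0 : theta z q = 0) : deriv (fun z => theta z q) z ≠ 0 := by
  have hzero : ∀ m : ℤ, theta (q ^ m) q = 0 := fun m =>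
    (theta_eq_zero_iff hq hq0 (zpow_ne_zero m hq0)).mpr ⟨m, rfl⟩
  have hstep : ∀ m : ℤ, deriv (fun z => theta z q) (q ^ (m + 1)) ≠ 0 ↔
      deriv (fun z => theta z q) (q ^ m) ≠ 0 := by
    intro m
    have := deriv_theta_mul_base hq hq0 (zpow_ne_zero m hq0) (hzero m)
    rw [zpow_add_one₀ hq0, mul_comm (q ^ m) q]
    have hm := zpow_ne_zero m hq0
    constructor
    · intro h h'
      rw [h', mul_zero] at this
      exact h ((mul_eq_zero.mp this).resolve_left hq0)
    · intro h h'
      rw [h', mul_zero] at this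
      exact h ((mul_eq_zero.mp this.symm).resolve_left (neg_ne_zero.mpr (inv_ne_zero hm)))
  obtain ⟨m, rfl⟩ := (theta_eq_zero_iff hq hq0 hz).mp h0
  induction m using Int.induction_on with
  | zero =>
    rw [zpow_zero, deriv_theta_one hq]
    exact neg_ne_zero.mpr (pow_ne_zero 2 (qPoch_ne_zero_of_norm_lt hq hq))
  | succ k ih => exact (hstep k).mpr (ih (zpow_ne_zero _ hq0) (hzero _))
  | pred k ih =>
    have := hstep (-(k : ℤ) - 1)
    rw [sub_add_cancel] at this
    exact this.mp (ih (zpow_ne_zero _ hq0) (hzero _))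

/-- The theta function in the logarithmic variable. -/
noncomputable def thetaExp (q u : ℂ) : ℂ := theta (exp u) q

lemma differentiable_thetaExp (hq : ‖q‖ < 1) : Differentiable ℂ (thetaExp q) := fun u =>
  DifferentiableAt.comp u (differentiableAt_theta hq (exp_ne_zero u)) differentiable_exp.differentiableAt

lemma deriv_thetaExp_ne_zero (hq : ‖q‖ < 1) (hq0 : q ≠ 0) {u : ℂ} (h0 : thetaExp q u = 0) :
    deriv (thetaExp q) u ≠ 0 := by
  have h : HasDerivAt (thetaExp q) (deriv (fun z => theta z q) (exp u) * exp u) u :=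
    HasDerivAt.comp u (differentiableAt_theta hq (exp_ne_zero u)).hasDerivAt (hasDerivAt_exp u)
  rw [h.deriv]
  exact mul_ne_zero (deriv_theta_ne_zero hq hq0 (exp_ne_zero u) h0) (exp_ne_zero u)

lemma thetaExp_neg (hq : ‖q‖ < 1) (u : ℂ) : thetaExp q (-u) = -exp (-u) * thetaExp q u := by
  rw [thetaExp, exp_neg, theta_inv hq (exp_ne_zero u)]; rfl

end Theta

section Base

variable {ℓ : ℂ}

lemma norm_base_lt_one (hℓ : ℓ.re < 0) : ‖base ℓ‖ < 1 := by
  rw [base, norm_exp]; exact Real.exp_lt_one_iff.mpr hℓ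

lemma base_ne_zero (ℓ : ℂ) : base ℓ ≠ 0 := exp_ne_zero ℓ

lemma norm_halfBase_lt_one {N : ℕ} (hN : 2 ≤ N) (hℓ : ℓ.re < 0) : ‖halfBase N ℓ‖ < 1 := by
  rw [halfBase, norm_exp]
  rw [Real.exp_lt_one_iff]
  have h : ((N : ℂ) / 2 * ℓ).re = (N : ℝ) / 2 * ℓ.re := by
    rw [show ((N : ℂ) / 2) = ((N / 2 : ℝ) : ℂ) by push_cast; ring, re_ofReal_mul]
  rw [h]
  have : (2 : ℝ) ≤ N := by exact_mod_cast hN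
  nlinarith

lemma halfBase_sq (N : ℕ) (ℓ : ℂ) : halfBase N ℓ ^ 2 = base ℓ ^ N := by
  rw [halfBase, base, ← exp_nat_mul, ← exp_nat_mul]
  congr 1; push_cast; ring

end Base


/-! ### Division by functions with simple zeros -/

section Division

/-- The quotient of `f` by `g`, continued over the simple zeros of `g`. -/
noncomputable def quot (f g : ℂ → ℂ) (z : ℂ) : ℂ :=
  if g z = 0 then deriv f z / deriv g z else f z / g z

lemma quot_of_ne {f g : ℂ → ℂ} {z : ℂ} (h : g z ≠ 0) : quot f g z = f z / g z := if_neg h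

lemma quot_of_eq {f g : ℂ → ℂ} {z : ℂ} (h : g z = 0) :
    quot f g z = deriv f z / deriv g z := if_pos h

lemma differentiableOn_quot {U : Set ℂ} (hU : IsOpen U) {f g : ℂ → ℂ}
    (hf : DifferentiableOn ℂ f U) (hg : DifferentiableOn ℂ g U)
    (h0 : ∀ z ∈ U, g z = 0 → f z = 0) (h1 : ∀ z ∈ U, g z = 0 → deriv g z ≠ 0) :
    DifferentiableOn ℂ (quot f g) U := by
  intro z hz
  have hnz := hU.mem_nhds hz
  have hfz := hf.differentiableAt hnz
  have hgz := hg.differentiableAt hnz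
  refine DifferentiableAt.differentiableWithinAt ?_
  by_cases hg0 : g z = 0
  · have hdf : DifferentiableAt ℂ (dslope f z) z :=
      ((differentiableOn_dslope hnz).mpr hf).differentiableAt hnz
    have hdg : DifferentiableAt ℂ (dslope g z) z :=
      ((differentiableOn_dslope hnz).mpr hg).differentiableAt hnz
    have hne : dslope g z z ≠ 0 := by rw [dslope_same]; exact h1 z hz hg0
    refine (hdf.div hdg hne).congr_of_eventuallyEq ?_
    filter_upwards [hdg.continuousAt.eventually_ne hne] with y hy
    by_cases hyz : y = z
    · subst hyz
      rw [quot_of_eq hg0, Pi.div_apply, dslope_same, dslope_same]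
    · have hyz' : y - z ≠ 0 := sub_ne_zero.mpr hyz
      have hg' : g y = (y - z) * dslope g z y := by
        have := sub_smul_dslope g z y
        rw [smul_eq_mul, hg0, sub_zero] at this
        exact this.symm
      have hf' : f y = (y - z) * dslope f z y := by
        have := sub_smul_dslope f z y
        rw [smul_eq_mul, h0 z hz hg0, sub_zero] at this
        exact this.symm
      rw [quot_of_ne (by rw [hg']; exact mul_ne_zero hyz' hy), hg', hf', Pi.div_apply,
        mul_div_mul_left _ _ hyz']
  · refine (hfz.div hgz hg0).congr_of_eventuallyEq ?_
    filter_upwards [hgz.continuousAt.eventually_ne hg0] with y hy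
    rw [quot_of_ne hy, Pi.div_apply]

variable {E : Type*} [NormedAddCommGroup E] [NormedSpace ℂ E] [ProperSpace E]

lemma contDiffAt_intervalIntegral_translate {V : Set E} (hV : IsOpen V) {G : E → ℂ}
    (hG : ContDiffOn ℂ 1 G V) {γ : ℝ → E} (hγ : Continuous γ) {a b : ℝ} {u₀ : E}
    (h : ∀ t ∈ Set.uIcc a b, u₀ + γ t ∈ V) :
    ContDiffAt ℂ 1 (fun u => ∫ t in a..b, G (u + γ t)) u₀ := by
  set K : Set E := (fun t => u₀ + γ t) '' Set.uIcc a b with hK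
  have hKc : IsCompact K := isCompact_uIcc.image (by fun_prop)
  obtain ⟨δ, hδ, hδV⟩ := hKc.exists_cthickening_subset_open hV (by
    rintro _ ⟨t, ht, rfl⟩; exact h t ht)
  have hK'c : IsCompact (Metric.cthickening δ K) := hKc.cthickening
  have hmem : ∀ u ∈ Metric.ball u₀ δ, ∀ t ∈ Set.uIcc a b, u + γ t ∈ Metric.cthickening δ K := by
    intro u hu t ht
    refine Metric.mem_cthickening_of_dist_le _ (u₀ + γ t) _ _ ⟨t, ht, rfl⟩ ?_
    rw [dist_add_right]; exact (Metric.mem_ball.mp hu).le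
  have hcf : ContinuousOn (fderiv ℂ G) V := hG.continuousOn_fderiv_of_isOpen hV le_rfl
  obtain ⟨M, hM⟩ := hK'c.exists_bound_of_continuousOn (hcf.mono hδV)
  have hcG : ∀ u ∈ Metric.ball u₀ δ, ContinuousOn (fun t => G (u + γ t)) (Set.uIcc a b) :=
    fun u hu => hG.continuousOn.comp (by fun_prop) fun t ht => hδV (hmem u hu t ht)
  have hcG' : ∀ u ∈ Metric.ball u₀ δ,
      ContinuousOn (fun t => fderiv ℂ G (u + γ t)) (Set.uIcc a b) :=
    fun u hu => hcf.comp (by fun_prop) fun t ht => hδV (hmem u hu t ht)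
  have hmeas : ∀ u ∈ Metric.ball u₀ δ, MeasureTheory.AEStronglyMeasurable
      (fun t => fderiv ℂ G (u + γ t)) (MeasureTheory.volume.restrict (Set.uIoc a b)) :=
    fun u hu => ((hcG' u hu).mono Set.uIoc_subset_uIcc).aestronglyMeasurable measurableSet_uIoc
  rw [contDiffAt_one_iff]
  refine ⟨fun u => ∫ t in a..b, fderiv ℂ G (u + γ t), Metric.ball u₀ δ,
    Metric.ball_mem_nhds _ hδ, ?_, ?_⟩
  · intro u hu
    refine ContinuousAt.continuousWithinAt ?_
    refine intervalIntegral.continuousAt_of_dominated_interval (bound := fun _ => M) ?_ ?_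
      intervalIntegrable_const ?_
    · filter_upwards [Metric.isOpen_ball.mem_nhds hu] with y hy using hmeas y hy
    · filter_upwards [Metric.isOpen_ball.mem_nhds hu] with y hy
      exact Eventually.of_forall fun t ht =>
        hM _ (hmem y hy t (Set.uIoc_subset_uIcc ht))
    · refine Eventually.of_forall fun t ht => ?_
      have hV' : u + γ t ∈ V := hδV (hmem u hu t (Set.uIoc_subset_uIcc ht))
      exact ContinuousAt.comp (f := fun x => x + γ t)
        (hcf.continuousAt (hV.mem_nhds hV')) (by fun_prop)
  · intro u hu
    refine intervalIntegral.hasFDerivAt_integral_of_dominated_of_fderiv_le (s := Metric.ball u₀ δ)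
      (F := fun x t => G (x + γ t)) (F' := fun x t => fderiv ℂ G (x + γ t))
      (bound := fun _ => M) (Metric.isOpen_ball.mem_nhds hu) ?_ ?_ (hmeas u hu) ?_
      intervalIntegrable_const ?_
    · filter_upwards [Metric.isOpen_ball.mem_nhds hu] with y hy
      exact ((hcG y hy).mono Set.uIoc_subset_uIcc).aestronglyMeasurable measurableSet_uIoc
    · exact (hcG u hu).intervalIntegrable
    · exact Eventually.of_forall fun t ht x hx => hM _ (hmem x hx t (Set.uIoc_subset_uIcc ht))
    · refine Eventually.of_forall fun t ht x hx => ?_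
      have hV' : x + γ t ∈ V := hδV (hmem x hx t (Set.uIoc_subset_uIcc ht))
      have h1 : HasFDerivAt G (fderiv ℂ G (x + γ t)) (x + γ t) :=
        ((hG.differentiableOn one_ne_zero).differentiableAt (hV.mem_nhds hV')).hasFDerivAt
      exact h1.comp x ((hasFDerivAt_id x).add_const (γ t))

/-- A `C¹` function vanishing on the zero set of `δ ∘ L`, where `δ` is an entire function with
simple zeros and `L ≠ 0` is linear, is divisible by `δ ∘ L`. -/
theorem exists_eq_mul_comp_of_vanish {Ω : Set E} (hΩ : IsOpen Ω) {F : E → ℂ}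
    (hF : ContDiffOn ℂ 1 F Ω) {L : E →L[ℂ] ℂ} {e : E} (hLe : L e = 1) {δ : ℂ → ℂ}
    (hδ : Differentiable ℂ δ) (hδ' : ∀ z, δ z = 0 → deriv δ z ≠ 0)
    (h0 : ∀ u ∈ Ω, δ (L u) = 0 → F u = 0) :
    ∃ Q : E → ℂ, ContDiffOn ℂ 1 Q Ω ∧ ∀ u ∈ Ω, F u = Q u * δ (L u) := by
  set Q : E → ℂ := fun u => quot (fun s => F (u + s • e)) (fun s => δ (L u + s)) 0 with hQ
  have hQne : ∀ u, δ (L u) ≠ 0 → Q u = F u / δ (L u) := by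
    intro u hu
    simp only [hQ]
    rw [quot_of_ne (by simpa using hu)]; simp
  refine ⟨Q, ?_, ?_⟩
  · intro u₀ hu₀
    refine ContDiffAt.contDiffWithinAt ?_
    have hV : IsOpen {u | u ∈ Ω ∧ δ (L u) ≠ 0} :=
      hΩ.inter (isOpen_ne_fun (hδ.continuous.comp L.continuous) continuous_const)
    have hG : ContDiffOn ℂ 1 (fun u => F u / δ (L u)) {u | u ∈ Ω ∧ δ (L u) ≠ 0} := by
      refine (hF.mono fun u hu => hu.1).div ?_ fun u hu => hu.2
      exact (hδ.contDiff.comp L.contDiff).contDiffOn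
    by_cases hz : δ (L u₀) = 0
    · have hev : ∀ᶠ s in 𝓝[≠] (0 : ℂ), δ (L u₀ + s) ≠ 0 := by
        have hd : HasDerivAt (fun s => δ (L u₀ + s)) (deriv δ (L u₀)) 0 := by
          have := (hδ (L u₀ + 0)).hasDerivAt.comp_const_add (L u₀) 0
          simpa using this
        simpa [hz] using hd.eventually_ne (c := 0) (hδ' _ hz)
      have hmem : ∀ᶠ p : E × ℂ in 𝓝 (u₀, 0), p.1 + p.2 • e ∈ Ω := by
        have : Tendsto (fun p : E × ℂ => p.1 + p.2 • e) (𝓝 (u₀, 0)) (𝓝 (u₀ + (0 : ℂ) • e)) :=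
          Continuous.tendsto (by fun_prop) _
        exact this.eventually (hΩ.mem_nhds (by simpa using hu₀))
      rw [nhds_prod_eq] at hmem
      obtain ⟨p, hp, p', hp', hpp⟩ := (eventually_prod_iff.mp hmem)
      obtain ⟨ε, hε, hεs⟩ := Metric.eventually_nhds_iff.mp
        ((eventually_nhdsWithin_iff.mp hev).and hp')
      set r := ε / 2 with hr
      have hr0 : 0 < r := by positivity
      have hcirc : ∀ t : ℝ, ‖circleMap 0 r t‖ = r := fun t => by
        simp [norm_circleMap_zero, abs_of_pos hr0]
      have hP := contDiffAt_intervalIntegral_translate hV hG (a := 0) (b := 2 * Real.pi)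
        (u₀ := u₀) (γ := fun t => circleMap 0 r t • e)
        ((continuous_circleMap 0 r).smul continuous_const) (fun t _ => by
          have hlt : dist (circleMap 0 r t) 0 < ε := by
            rw [dist_zero_right, hcirc]; linarith
          have h := hεs hlt
          refine ⟨hpp hp.self_of_nhds h.2, ?_⟩
          rw [map_add, map_smul, hLe, smul_eq_mul, mul_one]
          exact h.1 (by
            rw [Set.mem_compl_singleton_iff, ← norm_pos_iff, hcirc]; exact hr0))
      refine ((contDiffAt_const (c := (((2 * Real.pi : ℝ)⁻¹ : ℝ) : ℂ))).smul hP).congr_of_eventuallyEq ?_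
      have hnear : ∀ᶠ u in 𝓝 u₀, ∀ t ∈ Set.uIcc (0 : ℝ) (2 * Real.pi),
          δ (L u + circleMap 0 r t) ≠ 0 := by
        have hc : Continuous fun p : E × ℝ => δ (L p.1 + circleMap 0 r p.2) :=
          hδ.continuous.comp (by fun_prop)
        refine IsCompact.eventually_forall_of_forall_eventually isCompact_uIcc fun t _ => ?_
        refine hc.continuousAt.eventually_ne ?_
        have hlt : dist (circleMap 0 r t) 0 < ε := by
          rw [dist_zero_right, hcirc]; linarith
        exact (hεs hlt).1 (by rw [Set.mem_compl_singleton_iff, ← norm_pos_iff, hcirc]; exact hr0)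
      filter_upwards [hp, hnear] with u hpu hnu
      have hball : ∀ s ∈ Metric.ball (0 : ℂ) ε, u + s • e ∈ Ω := fun s hs =>
        hpp hpu (hεs (Metric.mem_ball.mp hs)).2
      have hdiff : DifferentiableOn ℂ
          (quot (fun s => F (u + s • e)) (fun s => δ (L u + s))) (Metric.ball 0 ε) := by
        refine differentiableOn_quot Metric.isOpen_ball ?_ ?_ ?_ ?_
        · exact (hF.differentiableOn one_ne_zero).comp
            (by fun_prop) hball
        · exact (hδ.comp (differentiable_id.const_add (L u))).differentiableOn
        · intro s hs h
          refine h0 _ (hball s hs) ?_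
          rw [map_add, map_smul, hLe, smul_eq_mul, mul_one]; exact h
        · intro s hs h
          rw [deriv_comp_const_add (f := δ)]
          exact hδ' _ h
      have hmv := DiffContOnCl.circleAverage (hdiff.diffContOnCl_ball
        (Metric.closedBall_subset_ball (show |r| < ε by rw [abs_of_pos hr0]; linarith)))
      rw [Real.circleAverage_def] at hmv
      change quot _ _ 0 = _
      rw [← hmv, ← coe_smul]
      congr 1
      refine intervalIntegral.integral_congr fun t ht => ?_
      rw [quot_of_ne (g := fun s => δ (L u + s)) (hnu t ht), map_add, map_smul, hLe, smul_eq_mul, mul_one]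
    · refine (hG.contDiffAt (hV.mem_nhds ⟨hu₀, hz⟩)).congr_of_eventuallyEq ?_
      filter_upwards [hV.mem_nhds ⟨hu₀, hz⟩] with u hu using hQne u hu.2
  · intro u hu
    by_cases hz : δ (L u) = 0
    · rw [hz, mul_zero, h0 u hu hz]
    · rw [hQne u hz, div_mul_cancel₀ _ hz]

end Division


section Pairs

variable {n : ℕ} {δ : ℂ → ℂ}

lemma eventually_ne_zero_of_simple_zeros (hδ : Differentiable ℂ δ)
    (hδ' : ∀ z, δ z = 0 → deriv δ z ≠ 0) (z : ℂ) {c : ℂ} (hc : c ≠ 0) :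
    ∀ᶠ t in 𝓝[≠] (0 : ℂ), δ (z + t * c) ≠ 0 := by
  by_cases hz : δ z = 0
  · have hd : HasDerivAt (fun t => δ (z + t * c)) (deriv δ z * c) 0 := by
      have h1 : HasDerivAt (fun t : ℂ => z + t * c) c 0 := by
        simpa using ((hasDerivAt_id (0 : ℂ)).mul_const c).const_add z
      refine HasDerivAt.comp 0 ?_ h1
      simpa using (hδ z).hasDerivAt
    exact hd.eventually_ne (c := 0) (mul_ne_zero (hδ' z hz) hc)
  · refine eventually_nhdsWithin_of_eventually_nhds ?_
    have hcont : Continuous fun t : ℂ => δ (z + t * c) := hδ.continuous.comp (by fun_prop)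
    exact hcont.continuousAt.eventually_ne (by simpa using hz)

lemma tendsto_add_smul (u c : Fin n → ℂ) :
    Tendsto (fun t : ℂ => u + t • c) (𝓝[≠] 0) (𝓝 u) := by
  have : Tendsto (fun t : ℂ => u + t • c) (𝓝 0) (𝓝 (u + (0 : ℂ) • c)) :=
    Continuous.tendsto (by fun_prop) 0
  simpa using this.mono_left nhdsWithin_le_nhds

/-- No two coordinates have a sum or a difference that is a zero of `δ`. -/
def PairGeneric (δ : ℂ → ℂ) (u : Fin n → ℂ) : Prop :=
  ∀ i j, i ≠ j → δ (u i + u j) ≠ 0 ∧ δ (u i - u j) ≠ 0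

lemma eventually_pairGeneric (hδ : Differentiable ℂ δ)
    (hδ' : ∀ z, δ z = 0 → deriv δ z ≠ 0) (u : Fin n → ℂ) :
    ∀ᶠ t in 𝓝[≠] (0 : ℂ), PairGeneric δ (u + t • fun m : Fin n => ((m : ℕ) + 1 : ℂ)) := by
  unfold PairGeneric
  simp only [eventually_all]
  intro i j hij
  have h1 : ((i : ℕ) + 1 + ((j : ℕ) + 1) : ℂ) ≠ 0 := by
    exact_mod_cast (show (i : ℕ) + 1 + ((j : ℕ) + 1) ≠ 0 by omega)
  have h2 : ((i : ℕ) + 1 - ((j : ℕ) + 1) : ℂ) ≠ 0 := by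
    rw [sub_ne_zero]
    intro h
    exact hij (Fin.ext (by exact_mod_cast add_right_cancel h))
  filter_upwards [eventually_ne_zero_of_simple_zeros hδ hδ' (u i + u j) h1,
    eventually_ne_zero_of_simple_zeros hδ hδ' (u i - u j) h2] with t ht1 ht2
  simp only [Pi.add_apply, Pi.smul_apply, smul_eq_mul]
  refine ⟨?_, ?_⟩
  · convert ht1 using 2; ring
  · convert ht2 using 2; ring

/-- Two continuous functions on an open set which agree at the generic points agree. -/
lemma eqOn_of_pairGeneric (hδ : Differentiable ℂ δ) (hδ' : ∀ z, δ z = 0 → deriv δ z ≠ 0)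
    {Ω : Set (Fin n → ℂ)} (hΩ : IsOpen Ω) {f g : (Fin n → ℂ) → ℂ} (hf : ContinuousOn f Ω)
    (hg : ContinuousOn g Ω) (h : ∀ u ∈ Ω, PairGeneric δ u → f u = g u) {u : Fin n → ℂ}
    (hu : u ∈ Ω) : f u = g u := by
  have ht := tendsto_add_smul u fun m : Fin n => ((m : ℕ) + 1 : ℂ)
  have h1 := (hf.continuousAt (hΩ.mem_nhds hu)).tendsto.comp ht
  have h2 := (hg.continuousAt (hΩ.mem_nhds hu)).tendsto.comp ht
  refine tendsto_nhds_unique_of_eventuallyEq h1 h2 ?_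
  filter_upwards [eventually_pairGeneric hδ hδ' u, ht.eventually (hΩ.mem_nhds hu)] with t ht1 ht2
  exact h _ ht2 ht1

/-- Division by a product of factors `δ (uᵢ - uⱼ)` with `i < j`. -/
theorem exists_eq_mul_prod_pairs (hδ : Differentiable ℂ δ) (hδ' : ∀ z, δ z = 0 → deriv δ z ≠ 0)
    {Ω : Set (Fin n → ℂ)} (hΩ : IsOpen Ω) {F : (Fin n → ℂ) → ℂ} (hF : ContDiffOn ℂ 1 F Ω)
    (h0 : ∀ u ∈ Ω, ∀ i j, i ≠ j → δ (u i - u j) = 0 →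
      (∀ a b, a ≠ b → (a ≠ i ∨ b ≠ j) → (a ≠ j ∨ b ≠ i) → δ (u a - u b) ≠ 0) →
      (∀ a b, a ≠ b → δ (u a + u b) ≠ 0) → F u = 0)
    (A : Finset (Fin n × Fin n)) (hA : ∀ p ∈ A, p.1 < p.2) :
    ∃ H : (Fin n → ℂ) → ℂ, ContDiffOn ℂ 1 H Ω ∧
      ∀ u ∈ Ω, F u = H u * ∏ p ∈ A, δ (u p.1 - u p.2) := by
  induction A using Finset.induction_on with
  | empty => exact ⟨F, hF, by simp⟩
  | insert p A hpA ih =>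
    obtain ⟨H, hH, hFH⟩ := ih fun p' hp' => hA p' (Finset.mem_insert_of_mem hp')
    have hp : p.1 < p.2 := hA p (Finset.mem_insert_self p A)
    have hvan : ∀ u ∈ Ω, δ (u p.1 - u p.2) = 0 → H u = 0 := by
      intro u hu hz
      set c : Fin n → ℂ := fun m => if m = p.1 then ((p.2 : ℕ) + 1 : ℂ) else ((m : ℕ) + 1 : ℂ)
        with hc
      have hcn : ∀ m, ∃ k : ℕ, c m = (k : ℂ) + 1 ∧ (m = p.1 → k = (p.2 : ℕ)) ∧
          (m ≠ p.1 → k = (m : ℕ)) := by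
        intro m
        by_cases hm : m = p.1
        · exact ⟨p.2, by simp [hc, hm], fun _ => rfl, fun h => absurd hm h⟩
        · exact ⟨m, by simp [hc, hm], fun h => absurd h hm, fun _ => rfl⟩
      have ht := tendsto_add_smul u c
      have hgen1 : ∀ᶠ t in 𝓝[≠] (0 : ℂ), ∀ a b, a ≠ b → (a ≠ p.1 ∨ b ≠ p.2) →
          (a ≠ p.2 ∨ b ≠ p.1) → δ ((u + t • c) a - (u + t • c) b) ≠ 0 := by
        simp only [eventually_all]
        intro a b hab h1 h2
        have hcab : c a - c b ≠ 0 := by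
          obtain ⟨k, hk, hk1, hk2⟩ := hcn a
          obtain ⟨k', hk', hk1', hk2'⟩ := hcn b
          rw [hk, hk', sub_ne_zero]
          intro h
          have h' : k = k' := by exact_mod_cast add_right_cancel h
          grind
        filter_upwards [eventually_ne_zero_of_simple_zeros hδ hδ' (u a - u b) hcab] with t ht1
        simp only [Pi.add_apply, Pi.smul_apply, smul_eq_mul]
        convert ht1 using 2; ring
      have hgen2 : ∀ᶠ t in 𝓝[≠] (0 : ℂ), ∀ a b, a ≠ b →
          δ ((u + t • c) a + (u + t • c) b) ≠ 0 := by
        simp only [eventually_all]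
        intro a b hab
        have hcab : c a + c b ≠ 0 := by
          obtain ⟨k, hk, -, -⟩ := hcn a
          obtain ⟨k', hk', -, -⟩ := hcn b
          rw [hk, hk']
          exact_mod_cast (show k + 1 + (k' + 1) ≠ 0 by omega)
        filter_upwards [eventually_ne_zero_of_simple_zeros hδ hδ' (u a + u b) hcab] with t ht1
        simp only [Pi.add_apply, Pi.smul_apply, smul_eq_mul]
        convert ht1 using 2; ring
      have hlim := (hH.continuousOn.continuousAt (hΩ.mem_nhds hu)).tendsto.comp ht
      refine tendsto_nhds_unique_of_eventuallyEq hlim tendsto_const_nhds ?_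
      filter_upwards [hgen1, hgen2, ht.eventually (hΩ.mem_nhds hu)] with t ht1 ht2 ht3
      have hF0 : F (u + t • c) = 0 := by
        refine h0 _ ht3 p.1 p.2 hp.ne ?_ ht1 ht2
        convert hz using 2
        simp [hc, hp.ne']
      rw [hFH _ ht3] at hF0
      refine (mul_eq_zero.mp hF0).resolve_right (Finset.prod_ne_zero_iff.mpr fun p' hp' => ?_)
      have hlt : p'.1 < p'.2 := hA p' (Finset.mem_insert_of_mem hp')
      refine ht1 _ _ hlt.ne ?_ ?_
      · by_contra! h
        exact hpA (by rwa [← Prod.ext h.1 h.2])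
      · by_contra! h
        exact absurd hlt (by rw [h.1, h.2]; exact hp.not_gt)
    obtain ⟨Q, hQ, hHQ⟩ := exists_eq_mul_comp_of_vanish hΩ hH
      (L := ContinuousLinearMap.proj (R := ℂ) (φ := fun _ : Fin n => ℂ) p.1
        - ContinuousLinearMap.proj (R := ℂ) (φ := fun _ : Fin n => ℂ) p.2)
      (e := Pi.single p.1 1) (by simp [hp.ne']) hδ hδ'
      (fun u hu hz => hvan u hu (by simpa using hz))
    refine ⟨Q, hQ, fun u hu => ?_⟩
    rw [Finset.prod_insert hpA, hFH u hu, hHQ u hu]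
    simp [mul_assoc]

end Pairs

section Skew

variable {n : ℕ}

/-- The product over `i < j` of `e i j`, with the pairs containing `k` removed up to sign. -/
noncomputable def skewCofactor (e : Fin n → Fin n → ℂ) (k : Fin n) : ℂ :=
  ∏ i, ∏ j ∈ Finset.Ioi i, if j = k then 1 else if i = k then -1 else e i j

lemma prod_erase_eq_prod_pairs (F : Fin n → ℂ) (k : Fin n) :
    ∏ l ∈ Finset.univ.erase k, F l
      = ∏ i, ∏ j ∈ Finset.Ioi i, if j = k then F i else if i = k then F j else 1 := by
  have h2 : ∀ i, (∏ j ∈ Finset.Ioi i, if j = k then F i else if i = k then F j else 1)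
      = if i = k then ∏ j ∈ Finset.Ioi k, F j else if i < k then F i else 1 := by
    intro i
    by_cases hik : i = k
    · subst hik
      rw [if_pos rfl]
      refine Finset.prod_congr rfl fun j hj => ?_
      rw [if_neg (Finset.mem_Ioi.mp hj).ne', if_pos rfl]
    · simp only [hik, if_false]
      rw [Finset.prod_ite_eq']
      simp
  simp only [h2]
  rw [← Finset.mul_prod_erase _ _ (Finset.mem_univ k), if_pos rfl]
  have h3 : (Finset.univ.erase k : Finset (Fin n)) = Finset.Ioi k ∪ Finset.Iio k := by
    ext i; simp [lt_or_lt_iff_ne, eq_comm]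
  have h4 : Disjoint (Finset.Ioi k) (Finset.Iio k) := by
    rw [Finset.disjoint_left]; intro i; simp; exact fun h => h.le
  rw [h3, Finset.prod_union h4, Finset.prod_union h4]
  congr 1
  rw [Finset.prod_eq_one (s := Finset.Ioi k), one_mul]
  · refine Finset.prod_congr rfl fun i hi => ?_
    have := Finset.mem_Iio.mp hi
    rw [if_neg this.ne, if_pos this]
  · intro i hi
    have := Finset.mem_Ioi.mp hi
    rw [if_neg this.ne', if_neg this.not_gt]

lemma skewCofactor_mul {e : Fin n → Fin n → ℂ} (he : ∀ i j, e i j = -e j i) (k : Fin n) :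
    skewCofactor e k * ∏ l ∈ Finset.univ.erase k, e l k = ∏ i, ∏ j ∈ Finset.Ioi i, e i j := by
  rw [prod_erase_eq_prod_pairs (fun l => e l k), skewCofactor, ← Finset.prod_mul_distrib]
  refine Finset.prod_congr rfl fun i _ => ?_
  rw [← Finset.prod_mul_distrib]
  refine Finset.prod_congr rfl fun j _ => ?_
  by_cases hjk : j = k
  · simp [hjk]
  · by_cases hik : i = k
    · subst hik; simp [hjk, he i j]
    · simp [hjk, hik]

lemma skewCofactor_eq_zero {e : Fin n → Fin n → ℂ} (he : ∀ i j, e i j = -e j i) {i j k : Fin n}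
    (hij : i ≠ j) (hki : k ≠ i) (hkj : k ≠ j) (h : e i j = 0) : skewCofactor e k = 0 := by
  wlog hlt : i < j generalizing i j
  · exact this hij.symm hkj hki (by rw [he, h, neg_zero]) (lt_of_le_of_ne (not_lt.mp hlt) hij.symm)
  refine Finset.prod_eq_zero (Finset.mem_univ i) (Finset.prod_eq_zero (Finset.mem_Ioi.mpr hlt) ?_)
  rw [if_neg hkj.symm, if_neg hki.symm, h]

lemma sum_mul_skewCofactor_eq_zero {e : Fin n → Fin n → ℂ} (he : ∀ i j, e i j = -e j i)
    {i j : Fin n} (hij : i ≠ j) (h : e i j = 0)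
    (hne : ∀ l, l ≠ i → l ≠ j → e l j ≠ 0) {c : ℂ} (hc : ∀ l, e i l = c * e j l)
    {G : Fin n → ℂ} (hG : G i = c ^ (n - 2) * G j) :
    ∑ k, G k * skewCofactor e k = 0 := by
  have hsum : ∑ k, G k * skewCofactor e k = G i * skewCofactor e i + G j * skewCofactor e j := by
    rw [← Finset.sum_subset (Finset.subset_univ {i, j}), Finset.sum_pair hij]
    intro k _ hk
    simp only [Finset.mem_insert, Finset.mem_singleton, not_or] at hk
    rw [skewCofactor_eq_zero he hij hk.1 hk.2 h, mul_zero]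
  set e' : Fin n → Fin n → ℂ := fun a b =>
    if a = i ∧ b = j then 1 else if a = j ∧ b = i then -1 else e a b with he'
  have he'' : ∀ a b, e' a b = -e' b a := by
    intro a b
    simp only [he']
    by_cases h1 : a = i ∧ b = j
    · have h2 : ¬ (b = i ∧ a = j) := fun h2 => hij (h1.1.symm.trans h2.2)
      rw [if_pos h1, if_neg h2, if_pos ⟨h1.2, h1.1⟩, neg_neg]
    · by_cases h2 : a = j ∧ b = i
      · rw [if_neg h1, if_pos h2, if_pos ⟨h2.2, h2.1⟩]
      · rw [if_neg h1, if_neg h2, if_neg fun h => h2 ⟨h.2, h.1⟩, if_neg fun h => h1 ⟨h.2, h.1⟩,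
          he]
  have hcof : ∀ k, k = i ∨ k = j → skewCofactor e k = skewCofactor e' k := by
    intro k hk
    refine Finset.prod_congr rfl fun a _ => Finset.prod_congr rfl fun b _ => ?_
    by_cases h1 : b = k
    · simp [h1]
    by_cases h2 : a = k
    · simp [h1, h2]
    rw [if_neg h1, if_neg h2, if_neg h1, if_neg h2]
    simp only [he']
    rw [if_neg, if_neg] <;> grind
  have key := (skewCofactor_mul he'' i).trans (skewCofactor_mul he'' j).symm
  rw [← hcof i (Or.inl rfl), ← hcof j (Or.inr rfl)] at key
  have hji : j ∈ (Finset.univ.erase i : Finset (Fin n)) := by simp [hij.symm]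
  have hijm : i ∈ (Finset.univ.erase j : Finset (Fin n)) := by simp [hij]
  rw [← Finset.mul_prod_erase _ _ hji, ← Finset.mul_prod_erase _ _ hijm,
    Finset.erase_right_comm (a := j) (b := i)] at key
  set S : Finset (Fin n) := (Finset.univ.erase i).erase j with hS
  have hcard : S.card = n - 2 := by
    rw [hS, Finset.card_erase_of_mem hji, Finset.card_erase_of_mem (Finset.mem_univ i)]
    simp; omega
  have hi1 : e' j i = -1 := by simp [he', hij.symm]
  have hj1 : e' i j = 1 := by simp [he']
  have hmem : ∀ l ∈ S, l ≠ i ∧ l ≠ j := by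
    intro l hl; rw [hS] at hl; simp at hl; exact ⟨hl.2, hl.1⟩
  have hXj : ∏ l ∈ S, e' l j = ∏ l ∈ S, e l j := by
    refine Finset.prod_congr rfl fun l hl => ?_
    simp [he', (hmem l hl).1, (hmem l hl).2]
  have hXi : ∏ l ∈ S, e' l i = c ^ (n - 2) * ∏ l ∈ S, e l j := by
    rw [← hcard, ← Finset.prod_const, ← Finset.prod_mul_distrib]
    refine Finset.prod_congr rfl fun l hl => ?_
    simp only [he', (hmem l hl).1, (hmem l hl).2, false_and, if_false]
    rw [he l i, hc l, he l j]; ring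
  have hX : ∏ l ∈ S, e l j ≠ 0 :=
    Finset.prod_ne_zero_iff.mpr fun l hl => hne l (hmem l hl).1 (hmem l hl).2
  rw [hXj, hXi, hi1, hj1] at key
  have hfin : skewCofactor e j = -(c ^ (n - 2) * skewCofactor e i) := by
    apply mul_right_cancel₀ hX
    linear_combination -key
  rw [hsum, hG, hfin]; ring

end Skew


section ThetaSum

variable {n : ℕ} {q : ℂ}

/-- The theta sum with prescribed numerators `G`. -/
noncomputable def thetaSumOf (q : ℂ) (x G : Fin n → ℂ) : ℂ :=
  ∑ k, G k / ∏ i ∈ Finset.univ.erase k, (theta (x i * x k) q * theta (x i / x k) q)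

/-- The skew-symmetric theta sum with prescribed numerators `G`. -/
noncomputable def skewSumOf (q : ℂ) (x G : Fin n → ℂ) : ℂ :=
  (∏ i, ∏ j ∈ Finset.Ioi i, eFun q (x i) (x j))
    * ∑ k, x k * G k / ∏ l ∈ Finset.univ.erase k, eFun q (x l) (x k)

lemma prod_pairs_mul (x : Fin n → ℂ) :
    ∏ i, ∏ j ∈ Finset.Ioi i, (x i * x j) = (∏ i, x i) ^ (n - 1) := by
  simp only [Finset.prod_mul_distrib]
  have h1 : ∏ i : Fin n, ∏ j ∈ Finset.Ioi i, x j = ∏ j : Fin n, ∏ i ∈ Finset.Iio j, x j :=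
    Finset.prod_comm' (by simp)
  rw [h1, ← Finset.prod_mul_distrib, ← Finset.prod_pow]
  refine Finset.prod_congr rfl fun i _ => ?_
  rw [Finset.prod_const, Finset.prod_const, ← pow_add, Fin.card_Ioi, Fin.card_Iio]
  congr 1
  omega

lemma skewSumOf_mul_pow (hn : 2 ≤ n) {x : Fin n → ℂ} (hx : ∀ i, x i ≠ 0) (G : Fin n → ℂ) :
    skewSumOf q x G * (∏ i, x i) ^ (n - 2)
      = thetaSumOf q x G * thetaPairs q x
        * ∏ i, ∏ j ∈ Finset.Ioi i, (x j * theta (x i / x j) q) := by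
  have hP : ∏ i, x i ≠ 0 := Finset.prod_ne_zero_iff.mpr fun i _ => hx i
  have h1 : ∑ k, x k * G k / ∏ l ∈ Finset.univ.erase k, eFun q (x l) (x k)
      = (∏ i, x i) * thetaSumOf q x G := by
    rw [thetaSumOf, Finset.mul_sum]
    refine Finset.sum_congr rfl fun k _ => ?_
    have h2 : ∏ l ∈ Finset.univ.erase k, eFun q (x l) (x k) = x k * (∏ i, x i)⁻¹
        * ∏ i ∈ Finset.univ.erase k, (theta (x i * x k) q * theta (x i / x k) q) := by
      simp only [eFun, mul_assoc]
      rw [Finset.prod_mul_distrib, ← Finset.mul_prod_erase Finset.univ x (Finset.mem_univ k),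
        Finset.prod_inv_distrib]
      have hE : ∏ i ∈ Finset.univ.erase k, x i ≠ 0 :=
        Finset.prod_ne_zero_iff.mpr fun i _ => hx i
      rw [mul_inv, ← mul_assoc, mul_inv_cancel_left₀ (hx k)]
    rw [h2]
    have := hx k
    generalize ∏ i ∈ Finset.univ.erase k, (theta (x i * x k) q * theta (x i / x k) q) = D
    by_cases hD : D = 0
    · simp [hD]
    · field_simp
  have h3 : (∏ i, ∏ j ∈ Finset.Ioi i, eFun q (x i) (x j)) * (∏ i, x i) ^ (n - 1)
      = thetaPairs q x * ∏ i, ∏ j ∈ Finset.Ioi i, (x j * theta (x i / x j) q) := by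
    rw [← prod_pairs_mul, thetaPairs]
    simp only [← Finset.prod_mul_distrib]
    refine Finset.prod_congr rfl fun i _ => Finset.prod_congr rfl fun j _ => ?_
    have := hx i
    rw [eFun]; field_simp
  have h4 : (∏ i, x i) ^ (n - 1) = (∏ i, x i) * (∏ i, x i) ^ (n - 2) := by
    rw [← pow_succ']; congr 1; omega
  rw [skewSumOf, h1]
  linear_combination (thetaSumOf q x G) * h3
    - (∏ i, ∏ j ∈ Finset.Ioi i, eFun q (x i) (x j)) * (thetaSumOf q x G) * h4

lemma eFun_antisymm (hq : ‖q‖ < 1) {x y : ℂ} (hx : x ≠ 0) (hy : y ≠ 0) :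
    eFun q x y = -eFun q y x := by
  rw [eFun, eFun, ← inv_div x y, theta_inv hq (div_ne_zero hx hy), mul_comm y x]
  field_simp

lemma prod_pairs_perm {f : Fin n → Fin n → ℂ} (hf : ∀ i j, f i j = f j i)
    (σ : Equiv.Perm (Fin n)) :
    ∏ i, ∏ j ∈ Finset.Ioi i, f (σ i) (σ j) = ∏ i, ∏ j ∈ Finset.Ioi i, f i j := by
  set s : Fin n → Fin n → ℂ := fun i j => if i < j then 1 else if j < i then -1 else 0 with hs
  have hanti : ∀ i j, s i j = -s j i := by
    intro i j
    simp only [hs]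
    rcases lt_trichotomy i j with h | h | h
    · simp [h, h.not_gt]
    · simp [h]
    · simp [h, h.not_gt]
  have hs1 : ∀ g : Fin n → Fin n → ℂ,
      ∏ i, ∏ j ∈ Finset.Ioi i, s i j * g i j = ∏ i, ∏ j ∈ Finset.Ioi i, g i j := by
    intro g
    refine Finset.prod_congr rfl fun i _ => Finset.prod_congr rfl fun j hj => ?_
    simp [hs, Finset.mem_Ioi.mp hj]
  have h1 := Equiv.Perm.prod_Ioi_comp_eq_sign_mul_prod σ hanti
  have h2 := Equiv.Perm.prod_Ioi_comp_eq_sign_mul_prod σ (f := fun i j => s i j * f i j)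
    (fun i j => by rw [hanti i j, hf i j]; ring)
  have h3 := hs1 fun _ _ => 1
  simp only [mul_one, Finset.prod_const_one] at h3
  rw [h3, mul_one] at h1
  rw [hs1] at h2
  simp only [Finset.prod_mul_distrib] at h2
  rw [h1] at h2
  refine mul_left_cancel₀ ?_ h2
  simp

lemma thetaPairs_perm (x : Fin n → ℂ) (σ : Equiv.Perm (Fin n)) :
    thetaPairs q (fun i => x (σ i)) = thetaPairs q x :=
  prod_pairs_perm (f := fun i j => theta (x i * x j) q) (fun i j => by rw [mul_comm]) σ

lemma thetaSumOf_perm (x G : Fin n → ℂ) (σ : Equiv.Perm (Fin n)) :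
    thetaSumOf q (fun i => x (σ i)) (fun i => G (σ i)) = thetaSumOf q x G := by
  rw [thetaSumOf, thetaSumOf]
  conv_rhs => rw [← Equiv.sum_comp σ]
  refine Finset.sum_congr rfl fun k _ => ?_
  congr 1
  refine Finset.prod_bij (fun i _ => σ i) ?_ ?_ ?_ ?_ <;> simp
  intro b hb
  exact ⟨σ.symm b, by rwa [Equiv.symm_apply_eq], by simp⟩

/-- `(x, G)` and `(y, G')` are multiplied by compatible factors in the terms of a theta sum. -/
def ThetaRel (n : ℕ) (q : ℂ) (p p' : ℂ × ℂ) : Prop :=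
  ∃ c : ℂ, c ≠ 0 ∧ (∀ v, v ≠ 0 → eFun q p.1 v = c * eFun q p'.1 v) ∧
    p.1 * p.2 = c ^ (n - 2) * (p'.1 * p'.2)

lemma ThetaRel.refl (p : ℂ × ℂ) : ThetaRel n q p p := ⟨1, one_ne_zero, by simp, by simp⟩

lemma ThetaRel.symm {p p' : ℂ × ℂ} (h : ThetaRel n q p p') : ThetaRel n q p' p := by
  obtain ⟨c, hc, h1, h2⟩ := h
  refine ⟨c⁻¹, inv_ne_zero hc, fun v hv => ?_, ?_⟩
  · rw [h1 v hv, inv_mul_cancel_left₀ hc]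
  · rw [h2, inv_pow, inv_mul_cancel_left₀ (pow_ne_zero _ hc)]

lemma ThetaRel.trans {p p' p'' : ℂ × ℂ} (h : ThetaRel n q p p') (h' : ThetaRel n q p' p'') :
    ThetaRel n q p p'' := by
  obtain ⟨c, hc, h1, h2⟩ := h
  obtain ⟨d, hd, h3, h4⟩ := h'
  refine ⟨c * d, mul_ne_zero hc hd, fun v hv => ?_, ?_⟩
  · rw [h1 v hv, h3 v hv, mul_assoc]
  · rw [h2, h4, mul_pow, mul_assoc]

lemma ThetaRel.int_induction {P : ℤ → ℂ × ℂ} (h : ∀ m, ThetaRel n q (P (m + 1)) (P m)) (m : ℤ) :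
    ThetaRel n q (P m) (P 0) := by
  induction m using Int.induction_on with
  | zero => exact .refl _
  | succ k ih => exact (h k).trans ih
  | pred k ih =>
    have := h (-(k : ℤ) - 1)
    rw [sub_add_cancel] at this
    exact this.symm.trans ih

lemma eFun_mul_base (hq : ‖q‖ < 1) (hq0 : q ≠ 0) {x v : ℂ} (hx : x ≠ 0) (hv : v ≠ 0) :
    eFun q (q * x) v = q⁻¹ * (x ^ 2)⁻¹ * eFun q x v := by
  rw [eFun, eFun, mul_assoc q x v, mul_div_assoc, theta_mul_base hq hq0 (mul_ne_zero hx hv),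
    theta_mul_base hq hq0 (div_ne_zero hx hv)]
  field_simp

lemma thetaRel_mul_base (hq : ‖q‖ < 1) (hq0 : q ≠ 0) (hn : 2 ≤ n) {x : ℂ} (hx : x ≠ 0) (G : ℂ) :
    ThetaRel n q (q * x, G / (q ^ (n - 1) * x ^ (2 * n - 4))) (x, G) := by
  obtain ⟨k, rfl⟩ := Nat.exists_eq_add_of_le' hn
  refine ⟨q⁻¹ * (x ^ 2)⁻¹, by positivity, fun v hv => eFun_mul_base hq hq0 hx hv, ?_⟩
  rw [show k + 2 - 1 = k + 1 by omega, show 2 * (k + 2) - 4 = 2 * k by omega,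
    show k + 2 - 2 = k by omega, mul_pow, inv_pow, inv_pow, ← pow_mul, pow_succ]
  field_simp

lemma thetaExp_add (u v : ℂ) : thetaExp q (u + v) = theta (exp u * exp v) q := by
  rw [thetaExp, exp_add]

lemma thetaExp_sub (u v : ℂ) : thetaExp q (u - v) = theta (exp u / exp v) q := by
  rw [thetaExp, exp_sub]

lemma eFun_exp (u v : ℂ) :
    eFun q (exp u) (exp v) = exp (-u) * thetaExp q (u + v) * thetaExp q (u - v) := by
  rw [eFun, thetaExp_add, thetaExp_sub, exp_neg]

lemma pairGeneric_iff (u : Fin n → ℂ) :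
    PairGeneric (thetaExp q) u ↔ Generic q fun i => exp (u i) := by
  simp only [PairGeneric, Generic, thetaExp_add, thetaExp_sub]

/-- In logarithmic variables, the product of the theta sum with `∏_{i < j} θ(x_i x_j)` continues
holomorphically over the zeros of the denominators. -/
theorem exists_thetaSum_continuation (hq : ‖q‖ < 1) (hq0 : q ≠ 0) (hn : 2 ≤ n)
    {Ω : Set (Fin n → ℂ)} (hΩ : IsOpen Ω) {W : Set ℂ} (hW : IsOpen W) {γ : ℂ → ℂ}
    (hγ : DifferentiableOn ℂ γ W) (hΩW : ∀ u ∈ Ω, ∀ i, u i ∈ W)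
    (hrel : ∀ u ∈ Ω, ∀ i j, i ≠ j → thetaExp q (u i - u j) = 0 →
      ThetaRel n q (exp (u i), γ (u i)) (exp (u j), γ (u j))) :
    ∃ H : (Fin n → ℂ) → ℂ, ContDiffOn ℂ 1 H Ω ∧
      ∀ u ∈ Ω, PairGeneric (thetaExp q) u →
        H u = thetaSumOf q (fun i => exp (u i)) (fun i => γ (u i))
          * thetaPairs q fun i => exp (u i) := by
  set e : (Fin n → ℂ) → Fin n → Fin n → ℂ := fun u i j => eFun q (exp (u i)) (exp (u j)) with he
  have hanti : ∀ u i j, e u i j = -e u j i := fun u i j =>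
    eFun_antisymm hq (exp_ne_zero _) (exp_ne_zero _)
  set F : (Fin n → ℂ) → ℂ := fun u => ∑ k, exp (u k) * γ (u k) * skewCofactor (e u) k with hF
  have hδ := differentiable_thetaExp hq
  have hδ' : ∀ z, thetaExp q z = 0 → deriv (thetaExp q) z ≠ 0 := fun z =>
    deriv_thetaExp_ne_zero hq hq0
  have hecd : ∀ i j, ContDiff ℂ 1 fun u : Fin n → ℂ => e u i j := by
    intro i j
    simp only [he, eFun_exp]
    have h1 : ContDiff ℂ 1 (thetaExp q) := hδ.contDiff
    exact ((contDiff_exp.comp (by fun_prop)).mul (h1.comp (by fun_prop))).mul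
      (h1.comp (by fun_prop))
  have hcof : ∀ k, ContDiff ℂ 1 fun u => skewCofactor (e u) k := by
    intro k
    refine contDiff_prod fun i _ => contDiff_prod fun j _ => ?_
    split_ifs
    · exact contDiff_const
    · exact contDiff_const
    · exact hecd i j
  have hFcd : ContDiffOn ℂ 1 F Ω := by
    refine ContDiffOn.sum fun k _ => ?_
    refine ContDiffOn.mul (ContDiffOn.mul ?_ ?_) (hcof k).contDiffOn
    · exact (contDiff_exp.comp (contDiff_apply ℂ ℂ k)).contDiffOn
    · exact (hγ.contDiffOn hW).comp (contDiff_apply ℂ ℂ k).contDiffOn fun u hu => hΩW u hu k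
  obtain ⟨H, hH, hFH⟩ := exists_eq_mul_prod_pairs hδ hδ' hΩ hFcd (fun u hu i j hij h0 h1 h2 => by
      obtain ⟨c, hc, hc1, hc2⟩ := hrel u hu i j hij h0
      refine sum_mul_skewCofactor_eq_zero (hanti u) hij (j := j) ?_ (fun l hli hlj => ?_)
        (c := c) (fun l => hc1 _ (exp_ne_zero _)) hc2
      · simp only [he, eFun_exp, h0, mul_zero]
      · simp only [he, eFun_exp]
        exact mul_ne_zero (mul_ne_zero (exp_ne_zero _) (h2 l j hlj))
          (h1 l j hlj (Or.inl hli) (Or.inl hlj)))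
    (Finset.univ.filter fun p : Fin n × Fin n => p.1 < p.2) (by simp)
  have hpairs : ∀ f : Fin n → Fin n → ℂ,
      ∏ p ∈ Finset.univ.filter (fun p : Fin n × Fin n => p.1 < p.2), f p.1 p.2
        = ∏ i, ∏ j ∈ Finset.Ioi i, f i j := by
    intro f
    rw [Finset.prod_filter, ← Finset.univ_product_univ, Finset.prod_product]
    refine Finset.prod_congr rfl fun i _ => ?_
    rw [← Finset.prod_filter]
    refine Finset.prod_congr ?_ fun _ _ => rfl
    ext j; simp
  have hpne : ∀ u : Fin n → ℂ, ∏ i, ∏ j ∈ Finset.Ioi i, exp (u j) ≠ 0 := fun u =>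
    Finset.prod_ne_zero_iff.mpr fun i _ => Finset.prod_ne_zero_iff.mpr fun j _ => exp_ne_zero _
  have hexpcd : ∀ i : Fin n, ContDiff ℂ 1 fun u : Fin n → ℂ => exp (u i) := fun i =>
    contDiff_exp.comp (contDiff_apply ℂ ℂ i)
  refine ⟨fun u => H u / (∏ i, ∏ j ∈ Finset.Ioi i, exp (u j)) * (∏ i, exp (u i)) ^ (n - 2),
    ?_, fun u hu hgen => ?_⟩
  · refine (hH.div (ContDiff.contDiffOn ?_) fun u _ => hpne u).mul (ContDiff.contDiffOn ?_)
    · exact contDiff_prod fun i _ => contDiff_prod fun j _ => hexpcd j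
    · exact (contDiff_prod fun i _ => hexpcd i).pow _
  · have hΔ : ∏ i, ∏ j ∈ Finset.Ioi i, (exp (u j) * theta (exp (u i) / exp (u j)) q)
        = (∏ i, ∏ j ∈ Finset.Ioi i, exp (u j))
          * ∏ i, ∏ j ∈ Finset.Ioi i, thetaExp q (u i - u j) := by
      simp only [thetaExp_sub, Finset.prod_mul_distrib]
    have hne : ∏ i, ∏ j ∈ Finset.Ioi i, thetaExp q (u i - u j) ≠ 0 :=
      Finset.prod_ne_zero_iff.mpr fun i _ => Finset.prod_ne_zero_iff.mpr fun j hj =>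
        (hgen i j (Finset.mem_Ioi.mp hj).ne).2
    have hFs : F u = skewSumOf q (fun i => exp (u i)) (fun i => γ (u i)) := by
      simp only [hF, skewSumOf]
      rw [Finset.mul_sum]
      refine Finset.sum_congr rfl fun k _ => ?_
      have h1 := skewCofactor_mul (hanti u) k
      have h2 : ∏ l ∈ Finset.univ.erase k, e u l k ≠ 0 := by
        refine Finset.prod_ne_zero_iff.mpr fun l hl => ?_
        have hlk : l ≠ k := Finset.ne_of_mem_erase hl
        simp only [he, eFun_exp]
        exact mul_ne_zero (mul_ne_zero (exp_ne_zero _) (hgen l k hlk).1) (hgen l k hlk).2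
      change _ = (∏ i, ∏ j ∈ Finset.Ioi i, e u i j) * (_ / ∏ l ∈ Finset.univ.erase k, e u l k)
      rw [← h1]
      field_simp
    have h1 := skewSumOf_mul_pow (q := q) hn (x := fun i => exp (u i)) (fun i => exp_ne_zero _)
      fun i => γ (u i)
    rw [← hFs, hFH u hu, hpairs (fun i j => thetaExp q (u i - u j)), hΔ] at h1
    have h2 := hpne u
    apply mul_right_cancel₀ (mul_ne_zero h2 hne)
    rw [← h1]
    field_simp

end ThetaSum


section PartA

variable {n : ℕ} {q : ℂ}

lemma exists_theta_continuation_exp (hq : ‖q‖ < 1) (hq0 : q ≠ 0) (hn : 2 ≤ n) {U : Set ℂ}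
    (hU : IsOpen U) (hqU : ∀ x : ℂ, q * x ∈ U ↔ x ∈ U) {g : ℂ → ℂ}
    (hg : DifferentiableOn ℂ g U)
    (hgq : ∀ x ∈ U, g (q * x) = g x / (q ^ (n - 1) * x ^ (2 * n - 4))) :
    ∃ H : (Fin n → ℂ) → ℂ, ContDiffOn ℂ 1 H {u | ∀ i, exp (u i) ∈ U} ∧
      ∀ u : Fin n → ℂ, (∀ i, exp (u i) ∈ U) → PairGeneric (thetaExp q) u →
        H u = thetaSum q g (fun i => exp (u i)) * thetaPairs q fun i => exp (u i) := by
  have hΩ : IsOpen {u : Fin n → ℂ | ∀ i, exp (u i) ∈ U} := by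
    simp only [Set.ofPred_forall]
    exact isOpen_iInter_of_finite fun i => hU.preimage (by fun_prop)
  refine exists_thetaSum_continuation hq hq0 hn hΩ (W := exp ⁻¹' U) (hU.preimage continuous_exp)
    (γ := fun u => g (exp u)) (hg.comp differentiable_exp.differentiableOn fun u hu => hu)
    (fun u hu i => hu i) fun u hu i j hij h0 => ?_
  obtain ⟨m, hm⟩ := (theta_eq_zero_iff hq hq0 (exp_ne_zero (u i - u j))).mp h0
  have hmem : ∀ m : ℤ, q ^ m * exp (u j) ∈ U := by
    intro m
    induction m using Int.induction_on with
    | zero => simpa using hu j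
    | succ k ih => rwa [zpow_add_one₀ hq0, mul_comm (q ^ _) q, mul_assoc, hqU]
    | pred k ih =>
      rwa [← hqU, ← mul_assoc, ← zpow_one_add₀ hq0, add_sub_cancel]
  have hrel : ∀ m : ℤ, ThetaRel n q
      (q ^ (m + 1) * exp (u j), g (q ^ (m + 1) * exp (u j)))
      (q ^ m * exp (u j), g (q ^ m * exp (u j))) := by
    intro m
    have h := thetaRel_mul_base hq hq0 hn (x := q ^ m * exp (u j))
      (mul_ne_zero (zpow_ne_zero m hq0) (exp_ne_zero _)) (g (q ^ m * exp (u j)))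
    rwa [← hgq _ (hmem m), ← mul_assoc, ← zpow_one_add₀ hq0, add_comm 1 m] at h
  have h := ThetaRel.int_induction
    (P := fun m : ℤ => (q ^ m * exp (u j), g (q ^ m * exp (u j)))) hrel m
  have hx : exp (u i) = q ^ m * exp (u j) := by
    rw [← hm, ← exp_add, sub_add_cancel]
  simpa only [zpow_zero, one_mul, ← hx] using h

lemma exp_log_comp {x : Fin n → ℂ} (hx : ∀ i, x i ≠ 0) : (fun i => exp (log (x i))) = x :=
  funext fun i => exp_log (hx i)

/-- The product of the theta sum with `∏_{i < j} θ(x_i x_j)` continues to a symmetric holomorphic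
function of the variables. -/
theorem exists_symm_thetaSum_continuation (hq : ‖q‖ < 1) (hq0 : q ≠ 0) (hn : 2 ≤ n) {U : Set ℂ}
    (hU : IsOpen U) (hU0 : (0 : ℂ) ∉ U) (hqU : ∀ x : ℂ, q * x ∈ U ↔ x ∈ U) {g : ℂ → ℂ}
    (hg : DifferentiableOn ℂ g U)
    (hgq : ∀ x ∈ U, g (q * x) = g x / (q ^ (n - 1) * x ^ (2 * n - 4))) :
    ∃ h : (Fin n → ℂ) → ℂ, IsSymmHolomorphic U h ∧
      ∀ x : Fin n → ℂ, (∀ i, x i ∈ U) → Generic q x →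
        h x = thetaSum q g x * thetaPairs q x := by
  obtain ⟨H, hH, hHgen⟩ := exists_theta_continuation_exp hq hq0 hn hU hqU hg hgq
  set Ω : Set (Fin n → ℂ) := {u | ∀ i, exp (u i) ∈ U} with hΩdef
  have hΩ : IsOpen Ω := by
    simp only [hΩdef, Set.ofPred_forall]
    exact isOpen_iInter_of_finite fun i => hU.preimage (by fun_prop)
  have hδ := differentiable_thetaExp hq
  have hδ' : ∀ z, thetaExp q z = 0 → deriv (thetaExp q) z ≠ 0 := fun z =>
    deriv_thetaExp_ne_zero hq hq0
  have hne : ∀ x ∈ U, x ≠ 0 := fun x hx h => hU0 (h ▸ hx)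
  have hper : ∀ u ∈ Ω, ∀ u' : Fin n → ℂ, (∀ i, exp (u' i) = exp (u i)) → H u' = H u := by
    intro u hu u' huu'
    set d : Fin n → ℂ := u' - u with hd
    have hexp : ∀ (v : Fin n → ℂ) i, exp ((v + d) i) = exp (v i) := by
      intro v i
      rw [Pi.add_apply, exp_add, hd, Pi.sub_apply, exp_sub, huu', div_self (exp_ne_zero _), mul_one]
    have hmaps : ∀ v ∈ Ω, v + d ∈ Ω := fun v hv i => by rw [hexp]; exact hv i
    have := eqOn_of_pairGeneric hδ hδ' hΩ (f := fun v => H (v + d)) (g := H)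
      (hH.continuousOn.comp (by fun_prop) hmaps) hH.continuousOn (fun v hv hgen => by
        have hgen' : PairGeneric (thetaExp q) (v + d) := by
          rw [pairGeneric_iff] at hgen ⊢
          simpa only [hexp] using hgen
        change H (v + d) = H v
        rw [hHgen v hv hgen, hHgen _ (hmaps v hv) hgen']
        simp only [hexp]) hu
    rwa [hd, add_sub_cancel] at this
  refine ⟨fun x => H fun i => log (x i), ⟨?_, ?_⟩, ?_⟩
  · intro x₀ hx₀
    refine DifferentiableAt.differentiableWithinAt ?_
    set L : (Fin n → ℂ) → Fin n → ℂ := fun x i => log (x₀ i) + log (x i / x₀ i) with hL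
    have hL0 : L x₀ = fun i => log (x₀ i) := by
      funext i; simp [hL, div_self (hne _ (hx₀ i))]
    have hLd : DifferentiableAt ℂ L x₀ := by
      refine differentiableAt_pi.mpr fun i => ?_
      change DifferentiableAt ℂ (fun x : Fin n → ℂ => log (x₀ i) + log (x i / x₀ i)) x₀
      refine DifferentiableAt.const_add _ ?_
      have h1 : DifferentiableAt ℂ (fun x : Fin n → ℂ => x i / x₀ i) x₀ := by fun_prop
      refine h1.clog ?_
      rw [div_self (hne _ (hx₀ i))]; exact one_mem_slitPlane
    have hmem : (fun i => log (x₀ i)) ∈ Ω := fun i => by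
      rw [exp_log (hne _ (hx₀ i))]; exact hx₀ i
    have hHd : DifferentiableAt ℂ H (L x₀) := by
      rw [hL0]
      exact (hH.differentiableOn one_ne_zero).differentiableAt (hΩ.mem_nhds hmem)
    refine (DifferentiableAt.comp x₀ hHd hLd).congr_of_eventuallyEq ?_
    have hV : IsOpen {x : Fin n → ℂ | ∀ i, x i ∈ U} := by
      simp only [Set.ofPred_forall]
      exact isOpen_iInter_of_finite fun i => hU.preimage (continuous_apply i)
    filter_upwards [hV.mem_nhds hx₀] with x hx
    have h2 : ∀ i, exp (L x i) = x i := fun i => by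
      rw [hL]
      change exp (log (x₀ i) + log (x i / x₀ i)) = _
      rw [exp_add, exp_log (hne _ (hx₀ i)), exp_log (div_ne_zero (hne _ (hx i)) (hne _ (hx₀ i))),
        mul_div_cancel₀ _ (hne _ (hx₀ i))]
    exact hper (L x) (fun i => by rw [h2]; exact hx i) _ fun i => by
      rw [h2, exp_log (hne _ (hx i))]
  · intro x hx σ
    have hmem : (fun i => log (x i)) ∈ Ω := fun i => by
      rw [exp_log (hne _ (hx i))]; exact hx i
    have hmaps : ∀ v ∈ Ω, (fun i => v (σ i)) ∈ Ω := fun v hv i => hv (σ i)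
    exact eqOn_of_pairGeneric hδ hδ' hΩ (f := fun v => H fun i => v (σ i)) (g := H)
      (hH.continuousOn.comp (by fun_prop) hmaps) hH.continuousOn (fun v hv hgen => by
        have hgen' : PairGeneric (thetaExp q) fun i => v (σ i) := fun i j hij =>
          hgen (σ i) (σ j) (σ.injective.ne hij)
        change H (fun i => v (σ i)) = H v
        rw [hHgen v hv hgen, hHgen _ (hmaps v hv) hgen',
          thetaPairs_perm (fun i => exp (v i)) σ]
        congr 1
        exact thetaSumOf_perm (fun i => exp (v i)) (fun i => g (exp (v i))) σ) hmem
  · intro x hx hgen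
    have hmem : (fun i => log (x i)) ∈ Ω := fun i => by
      rw [exp_log (hne _ (hx i))]; exact hx i
    have hxx := exp_log_comp fun i => hne _ (hx i)
    have := hHgen _ hmem (by rw [pairGeneric_iff, hxx]; exact hgen)
    rwa [hxx] at this

lemma thetaPairs_ne_zero {x : Fin n → ℂ} (hx : Generic q x) : thetaPairs q x ≠ 0 :=
  Finset.prod_ne_zero_iff.mpr fun i _ => Finset.prod_ne_zero_iff.mpr fun j hj =>
    (hx i j (Finset.mem_Ioi.mp hj).ne).1

theorem exists_divided_skewSum (hq : ‖q‖ < 1) (hq0 : q ≠ 0) (hn : 2 < n) {U : Set ℂ}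
    (hU : IsOpen U) (hU0 : (0 : ℂ) ∉ U) (hqU : ∀ x : ℂ, q * x ∈ U ↔ x ∈ U) {g : ℂ → ℂ}
    (hg : DifferentiableOn ℂ g U)
    (hgq : ∀ x ∈ U, g (q * x) = g x / (q ^ (n - 1) * x ^ (2 * n - 4))) :
    ∃ h h' : (Fin n → ℂ) → ℂ, IsSymmHolomorphic U h ∧ IsSymmHolomorphic U h' ∧
      ∀ x : Fin n → ℂ, (∀ i, x i ∈ U) →
        h x = (∏ i, x i) ^ (n - 2) * h' x ∧
        (Generic q x →
          skewSum q g x = h' x * ∏ i, ∏ j ∈ Finset.Ioi i, (x j * theta (x i / x j) q) ∧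
          thetaSum q g x = h x / thetaPairs q x) := by
  obtain ⟨h, hh, hgen⟩ := exists_symm_thetaSum_continuation hq hq0 hn.le hU hU0 hqU hg hgq
  have hne : ∀ x ∈ U, x ≠ 0 := fun x hx h => hU0 (h ▸ hx)
  have hP : ∀ x : Fin n → ℂ, (∀ i, x i ∈ U) → (∏ i, x i) ^ (n - 2) ≠ 0 := fun x hx =>
    pow_ne_zero _ (Finset.prod_ne_zero_iff.mpr fun i _ => hne _ (hx i))
  refine ⟨h, fun x => h x / (∏ i, x i) ^ (n - 2), hh, ⟨?_, ?_⟩, fun x hx => ⟨?_, fun hx' => ?_⟩⟩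
  · simp only [div_eq_mul_inv]
    refine hh.1.mul (DifferentiableOn.fun_inv ?_ hP)
    have hd : ContDiff ℂ 1 fun x : Fin n → ℂ => ∏ i, x i :=
      contDiff_prod fun i _ => contDiff_apply ℂ ℂ i
    exact ((hd.differentiable one_ne_zero).pow _).differentiableOn
  · intro x hx σ
    beta_reduce
    rw [hh.2 x hx σ, Equiv.prod_comp σ]
  · exact (mul_div_cancel₀ _ (hP x hx)).symm
  · refine ⟨?_, ?_⟩
    · beta_reduce
      have h1 := skewSumOf_mul_pow (q := q) hn.le (fun i => hne _ (hx i)) fun i => g (x i)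
      rw [hgen x hx hx', div_mul_eq_mul_div, eq_div_iff (hP x hx)]
      exact h1
    · rw [hgen x hx hx', mul_div_cancel_right₀ _ (thetaPairs_ne_zero hx')]

end PartA


section QLog

variable {ℓ : ℂ} {N : ℕ}

/-- The coordinate `v` of `u = α ℓ + i v` with real `α`, `v`. -/
noncomputable def height (ℓ u : ℂ) : ℝ := u.im - u.re / ℓ.re * ℓ.im

lemma continuous_height (ℓ : ℂ) : Continuous (height ℓ) := by
  unfold height; fun_prop

lemma height_add (ℓ u v : ℂ) : height ℓ (u + v) = height ℓ u + height ℓ v := by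
  simp only [height, add_im, add_re]; ring

lemma height_neg (ℓ u : ℂ) : height ℓ (-u) = -height ℓ u := by
  simp only [height, neg_im, neg_re]; ring

lemma height_sub (ℓ u v : ℂ) : height ℓ (u - v) = height ℓ u - height ℓ v := by
  rw [sub_eq_add_neg, height_add, height_neg, sub_eq_add_neg]

lemma height_real_mul (hℓ : ℓ.re < 0) (t : ℝ) : height ℓ (t * ℓ) = 0 := by
  have := hℓ.ne
  simp only [height, re_ofReal_mul, im_ofReal_mul]
  field_simp
  ring

lemma height_real_mul_I (ℓ : ℂ) (t : ℝ) : height ℓ (t * I) = t := by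
  simp [height]

lemma height_base (hℓ : ℓ.re < 0) : height ℓ ℓ = 0 := by
  simpa using height_real_mul hℓ 1

lemma height_two_pi (ℓ : ℂ) (k : ℤ) : height ℓ (k * (2 * Real.pi * I)) = k * (2 * Real.pi) := by
  have := height_real_mul_I ℓ (k * (2 * Real.pi))
  rw [← this]; congr 1; push_cast; ring

/-- `x q^{-α}` with `α = log |x| / log |q|`, a number of modulus one. -/
noncomputable def qUnit (ℓ x : ℂ) : ℂ := x * exp (-(((Real.log ‖x‖ / ℓ.re : ℝ) : ℂ) * ℓ))

lemma qLog_eq (ℓ x : ℂ) :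
    qLog ℓ x = ((Real.log ‖x‖ / ℓ.re : ℝ) : ℂ) * ℓ + log (qUnit ℓ x) := rfl

lemma norm_qUnit (hℓ : ℓ.re < 0) {x : ℂ} (hx : x ≠ 0) : ‖qUnit ℓ x‖ = 1 := by
  rw [qUnit, norm_mul, norm_exp, neg_re, re_ofReal_mul, div_mul_cancel₀ _ hℓ.ne, Real.exp_neg,
    Real.exp_log (norm_pos_iff.mpr hx)]
  exact mul_inv_cancel₀ (norm_ne_zero_iff.mpr hx)

lemma qUnit_ne_zero (hℓ : ℓ.re < 0) {x : ℂ} (hx : x ≠ 0) : qUnit ℓ x ≠ 0 := by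
  rw [← norm_ne_zero_iff, norm_qUnit hℓ hx]; exact one_ne_zero

lemma exp_qLog (hℓ : ℓ.re < 0) {x : ℂ} (hx : x ≠ 0) : exp (qLog ℓ x) = x := by
  rw [qLog_eq, exp_add, exp_log (qUnit_ne_zero hℓ hx), qUnit, mul_comm, mul_assoc, ← exp_add,
    neg_add_cancel, exp_zero, mul_one]

lemma height_qLog (hℓ : ℓ.re < 0) {x : ℂ} (hx : x ≠ 0) :
    height ℓ (qLog ℓ x) = arg (qUnit ℓ x) := by
  rw [qLog_eq, height_add, height_real_mul hℓ, zero_add, height, log_re, log_im,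
    norm_qUnit hℓ hx]
  simp

lemma height_qLog_mem (hℓ : ℓ.re < 0) {x : ℂ} (hx : x ≠ 0) :
    -Real.pi < height ℓ (qLog ℓ x) ∧ height ℓ (qLog ℓ x) ≤ Real.pi := by
  rw [height_qLog hℓ hx]; exact ⟨neg_pi_lt_arg _, arg_le_pi _⟩

lemma eq_of_exp_eq_of_height {u v : ℂ} (h : exp u = exp v)
    (hh : |height ℓ u - height ℓ v| < 2 * Real.pi) : u = v := by
  obtain ⟨k, hk⟩ := exp_eq_exp_iff_exists_int.mp h
  rw [hk, height_add, height_two_pi, add_sub_cancel_left, abs_mul,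
    abs_of_pos Real.two_pi_pos] at hh
  have h1 : |(k : ℝ)| < 1 := by
    by_contra! h1
    nlinarith [Real.pi_pos]
  have h2 : |k| < 1 := by exact_mod_cast h1
  rw [hk, Int.abs_lt_one_iff.mp h2]; simp

lemma qLog_exp (hℓ : ℓ.re < 0) {u : ℂ} (h1 : -Real.pi < height ℓ u) (h2 : height ℓ u ≤ Real.pi) :
    qLog ℓ (exp u) = u := by
  have h := height_qLog_mem hℓ (exp_ne_zero u)
  refine eq_of_exp_eq_of_height (ℓ := ℓ) (exp_qLog hℓ (exp_ne_zero u)) ?_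
  rw [abs_lt]; constructor <;> linarith [h.1, h.2]

lemma mem_varDomain_iff (hℓ : ℓ.re < 0) {x : ℂ} :
    x ∈ varDomain N ℓ ↔ x ≠ 0 ∧ (Odd N → qUnit ℓ x ∈ slitPlane) := by
  refine and_congr_right fun hx => imp_congr_right fun _ => ?_
  constructor
  · intro h
    rw [mem_slitPlane_iff_arg]
    refine ⟨fun harg => ?_, qUnit_ne_zero hℓ hx⟩
    refine h (Real.log ‖x‖ / ℓ.re) ?_
    have h1 : qUnit ℓ x = -1 := by
      have := norm_mul_exp_arg_mul_I (qUnit ℓ x)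
      rw [norm_qUnit hℓ hx, harg, exp_pi_mul_I] at this
      simpa using this.symm
    rw [qUnit, exp_neg] at h1
    field_simp at h1
    exact h1
  · rintro h u rfl
    have h1 : Real.log ‖-exp (u * ℓ)‖ / ℓ.re = u := by
      rw [norm_neg, norm_exp, Real.log_exp, re_ofReal_mul, mul_div_cancel_right₀ _ hℓ.ne]
    rw [qUnit, h1, exp_neg, neg_mul, mul_inv_cancel₀ (exp_ne_zero _)] at h
    simp [slitPlane] at h
    linarith

lemma height_qLog_lt (hℓ : ℓ.re < 0) (hN : Odd N) {x : ℂ} (hx : x ∈ varDomain N ℓ) :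
    |height ℓ (qLog ℓ x)| < Real.pi := by
  obtain ⟨hx0, hx1⟩ := (mem_varDomain_iff hℓ).mp hx
  have h := height_qLog_mem hℓ hx0
  rw [abs_lt]
  refine ⟨h.1, lt_of_le_of_ne h.2 ?_⟩
  rw [height_qLog hℓ hx0]
  exact (mem_slitPlane_iff_arg.mp (hx1 hN)).1

lemma exp_mem_varDomain (hℓ : ℓ.re < 0) {u : ℂ} (h : Odd N → |height ℓ u| < Real.pi) :
    exp u ∈ varDomain N ℓ := by
  refine (mem_varDomain_iff hℓ).mpr ⟨exp_ne_zero u, fun hN => ?_⟩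
  have hu := abs_lt.mp (h hN)
  rw [mem_slitPlane_iff_arg, ← height_qLog hℓ (exp_ne_zero u), qLog_exp hℓ hu.1 hu.2.le]
  exact ⟨hu.2.ne, qUnit_ne_zero hℓ (exp_ne_zero u)⟩

lemma continuousAt_qUnit (ℓ : ℂ) {x : ℂ} (hx : x ≠ 0) : ContinuousAt (qUnit ℓ) x := by
  have h1 : ContinuousAt (fun x : ℂ => Real.log ‖x‖) x :=
    ContinuousAt.log continuous_norm.continuousAt (norm_ne_zero_iff.mpr hx)
  unfold qUnit
  refine continuousAt_id.mul (ContinuousAt.cexp (ContinuousAt.neg (ContinuousAt.mul ?_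
    continuousAt_const)))
  exact continuous_ofReal.continuousAt.comp (h1.div_const _)

lemma isOpen_varDomain (hℓ : ℓ.re < 0) : IsOpen (varDomain N ℓ) := by
  rw [isOpen_iff_mem_nhds]
  intro x hx
  obtain ⟨hx0, hx1⟩ := (mem_varDomain_iff hℓ).mp hx
  by_cases hN : Odd N
  · filter_upwards [eventually_ne_nhds hx0,
      (continuousAt_qUnit ℓ hx0).eventually (isOpen_slitPlane.mem_nhds (hx1 hN))] with y hy hy'
    exact (mem_varDomain_iff hℓ).mpr ⟨hy, fun _ => hy'⟩
  · filter_upwards [eventually_ne_nhds hx0] with y hy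
    exact (mem_varDomain_iff hℓ).mpr ⟨hy, fun h => absurd h hN⟩

lemma zero_notMem_varDomain : (0 : ℂ) ∉ varDomain N ℓ := fun h => h.1 rfl

lemma base_mul_mem_varDomain (x : ℂ) : base ℓ * x ∈ varDomain N ℓ ↔ x ∈ varDomain N ℓ := by
  have hb : base ℓ ≠ 0 := base_ne_zero ℓ
  refine and_congr (by simp [hb]) (imp_congr_right fun _ => ⟨fun h u hu => ?_, fun h u hu => ?_⟩)
  · refine h (u + 1) ?_
    rw [hu, base, mul_neg, ← exp_add]; congr 2; push_cast; ring
  · refine h (u - 1) ?_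
    apply mul_left_cancel₀ hb
    rw [hu, base, mul_neg, ← exp_add]; congr 2; push_cast; ring

lemma differentiableAt_qLog (hℓ : ℓ.re < 0) (hN : Odd N) {x : ℂ} (hx : x ∈ varDomain N ℓ) :
    DifferentiableAt ℂ (qLog ℓ) x := by
  obtain ⟨hx0, hx1⟩ := (mem_varDomain_iff hℓ).mp hx
  have h1 : ContinuousAt (fun x : ℂ => Real.log ‖x‖) x :=
    ContinuousAt.log continuous_norm.continuousAt (norm_ne_zero_iff.mpr hx0)
  have hc : ContinuousAt (qLog ℓ) x := by
    refine ContinuousAt.add (ContinuousAt.mul ?_ continuousAt_const) ?_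
    · exact continuous_ofReal.continuousAt.comp (h1.div_const _)
    · exact (continuousAt_qUnit ℓ hx0).clog (hx1 hN)
  refine (HasDerivAt.of_local_left_inverse hc (hasDerivAt_exp _) (exp_ne_zero _)
    ?_).differentiableAt
  filter_upwards [eventually_ne_nhds hx0] with y hy using exp_qLog hℓ hy

end QLog

section GFun

variable {ℓ : ℂ} {N : ℕ}

/-- The function `g_N` in the logarithmic variable. -/
noncomputable def gExp (N : ℕ) (ℓ u : ℂ) : ℂ :=
  exp (((N : ℂ) / 2 - 1) * u) * thetaExp (halfBase N ℓ) (-(N * u))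

lemma gFun_eq (hℓ : ℓ.re < 0) {x : ℂ} (hx : x ≠ 0) : gFun N ℓ x = gExp N ℓ (qLog ℓ x) := by
  rw [gFun, gExp, qLogPow, thetaExp, exp_neg, exp_nat_mul, exp_qLog hℓ hx]

lemma differentiable_gExp (hN : 2 ≤ N) (hℓ : ℓ.re < 0) : Differentiable ℂ (gExp N ℓ) := by
  have h := differentiable_thetaExp (norm_halfBase_lt_one hN hℓ)
  unfold gExp
  exact (differentiable_exp.comp (by fun_prop)).mul (h.comp (by fun_prop))

lemma gExp_add_base (hN : 2 ≤ N) (hℓ : ℓ.re < 0) (u : ℂ) :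
    gExp N ℓ (u + ℓ) = gExp N ℓ u / (base ℓ ^ (N + 1) * exp u ^ (2 * N)) := by
  set p := halfBase N ℓ with hp
  have hp0 : p ≠ 0 := exp_ne_zero _
  have hp1 := norm_halfBase_lt_one hN hℓ
  have hb := base_ne_zero ℓ
  have h1 : exp (((N : ℂ) / 2 - 1) * (u + ℓ)) = exp (((N : ℂ) / 2 - 1) * u) * (p / base ℓ) := by
    rw [hp, halfBase, base, ← exp_sub, ← exp_add]; congr 1; ring
  set z := exp (-(N * (u + ℓ))) with hz
  have hz0 : z ≠ 0 := exp_ne_zero _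
  have h2 : exp (-(N * u)) = p * (p * z) := by
    rw [hp, halfBase, hz, ← exp_add, ← exp_add]; congr 1; ring
  have h3 : thetaExp p (-(N * u)) = (p * z)⁻¹ * z⁻¹ * thetaExp p (-(N * (u + ℓ))) := by
    rw [thetaExp, h2, theta_mul_base hp1 hp0 (mul_ne_zero hp0 hz0), theta_mul_base hp1 hp0 hz0,
      thetaExp]
    ring
  have h4 : base ℓ ^ (N + 1) * exp u ^ (2 * N) = base ℓ * (p ^ 2 * (p * (p * z))⁻¹ ^ 2) := by
    rw [pow_succ', ← halfBase_sq, ← h2, ← exp_neg, neg_neg, ← exp_nat_mul, ← exp_nat_mul,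
      mul_assoc]
    congr 3; push_cast; ring
  rw [gExp, gExp, ← hp, h1, h3, h4]
  field_simp

lemma gExp_add_two_pi (u : ℂ) (hN : Even N) (k : ℤ) :
    gExp N ℓ (u + k * (2 * Real.pi * I)) = gExp N ℓ u := by
  obtain ⟨m, rfl⟩ := hN
  rw [gExp, gExp, thetaExp, thetaExp]
  congr 1
  · rw [exp_eq_exp_iff_exists_int]
    refine ⟨(m - 1) * k, ?_⟩
    push_cast; ring
  · congr 1
    rw [exp_eq_exp_iff_exists_int]
    refine ⟨-((m + m) * k), ?_⟩
    push_cast; ring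

lemma gExp_eq_of_exp_eq (hN : Even N) {u v : ℂ} (h : exp u = exp v) :
    gExp N ℓ u = gExp N ℓ v := by
  obtain ⟨k, rfl⟩ := exp_eq_exp_iff_exists_int.mp h
  exact gExp_add_two_pi v hN k

lemma gFun_exp (hℓ : ℓ.re < 0) {u : ℂ} (h : Odd N → |height ℓ u| < Real.pi) :
    gFun N ℓ (exp u) = gExp N ℓ u := by
  rw [gFun_eq hℓ (exp_ne_zero u)]
  rcases N.even_or_odd with hN | hN
  · exact gExp_eq_of_exp_eq hN (exp_qLog hℓ (exp_ne_zero u))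
  · have hu := abs_lt.mp (h hN)
    rw [qLog_exp hℓ hu.1 hu.2.le]

lemma differentiableOn_gFun (hN : 2 ≤ N) (hℓ : ℓ.re < 0) :
    DifferentiableOn ℂ (gFun N ℓ) (varDomain N ℓ) := by
  intro x hx
  refine DifferentiableAt.differentiableWithinAt ?_
  have hx0 : x ≠ 0 := hx.1
  rcases N.even_or_odd with hN' | hN'
  · have h1 : DifferentiableAt ℂ (fun y => log x + log (y / x)) x := by
      have h2 : DifferentiableAt ℂ (fun y : ℂ => y / x) x := by fun_prop
      refine (h2.clog ?_).const_add _
      rw [div_self hx0]; exact one_mem_slitPlane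
    refine (DifferentiableAt.comp x (differentiable_gExp hN hℓ _) h1).congr_of_eventuallyEq ?_
    filter_upwards [eventually_ne_nhds hx0] with y hy
    rw [gFun_eq hℓ hy]
    refine gExp_eq_of_exp_eq hN' ?_
    rw [exp_qLog hℓ hy, exp_add, exp_log hx0, exp_log (div_ne_zero hy hx0), mul_div_cancel₀ _ hx0]
  · refine (DifferentiableAt.comp x (differentiable_gExp hN hℓ _)
      (differentiableAt_qLog hℓ hN' hx)).congr_of_eventuallyEq ?_
    filter_upwards [eventually_ne_nhds hx0] with y hy using gFun_eq hℓ hy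

lemma qLog_base_mul (hℓ : ℓ.re < 0) {x : ℂ} (hx : x ≠ 0) :
    qLog ℓ (base ℓ * x) = qLog ℓ x + ℓ := by
  have h := height_qLog_mem hℓ hx
  have h1 : exp (qLog ℓ x + ℓ) = base ℓ * x := by
    rw [exp_add, exp_qLog hℓ hx, mul_comm]; rfl
  rw [← h1]
  refine qLog_exp hℓ ?_ ?_ <;> rw [height_add, height_base hℓ, add_zero]
  exacts [h.1, h.2]

lemma gFun_base_mul (hN : 2 ≤ N) (hℓ : ℓ.re < 0) {x : ℂ} (hx : x ≠ 0) :
    gFun N ℓ (base ℓ * x) = gFun N ℓ x / (base ℓ ^ (N + 1) * x ^ (2 * N)) := by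
  rw [gFun_eq hℓ (mul_ne_zero (base_ne_zero ℓ) hx), gFun_eq hℓ hx, qLog_base_mul hℓ hx,
    gExp_add_base hN hℓ, exp_qLog hℓ hx]

end GFun


section Shift

variable {n : ℕ} {q : ℂ}

lemma thetaPairs_update_mul_base (hq : ‖q‖ < 1) (hq0 : q ≠ 0) {x : Fin n → ℂ}
    (hx : ∀ i, x i ≠ 0) (i : Fin n) :
    thetaPairs q (Function.update x i (q * x i)) * ∏ l ∈ Finset.univ.erase i, -(x l * x i)
      = thetaPairs q x := by
  rw [prod_erase_eq_prod_pairs (fun l => -(x l * x i)), thetaPairs, thetaPairs,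
    ← Finset.prod_mul_distrib]
  refine Finset.prod_congr rfl fun a _ => ?_
  rw [← Finset.prod_mul_distrib]
  refine Finset.prod_congr rfl fun b hb => ?_
  have hab : a ≠ b := (Finset.mem_Ioi.mp hb).ne
  have ha := hx a
  have hb0 := hx b
  by_cases hbi : b = i
  · subst hbi
    rw [Function.update_self, Function.update_of_ne hab, if_pos rfl, mul_left_comm,
      theta_mul_base hq hq0 (mul_ne_zero ha hb0)]
    field_simp
  · by_cases hai : a = i
    · subst hai
      rw [Function.update_self, Function.update_of_ne hbi, if_neg hbi, if_pos rfl, mul_assoc,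
        theta_mul_base hq hq0 (mul_ne_zero ha hb0)]
      field_simp
    · rw [Function.update_of_ne hai, Function.update_of_ne hbi, if_neg hbi, if_neg hai, mul_one]

lemma theta_div_base_mul (hq : ‖q‖ < 1) (hq0 : q ≠ 0) {x y : ℂ} (hx : x ≠ 0) (hy : y ≠ 0) :
    theta (x / (q * y)) q = -(x / (q * y)) * theta (x / y) q := by
  have hz : x / (q * y) ≠ 0 := div_ne_zero hx (mul_ne_zero hq0 hy)
  have h := theta_mul_base hq hq0 hz
  rw [show q * (x / (q * y)) = x / y by field_simp] at h
  rw [h]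
  field_simp

lemma thetaSumOf_update_mul_base (hq : ‖q‖ < 1) (hq0 : q ≠ 0) (hn : 2 ≤ n) {x : Fin n → ℂ}
    (hx : ∀ i, x i ≠ 0) (G : Fin n → ℂ) (i : Fin n) :
    thetaSumOf q (Function.update x i (q * x i))
        (Function.update G i (G i / (q ^ (n - 1) * x i ^ (2 * n - 4))))
      = x i ^ 2 * thetaSumOf q x G := by
  rw [thetaSumOf, thetaSumOf, Finset.mul_sum]
  refine Finset.sum_congr rfl fun k _ => ?_
  have hi := hx i
  have hk := hx k
  by_cases hki : k = i
  · subst hki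
    have h1 : ∏ l ∈ Finset.univ.erase k,
        (theta (Function.update x k (q * x k) l * Function.update x k (q * x k) k) q
          * theta (Function.update x k (q * x k) l / Function.update x k (q * x k) k) q)
        = (q * x k ^ 2)⁻¹ ^ (n - 1) *
          ∏ l ∈ Finset.univ.erase k, (theta (x l * x k) q * theta (x l / x k) q) := by
      have hcard : (Finset.univ.erase k : Finset (Fin n)).card = n - 1 := by
        rw [Finset.card_erase_of_mem (Finset.mem_univ k)]; simp
      rw [← hcard, ← Finset.prod_const, ← Finset.prod_mul_distrib]
      refine Finset.prod_congr rfl fun l hl => ?_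
      have hl' := hx l
      rw [Function.update_self, Function.update_of_ne (Finset.ne_of_mem_erase hl), mul_left_comm,
        theta_mul_base hq hq0 (mul_ne_zero hl' hk), theta_div_base_mul hq hq0 hl' hk]
      field_simp
    rw [h1, Function.update_self]
    obtain ⟨m, rfl⟩ := Nat.exists_eq_add_of_le' hn
    rw [show m + 2 - 1 = m + 1 by omega, show 2 * (m + 2) - 4 = 2 * m by omega, inv_pow, mul_pow,
      ← pow_mul]
    generalize ∏ l ∈ Finset.univ.erase k, (theta (x l * x k) q * theta (x l / x k) q) = D
    have h2 : x k ^ (2 * (m + 1)) = x k ^ 2 * x k ^ (2 * m) := by ring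
    rw [h2, mul_div_assoc']
    have h3 : x k ^ (2 * m) ≠ 0 := pow_ne_zero _ hk
    have h4 : q ^ (m + 1) ≠ 0 := pow_ne_zero _ hq0
    by_cases hD : D = 0
    · simp [hD]
    · field_simp
  · have hik : i ∈ (Finset.univ.erase k : Finset (Fin n)) := by simp [Ne.symm hki]
    rw [Function.update_of_ne hki, Function.update_of_ne hki, ← Finset.mul_prod_erase _ _ hik,
      ← Finset.mul_prod_erase _ _ hik, Function.update_self, mul_assoc q, mul_div_assoc q,
      theta_mul_base hq hq0 (mul_ne_zero hi hk), theta_mul_base hq hq0 (div_ne_zero hi hk)]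
    have h1 : ∏ l ∈ (Finset.univ.erase k).erase i,
        (theta (Function.update x i (q * x i) l * x k) q
          * theta (Function.update x i (q * x i) l / x k) q)
        = ∏ l ∈ (Finset.univ.erase k).erase i, (theta (x l * x k) q * theta (x l / x k) q) :=
      Finset.prod_congr rfl fun l hl => by rw [Function.update_of_ne (Finset.ne_of_mem_erase hl)]
    rw [h1]
    generalize ∏ l ∈ (Finset.univ.erase k).erase i, (theta (x l * x k) q * theta (x l / x k) q) = D
    generalize theta (x i * x k) q = A
    generalize theta (x i / x k) q = B
    by_cases hD : A * B * D = 0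
    · have h2 : -(x i * x k)⁻¹ * A * (-(x i / x k)⁻¹ * B) * D = 0 := by
        linear_combination (x i * x k)⁻¹ * (x i / x k)⁻¹ * hD
      rw [h2, hD]; simp
    · have hA : A ≠ 0 := fun h => hD (by rw [h]; ring)
      have hB : B ≠ 0 := fun h => hD (by rw [h]; ring)
      have hD' : D ≠ 0 := fun h => hD (by rw [h]; ring)
      field_simp

lemma thetaSumOf_mul_thetaPairs_update {N : ℕ} (hN : 2 ≤ N) (hq : ‖q‖ < 1) (hq0 : q ≠ 0)
    {x : Fin (N + 2) → ℂ} (hx : ∀ i, x i ≠ 0) (G : Fin (N + 2) → ℂ) (i : Fin (N + 2)) :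
    thetaSumOf q (Function.update x i (q * x i))
        (Function.update G i (G i / (q ^ (N + 1) * x i ^ (2 * N))))
        * thetaPairs q (Function.update x i (q * x i))
      = (-1) ^ (N + 1) * (thetaSumOf q x G * thetaPairs q x / ((∏ j, x j) * x i ^ (N - 2))) := by
  have h1 := thetaSumOf_update_mul_base hq hq0 (by omega) hx G i
  rw [show N + 2 - 1 = N + 1 by omega, show 2 * (N + 2) - 4 = 2 * N by omega] at h1
  have h2 := thetaPairs_update_mul_base hq hq0 hx i
  have hcard : (Finset.univ.erase i : Finset (Fin (N + 2))).card = N + 1 := by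
    rw [Finset.card_erase_of_mem (Finset.mem_univ i)]; simp
  have h3 : ∏ l ∈ Finset.univ.erase i, -(x l * x i)
      = (-1) ^ (N + 1) * ((∏ l ∈ Finset.univ.erase i, x l) * x i ^ (N + 1)) := by
    rw [← hcard, ← Finset.prod_const, ← Finset.prod_const, ← Finset.prod_mul_distrib,
      ← Finset.prod_mul_distrib]
    exact Finset.prod_congr rfl fun _ _ => by ring
  have hi := hx i
  have hE : ∏ l ∈ Finset.univ.erase i, x l ≠ 0 := Finset.prod_ne_zero_iff.mpr fun l _ => hx l
  rw [h3] at h2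
  rw [h1, ← h2, ← Finset.mul_prod_erase _ _ (Finset.mem_univ i)]
  generalize thetaPairs q (Function.update x i (q * x i)) = P
  obtain ⟨m, rfl⟩ := Nat.exists_eq_add_of_le' hN
  have hsign : ((-1 : ℂ) ^ (m + 2 + 1)) * (-1) ^ (m + 2 + 1) = 1 := by
    rw [← mul_pow]; norm_num
  rw [show m + 2 - 2 = m by omega]
  field_simp
  linear_combination -(x i ^ 3 * x i ^ m * thetaSumOf q x G * P) * hsign

end Shift

section Coefficient

variable {ℓ : ℂ} {N : ℕ}

lemma isOpen_forall_mem {n : ℕ} {U : Set ℂ} (hU : IsOpen U) {φ : ℂ → ℂ} (hφ : Continuous φ) :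
    IsOpen {u : Fin n → ℂ | ∀ i, φ (u i) ∈ U} := by
  simp only [Set.ofPred_forall]
  exact isOpen_iInter_of_finite fun i => hU.preimage (by fun_prop)

/-- The function `f` attached to `g_N`, with its quasi-periodicity. -/
theorem exists_coefficient_function (hN : 2 ≤ N) (hℓ : ℓ.re < 0) :
    ∃ f : (Fin (N + 2) → ℂ) → ℂ, IsSymmHolomorphic (varDomain N ℓ) f ∧
      (∀ x : Fin (N + 2) → ℂ, (∀ i, x i ∈ varDomain N ℓ) → Generic (base ℓ) x →
        f x = thetaSum (base ℓ) (gFun N ℓ) x * thetaPairs (base ℓ) x) ∧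
      ∀ x : Fin (N + 2) → ℂ, (∀ i, x i ∈ varDomain N ℓ) → ∀ i : Fin (N + 2),
        f (Function.update x i (base ℓ * x i))
          = (-1) ^ (N + 1) * (f x / ((∏ j, x j) * x i ^ (N - 2))) := by
  have hq := norm_base_lt_one hℓ
  have hq0 := base_ne_zero ℓ
  have hgq : ∀ x ∈ varDomain N ℓ, gFun N ℓ (base ℓ * x)
      = gFun N ℓ x / (base ℓ ^ (N + 2 - 1) * x ^ (2 * (N + 2) - 4)) := by
    intro x hx
    rw [gFun_base_mul hN hℓ hx.1]
    congr 3
  obtain ⟨f, hf, hgen⟩ := exists_symm_thetaSum_continuation (n := N + 2) hq hq0 (by omega)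
    (isOpen_varDomain hℓ) zero_notMem_varDomain base_mul_mem_varDomain
    (differentiableOn_gFun hN hℓ) hgq
  refine ⟨f, hf, hgen, fun x hx i => ?_⟩
  set Ω : Set (Fin (N + 2) → ℂ) := {u | ∀ i, exp (u i) ∈ varDomain N ℓ} with hΩdef
  have hΩ : IsOpen Ω := isOpen_forall_mem (isOpen_varDomain hℓ) continuous_exp
  have hcexp : Continuous fun (u : Fin (N + 2) → ℂ) j => exp (u j) := by fun_prop
  have hmaps : ∀ y : Fin (N + 2) → ℂ, (∀ j, y j ∈ varDomain N ℓ) →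
      ∀ j, Function.update y i (base ℓ * y i) j ∈ varDomain N ℓ := by
    intro y hy j
    by_cases hj : j = i
    · subst hj; rw [Function.update_self, base_mul_mem_varDomain]; exact hy j
    · rw [Function.update_of_ne hj]; exact hy j
  have hcont1 : ContinuousOn (fun u : Fin (N + 2) → ℂ =>
      f (Function.update (fun j => exp (u j)) i (base ℓ * exp (u i)))) Ω := by
    refine hf.1.continuousOn.comp (Continuous.continuousOn ?_) fun u hu => hmaps _ hu
    exact hcexp.update i (by fun_prop)
  have hcont2 : ContinuousOn (fun u : Fin (N + 2) → ℂ => (-1) ^ (N + 1) *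
      (f (fun j => exp (u j)) / ((∏ j, exp (u j)) * exp (u i) ^ (N - 2)))) Ω := by
    refine continuousOn_const.mul (ContinuousOn.div ?_ (Continuous.continuousOn (by fun_prop)) ?_)
    · exact hf.1.continuousOn.comp hcexp.continuousOn fun u hu => hu
    · intro u _
      exact mul_ne_zero (Finset.prod_ne_zero_iff.mpr fun j _ => exp_ne_zero _)
        (pow_ne_zero _ (exp_ne_zero _))
  have hxx := exp_log_comp fun j => (hx j).1
  have key := eqOn_of_pairGeneric (differentiable_thetaExp hq)
    (fun z => deriv_thetaExp_ne_zero hq hq0) hΩ hcont1 hcont2 (fun u hu hu' => by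
      rw [pairGeneric_iff] at hu'
      have hgen' : Generic (base ℓ)
          (Function.update (fun j => exp (u j)) i (base ℓ * exp (u i))) := by
        intro a b hab
        have h := hu' a b hab
        have h' := hu' b a hab.symm
        by_cases ha : a = i
        · subst ha
          rw [Function.update_self, Function.update_of_ne hab.symm, mul_assoc, mul_div_assoc,
            theta_mul_base_ne_zero hq hq0 (mul_ne_zero (exp_ne_zero _) (exp_ne_zero _)),
            theta_mul_base_ne_zero hq hq0 (div_ne_zero (exp_ne_zero _) (exp_ne_zero _))]
          exact h
        · by_cases hb : b = i
          · subst hb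
            rw [Function.update_self, Function.update_of_ne hab, mul_left_comm,
              theta_mul_base_ne_zero hq hq0 (mul_ne_zero (exp_ne_zero _) (exp_ne_zero _)),
              ← inv_div, theta_ne_zero_inv hq (div_ne_zero (mul_ne_zero hq0 (exp_ne_zero _))
                (exp_ne_zero _)), mul_div_assoc,
              theta_mul_base_ne_zero hq hq0 (div_ne_zero (exp_ne_zero _) (exp_ne_zero _))]
            exact ⟨h.1, h'.2⟩
          · rw [Function.update_of_ne ha, Function.update_of_ne hb]; exact h
      have h1 := thetaSumOf_mul_thetaPairs_update hN hq hq0 (x := fun j => exp (u j))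
        (fun j => exp_ne_zero _) (fun j => gFun N ℓ (exp (u j))) i
      rw [hgen _ hu hu', hgen _ (hmaps _ hu) hgen']
      refine Eq.trans ?_ h1
      congr 1
      refine congrArg (thetaSumOf _ _) (funext fun j => ?_)
      by_cases hj : j = i
      · subst hj
        rw [Function.update_self, Function.update_self, gFun_base_mul hN hℓ (exp_ne_zero _)]
      · rw [Function.update_of_ne hj, Function.update_of_ne hj])
    (u := fun j => log (x j)) (fun j => by rw [exp_log (hx j).1]; exact hx j)
  simpa only [exp_log (hx _).1] using key

end Coefficient


section Succ

variable {n : ℕ} {q : ℂ}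

lemma prod_erase_eq_prod_ite (F : Fin n → ℂ) (k : Fin n) :
    ∏ l ∈ Finset.univ.erase k, F l = ∏ l, if l = k then 1 else F l := by
  rw [← Finset.mul_prod_erase _ _ (Finset.mem_univ k), if_pos rfl, one_mul]
  exact Finset.prod_congr rfl fun l hl => by rw [if_neg (Finset.ne_of_mem_erase hl)]

/-- The sum over the last `n` variables in a theta sum of `n + 1` variables. -/
noncomputable def thetaTail (q x : ℂ) (Y G : Fin n → ℂ) : ℂ :=
  ∑ k, G k / (theta (x * Y k) q * theta (x / Y k) q
    * ∏ l ∈ Finset.univ.erase k, (theta (Y l * Y k) q * theta (Y l / Y k) q))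

lemma thetaSumOf_succ (X G : Fin (n + 1) → ℂ) :
    thetaSumOf q X G
      = G 0 / ∏ k : Fin n, (theta (X k.succ * X 0) q * theta (X k.succ / X 0) q)
        + thetaTail q (X 0) (fun k => X k.succ) fun k => G k.succ := by
  rw [thetaSumOf, Fin.sum_univ_succ, thetaTail]
  simp only [prod_erase_eq_prod_ite, Fin.prod_univ_succ, Fin.succ_ne_zero, Fin.succ_inj,
    (Fin.succ_ne_zero _).symm, if_true, if_false, one_mul]

lemma thetaPairs_succ (X : Fin (n + 1) → ℂ) :
    thetaPairs q X = (∏ k : Fin n, theta (X 0 * X k.succ) q) * thetaPairs q fun k => X k.succ := by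
  rw [thetaPairs, Fin.prod_univ_succ, Fin.prod_Ioi_zero, thetaPairs]
  simp only [Fin.prod_Ioi_succ]

lemma thetaTail_inv (hq : ‖q‖ < 1) {x : ℂ} (hx : x ≠ 0) {Y : Fin n → ℂ} (hY : ∀ k, Y k ≠ 0)
    (G : Fin n → ℂ) : thetaTail q x⁻¹ Y G = x ^ 2 * thetaTail q x Y G := by
  rw [thetaTail, thetaTail, Finset.mul_sum]
  refine Finset.sum_congr rfl fun k _ => ?_
  have hk := hY k
  have h1 : x⁻¹ * Y k = (x / Y k)⁻¹ := by field_simp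
  have h2 : x⁻¹ / Y k = (x * Y k)⁻¹ := by field_simp
  rw [h1, h2, theta_inv hq (div_ne_zero hx hk), theta_inv hq (mul_ne_zero hx hk)]
  have h3 : ∀ A B D : ℂ, -(x / Y k)⁻¹ * A * (-(x * Y k)⁻¹ * B) * D = (x ^ 2)⁻¹ * (B * A * D) := by
    intro A B D; field_simp
  rw [h3, ← div_div, div_inv_eq_mul, mul_comm, mul_div_assoc]

/-- What remains of the first term of the theta sum after subtraction of its product form. -/
lemma thetaPairs_mul_sub (X G : Fin (n + 1) → ℂ)
    (h : ∏ k : Fin n, (theta (X k.succ * X 0) q * theta (X k.succ / X 0) q) ≠ 0) :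
    (thetaPairs q fun k => X k.succ) * G 0
        - thetaSumOf q X G * thetaPairs q X * ∏ k : Fin n, theta (X k.succ / X 0) q
      = -((thetaPairs q fun k => X k.succ)
        * (∏ k : Fin n, (theta (X k.succ * X 0) q * theta (X k.succ / X 0) q))
        * thetaTail q (X 0) (fun k => X k.succ) fun k => G k.succ) := by
  have hW : ∏ k : Fin n, (theta (X k.succ * X 0) q * theta (X k.succ / X 0) q)
      = (∏ k : Fin n, theta (X 0 * X k.succ) q) * ∏ k : Fin n, theta (X k.succ / X 0) q := by
    rw [← Finset.prod_mul_distrib]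
    exact Finset.prod_congr rfl fun k _ => by rw [mul_comm (X k.succ)]
  rw [thetaSumOf_succ, thetaPairs_succ]
  rw [hW] at h ⊢
  generalize (∏ k : Fin n, theta (X 0 * X k.succ) q) = A at h ⊢
  generalize (∏ k : Fin n, theta (X k.succ / X 0) q) = B at h ⊢
  have hA := left_ne_zero_of_mul h
  have hB := right_ne_zero_of_mul h
  field_simp
  ring

end Succ

section LogCoefficient

variable {ℓ : ℂ} {N : ℕ}

/-- The tuples of logarithms on which the theta sum of `g_N` continues holomorphically. -/
def logDomain (N : ℕ) (ℓ : ℂ) : Set (Fin (N + 2) → ℂ) :=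
  {u | Odd N → ∀ i j, |height ℓ (u i) - height ℓ (u j)| < 2 * Real.pi}

lemma isOpen_imp {X : Type*} [TopologicalSpace X] {p : Prop} {s : X → Prop}
    (h : IsOpen {x | s x}) : IsOpen {x | p → s x} := by
  by_cases hp : p
  · simpa [hp] using h
  · simp [hp]

lemma isOpen_logDomain : IsOpen (logDomain N ℓ) := by
  have := continuous_height ℓ
  refine isOpen_imp ?_
  simp only [Set.ofPred_forall]
  exact isOpen_iInter_of_finite fun i => isOpen_iInter_of_finite fun j =>
    isOpen_lt (by fun_prop) continuous_const

/-- `H` continues the theta sum of `g_N`, in logarithmic variables. -/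
def IsLogCoefficient (N : ℕ) (ℓ : ℂ) (H : (Fin (N + 2) → ℂ) → ℂ) : Prop :=
  ContDiffOn ℂ 1 H (logDomain N ℓ) ∧ ∀ u ∈ logDomain N ℓ, PairGeneric (thetaExp (base ℓ)) u →
    H u = thetaSumOf (base ℓ) (fun i => exp (u i)) (fun i => gExp N ℓ (u i))
      * thetaPairs (base ℓ) fun i => exp (u i)

lemma gExp_thetaRel (hN : 2 ≤ N) (hℓ : ℓ.re < 0) (u : ℂ) (m : ℤ) :
    ThetaRel (N + 2) (base ℓ) (exp (u + m * ℓ), gExp N ℓ (u + m * ℓ)) (exp u, gExp N ℓ u) := by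
  have h := ThetaRel.int_induction (n := N + 2) (q := base ℓ)
    (P := fun m : ℤ => (exp (u + m * ℓ), gExp N ℓ (u + m * ℓ))) (fun m => by
      have h := thetaRel_mul_base (n := N + 2) (norm_base_lt_one hℓ) (base_ne_zero ℓ) (by omega)
        (exp_ne_zero (u + m * ℓ)) (gExp N ℓ (u + m * ℓ))
      rw [show N + 2 - 1 = N + 1 by omega, show 2 * (N + 2) - 4 = 2 * N by omega,
        ← gExp_add_base hN hℓ] at h
      have h0 : base ℓ * exp (u + m * ℓ) = exp (u + m * ℓ + ℓ) := by
        rw [exp_add _ ℓ, mul_comm]; rfl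
      have h1 : u + ((m + 1 : ℤ) : ℂ) * ℓ = u + m * ℓ + ℓ := by push_cast; ring
      simpa only [h1, h0] using h) m
  simpa using h

theorem exists_isLogCoefficient (hN : 2 ≤ N) (hℓ : ℓ.re < 0) : ∃ H, IsLogCoefficient N ℓ H := by
  have hq := norm_base_lt_one hℓ
  have hq0 := base_ne_zero ℓ
  refine exists_thetaSum_continuation hq hq0 (by omega) isOpen_logDomain isOpen_univ
    (differentiable_gExp hN hℓ).differentiableOn (fun _ _ _ => Set.mem_univ _)
    fun u hu i j hij h0 => ?_
  obtain ⟨m, hm⟩ := (theta_eq_zero_iff hq hq0 (exp_ne_zero (u i - u j))).mp h0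
  have hexp : exp (u i) = exp (u j + m * ℓ) := by
    rw [exp_add, exp_int_mul]
    change exp (u i) = exp (u j) * base ℓ ^ m
    rw [← hm, ← exp_add, add_sub_cancel]
  have h := gExp_thetaRel hN hℓ (u j) m
  rcases N.even_or_odd with hN' | hN'
  · rwa [← hexp, ← gExp_eq_of_exp_eq hN' hexp] at h
  · have : u i = u j + m * ℓ := by
      refine eq_of_exp_eq_of_height (ℓ := ℓ) hexp ?_
      have h1 : height ℓ (m * ℓ) = 0 := by simpa using height_real_mul hℓ m
      rw [height_add, h1, add_zero]
      exact hu hN' i j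
    rwa [← this] at h

variable {H : (Fin (N + 2) → ℂ) → ℂ}

lemma IsLogCoefficient.eq_of_pairGeneric (hH : IsLogCoefficient N ℓ H) (hℓ : ℓ.re < 0)
    {f : (Fin (N + 2) → ℂ) → ℂ} (hf : ContinuousOn f {x | ∀ i, x i ∈ varDomain N ℓ})
    (hgen : ∀ x : Fin (N + 2) → ℂ, (∀ i, x i ∈ varDomain N ℓ) → Generic (base ℓ) x →
        f x = thetaSum (base ℓ) (gFun N ℓ) x * thetaPairs (base ℓ) x)
    {u : Fin (N + 2) → ℂ} (hu : Odd N → ∀ i, |height ℓ (u i)| < Real.pi) :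
    H u = f fun i => exp (u i) := by
  have hq := norm_base_lt_one hℓ
  have hch := continuous_height ℓ
  set Ω : Set (Fin (N + 2) → ℂ) := {u | Odd N → ∀ i, |height ℓ (u i)| < Real.pi} with hΩ
  have hΩo : IsOpen Ω := by
    refine isOpen_imp ?_
    simp only [Set.ofPred_forall]
    exact isOpen_iInter_of_finite fun i => isOpen_lt (by fun_prop) continuous_const
  have hsub : Ω ⊆ logDomain N ℓ := by
    intro v hv hN' i j
    have h1 := abs_lt.mp (hv hN' i)
    have h2 := abs_lt.mp (hv hN' j)
    rw [abs_lt]; constructor <;> linarith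
  have hmem : ∀ v ∈ Ω, ∀ i, exp (v i) ∈ varDomain N ℓ := fun v hv i =>
    exp_mem_varDomain hℓ fun h => hv h i
  refine eqOn_of_pairGeneric (differentiable_thetaExp hq)
    (fun z => deriv_thetaExp_ne_zero hq (base_ne_zero ℓ)) hΩo (g := fun u => f fun i => exp (u i))
    (hH.1.continuousOn.mono hsub) (hf.comp (by fun_prop) hmem) (fun v hv hv' => ?_) hu
  rw [hH.2 v (hsub hv) hv', hgen _ (hmem v hv) ((pairGeneric_iff v).mp hv')]
  congr 1
  refine congrArg (thetaSumOf _ _) (funext fun i => ?_)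
  exact (gFun_exp hℓ fun h => hv h i).symm

lemma IsLogCoefficient.add_base (hH : IsLogCoefficient N ℓ H) (hN : 2 ≤ N) (hℓ : ℓ.re < 0)
    {u : Fin (N + 2) → ℂ} (hu : u ∈ logDomain N ℓ) (i : Fin (N + 2)) :
    H (Function.update u i (u i + ℓ))
      = (-1) ^ (N + 1) * (H u / ((∏ j, exp (u j)) * exp (u i) ^ (N - 2))) := by
  have hq := norm_base_lt_one hℓ
  have hq0 := base_ne_zero ℓ
  have hheight : ∀ (v : Fin (N + 2) → ℂ) j,
      height ℓ (Function.update v i (v i + ℓ) j) = height ℓ (v j) := by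
    intro v j
    by_cases hj : j = i
    · subst hj; rw [Function.update_self, height_add, height_base hℓ, add_zero]
    · rw [Function.update_of_ne hj]
  have hmaps : ∀ v ∈ logDomain N ℓ, Function.update v i (v i + ℓ) ∈ logDomain N ℓ := by
    intro v hv hN' a b
    rw [hheight, hheight]; exact hv hN' a b
  have hexp : ∀ v : Fin (N + 2) → ℂ, (fun j => exp (Function.update v i (v i + ℓ) j))
      = Function.update (fun j => exp (v j)) i (base ℓ * exp (v i)) := by
    intro v; funext j
    by_cases hj : j = i
    · subst hj; rw [Function.update_self, Function.update_self, exp_add, mul_comm]; rfl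
    · rw [Function.update_of_ne hj, Function.update_of_ne hj]
  refine eqOn_of_pairGeneric (differentiable_thetaExp hq)
    (fun z => deriv_thetaExp_ne_zero hq hq0) isOpen_logDomain
    (f := fun u => H (Function.update u i (u i + ℓ)))
    (g := fun u => (-1) ^ (N + 1) * (H u / ((∏ j, exp (u j)) * exp (u i) ^ (N - 2))))
    ?_ ?_ (fun v hv hv' => ?_) hu
  · refine hH.1.continuousOn.comp (Continuous.continuousOn ?_) hmaps
    exact continuous_id.update i (by fun_prop)
  · refine continuousOn_const.mul (hH.1.continuousOn.div (Continuous.continuousOn (by fun_prop)) ?_)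
    intro v _
    exact mul_ne_zero (Finset.prod_ne_zero_iff.mpr fun j _ => exp_ne_zero _)
      (pow_ne_zero _ (exp_ne_zero _))
  · have hgen : PairGeneric (thetaExp (base ℓ)) (Function.update v i (v i + ℓ)) := by
      have hs : ∀ z, thetaExp (base ℓ) (z + ℓ) ≠ 0 ↔ thetaExp (base ℓ) z ≠ 0 := by
        intro z
        rw [thetaExp, exp_add, mul_comm]
        exact theta_mul_base_ne_zero hq hq0 (exp_ne_zero z)
      intro a b hab
      have h := hv' a b hab
      by_cases ha : a = i
      · subst ha
        rw [Function.update_self, Function.update_of_ne hab.symm, add_right_comm, hs,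
          add_sub_right_comm, hs]
        exact h
      · by_cases hb : b = i
        · subst hb
          rw [Function.update_self, Function.update_of_ne hab, ← add_assoc, hs,
            ← hs (v a - (v b + ℓ)), sub_add_eq_sub_sub, sub_add_cancel]
          exact h
        · rw [Function.update_of_ne ha, Function.update_of_ne hb]; exact h
    rw [hH.2 v hv hv', hH.2 _ (hmaps v hv) hgen, hexp]
    refine Eq.trans ?_ (thetaSumOf_mul_thetaPairs_update hN hq hq0 (x := fun j => exp (v j))
      (fun j => exp_ne_zero _) (fun j => gExp N ℓ (v j)) i)
    congr 1
    refine congrArg (thetaSumOf _ _) (funext fun j => ?_)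
    by_cases hj : j = i
    · subst hj
      rw [Function.update_self, Function.update_self, gExp_add_base hN hℓ]
    · rw [Function.update_of_ne hj, Function.update_of_ne hj]

/-- The part of `g_N` which does not contribute to the integral, times `∏ θ(y_k y_l)`. -/
noncomputable def remainder (N : ℕ) (ℓ : ℂ) (H : (Fin (N + 2) → ℂ) → ℂ) (y : Fin (N + 1) → ℂ)
    (u : ℂ) : ℂ :=
  (thetaPairs (base ℓ) fun k => exp (y k)) * gExp N ℓ u
    - H (Fin.cons u y) * ∏ k, theta (exp (y k) / exp u) (base ℓ)

lemma remainder_eq_of_pairGeneric (hH : IsLogCoefficient N ℓ H) {v : Fin (N + 2) → ℂ}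
    (hv : v ∈ logDomain N ℓ) (hv' : PairGeneric (thetaExp (base ℓ)) v) :
    remainder N ℓ H (fun k => v k.succ) (v 0)
      = -((thetaPairs (base ℓ) fun k : Fin (N + 1) => exp (v k.succ))
        * (∏ k : Fin (N + 1), (theta (exp (v k.succ) * exp (v 0)) (base ℓ)
          * theta (exp (v k.succ) / exp (v 0)) (base ℓ)))
        * thetaTail (base ℓ) (exp (v 0)) (fun k => exp (v k.succ)) fun k => gExp N ℓ (v k.succ)) := by
  have hcons : (Fin.cons (v 0) fun k : Fin (N + 1) => v k.succ : Fin (N + 2) → ℂ) = v :=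
    Fin.cons_self_tail v
  rw [remainder, hcons, hH.2 v hv hv']
  refine thetaPairs_mul_sub (fun i => exp (v i)) (fun i => gExp N ℓ (v i)) ?_
  refine Finset.prod_ne_zero_iff.mpr fun k _ => ?_
  have := hv' k.succ 0 (Fin.succ_ne_zero k)
  rw [thetaExp_add, thetaExp_sub] at this
  exact mul_ne_zero this.1 this.2

lemma continuousOn_remainder (hH : IsLogCoefficient N ℓ H) (hN : 2 ≤ N) (hℓ : ℓ.re < 0) :
    ContinuousOn (fun v : Fin (N + 2) → ℂ => remainder N ℓ H (fun k => v k.succ) (v 0))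
      (logDomain N ℓ) := by
  have hth := (differentiable_thetaExp (norm_base_lt_one hℓ)).continuous
  have hg := (differentiable_gExp hN hℓ).continuous
  unfold remainder thetaPairs
  simp only [← thetaExp_add, ← thetaExp_sub]
  refine ContinuousOn.sub (Continuous.continuousOn (by fun_prop))
    (ContinuousOn.mul ?_ (Continuous.continuousOn (by fun_prop)))
  refine hH.1.continuousOn.congr fun v _ => ?_
  exact congrArg H (Fin.cons_self_tail v)

lemma remainder_neg (hH : IsLogCoefficient N ℓ H) (hN : 2 ≤ N) (hℓ : ℓ.re < 0)
    {y : Fin (N + 1) → ℂ} {u : ℂ} (h1 : Fin.cons u y ∈ logDomain N ℓ)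
    (h2 : Fin.cons (-u) y ∈ logDomain N ℓ) :
    remainder N ℓ H y (-u) = exp u ^ 2 * remainder N ℓ H y u := by
  have hq := norm_base_lt_one hℓ
  have hq0 := base_ne_zero ℓ
  set φ : (Fin (N + 2) → ℂ) → Fin (N + 2) → ℂ := fun v => Function.update v 0 (-v 0) with hφ
  have hφc : Continuous φ := continuous_id.update 0 (by fun_prop)
  have hφ0 : ∀ v, φ v 0 = -v 0 := fun v => by simp [hφ]
  have hφs : ∀ v k, φ v (Fin.succ k) = v k.succ := fun v k => by simp [hφ]
  set Ω := logDomain N ℓ ∩ φ ⁻¹' logDomain N ℓ with hΩ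
  have hΩo : IsOpen Ω := isOpen_logDomain.inter (isOpen_logDomain.preimage hφc)
  have hc := continuousOn_remainder hH hN hℓ
  have hmem : (Fin.cons u y : Fin (N + 2) → ℂ) ∈ Ω := by
    refine ⟨h1, ?_⟩
    simpa [hφ, Fin.cons_zero, Fin.update_cons_zero] using h2
  have key := eqOn_of_pairGeneric (differentiable_thetaExp hq)
    (fun z => deriv_thetaExp_ne_zero hq hq0) hΩo
    (f := fun v => remainder N ℓ H (fun k => φ v k.succ) (φ v 0))
    (g := fun v => exp (v 0) ^ 2 * remainder N ℓ H (fun k => v k.succ) (v 0))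
    (hc.comp hφc.continuousOn fun v hv => hv.2)
    ((Continuous.continuousOn (by fun_prop)).mul (hc.mono Set.inter_subset_left))
    (fun v hv hv' => by
      have hgen : PairGeneric (thetaExp (base ℓ)) (φ v) := by
        have hs : ∀ z, thetaExp (base ℓ) (-z) ≠ 0 ↔ thetaExp (base ℓ) z ≠ 0 := by
          intro z
          rw [thetaExp_neg hq]; simp
        intro a b hab
        have h := hv' a b hab
        have h' := hv' b a hab.symm
        by_cases ha : a = 0
        · subst ha
          simp only [hφ]
          rw [Function.update_self, Function.update_of_ne hab.symm, neg_add_eq_sub,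
            ← hs (-v 0 - v b), neg_sub, sub_neg_eq_add]
          exact ⟨h'.2, h'.1⟩
        · by_cases hb : b = 0
          · subst hb
            simp only [hφ]
            rw [Function.update_self, Function.update_of_ne hab, ← sub_eq_add_neg, sub_neg_eq_add]
            exact h.symm
          · simp only [hφ]
            rw [Function.update_of_ne ha, Function.update_of_ne hb]; exact h
      rw [remainder_eq_of_pairGeneric hH hv.1 hv', remainder_eq_of_pairGeneric hH hv.2 hgen]
      simp only [hφs, hφ0, exp_neg]
      rw [thetaTail_inv hq (exp_ne_zero _) fun k => exp_ne_zero _]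
      have hW : ∏ k : Fin (N + 1), (theta (exp (v k.succ) * (exp (v 0))⁻¹) (base ℓ)
            * theta (exp (v k.succ) / (exp (v 0))⁻¹) (base ℓ))
          = ∏ k : Fin (N + 1), (theta (exp (v k.succ) * exp (v 0)) (base ℓ)
            * theta (exp (v k.succ) / exp (v 0)) (base ℓ)) :=
        Finset.prod_congr rfl fun k _ => by rw [div_inv_eq_mul, ← div_eq_mul_inv, mul_comm]
      rw [hW]; ring) hmem
  simpa only [hφs, hφ0, Fin.cons_zero, Fin.cons_succ] using key

lemma remainder_add_two_pi (hH : IsLogCoefficient N ℓ H) (hN : 2 ≤ N) (hℓ : ℓ.re < 0)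
    {y : Fin (N + 1) → ℂ} {u : ℂ} (h1 : Fin.cons u y ∈ logDomain N ℓ)
    (h2 : Fin.cons (u + 2 * Real.pi * I) y ∈ logDomain N ℓ) :
    remainder N ℓ H y (u + 2 * Real.pi * I) = remainder N ℓ H y u := by
  have hq := norm_base_lt_one hℓ
  have hq0 := base_ne_zero ℓ
  set φ : (Fin (N + 2) → ℂ) → Fin (N + 2) → ℂ :=
    fun v => Function.update v 0 (v 0 + 2 * Real.pi * I) with hφ
  have hφc : Continuous φ := continuous_id.update 0 (by fun_prop)
  have hφ0 : ∀ v, φ v 0 = v 0 + 2 * Real.pi * I := fun v => by simp [hφ]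
  have hφs : ∀ v k, φ v (Fin.succ k) = v k.succ := fun v k => by simp [hφ]
  have hexp : ∀ v j, exp (φ v j) = exp (v j) := by
    intro v j
    refine Fin.cases ?_ (fun k => ?_) j
    · rw [hφ0, exp_periodic]
    · rw [hφs]
  set Ω := logDomain N ℓ ∩ φ ⁻¹' logDomain N ℓ with hΩ
  have hΩo : IsOpen Ω := isOpen_logDomain.inter (isOpen_logDomain.preimage hφc)
  have hc := continuousOn_remainder hH hN hℓ
  have hmem : (Fin.cons u y : Fin (N + 2) → ℂ) ∈ Ω := by
    refine ⟨h1, ?_⟩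
    simpa [hφ, Fin.cons_zero, Fin.update_cons_zero] using h2
  have key := eqOn_of_pairGeneric (differentiable_thetaExp hq)
    (fun z => deriv_thetaExp_ne_zero hq hq0) hΩo
    (f := fun v => remainder N ℓ H (fun k => φ v k.succ) (φ v 0))
    (g := fun v => remainder N ℓ H (fun k => v k.succ) (v 0))
    (hc.comp hφc.continuousOn fun v hv => hv.2) (hc.mono Set.inter_subset_left)
    (fun v hv hv' => by
      have hgen : PairGeneric (thetaExp (base ℓ)) (φ v) := by
        rw [pairGeneric_iff] at hv' ⊢
        simpa only [hexp] using hv'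
      rw [remainder_eq_of_pairGeneric hH hv.1 hv', remainder_eq_of_pairGeneric hH hv.2 hgen]
      simp only [hexp, hφs]) hmem
  simpa only [hφs, hφ0, Fin.cons_zero, Fin.cons_succ] using key

end LogCoefficient


section Bounds

variable {q : ℂ}

lemma norm_prod_one_sub_le (hq : ‖q‖ < 1) {z : ℂ} {r : ℝ} (hz : ‖z‖ ≤ r) (n : ℕ) :
    ‖∏ k ∈ Finset.range n, (1 - z * q ^ k)‖ ≤ Real.exp (r / (1 - ‖q‖)) := by
  rw [norm_prod]
  have h1 : ∀ k ∈ Finset.range n, ‖1 - z * q ^ k‖ ≤ Real.exp (r * ‖q‖ ^ k) := by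
    intro k _
    calc ‖1 - z * q ^ k‖ ≤ 1 + ‖z‖ * ‖q‖ ^ k := by
          have := norm_sub_le (1 : ℂ) (z * q ^ k)
          rwa [norm_one, norm_mul, norm_pow] at this
      _ ≤ r * ‖q‖ ^ k + 1 := by
          rw [add_comm]; gcongr
      _ ≤ _ := Real.add_one_le_exp _
  refine (Finset.prod_le_prod (fun _ _ => norm_nonneg _) h1).trans ?_
  rw [← Real.exp_sum, ← Finset.mul_sum, div_eq_mul_inv]
  have hr : 0 ≤ r := (norm_nonneg z).trans hz
  gcongr
  rw [← tsum_geometric_of_lt_one (norm_nonneg q) hq]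
  exact (summable_geometric_of_lt_one (norm_nonneg q) hq).sum_le_tsum _
    fun _ _ => by positivity

lemma norm_qPoch_le (hq : ‖q‖ < 1) {z : ℂ} {r : ℝ} (hz : ‖z‖ ≤ r) :
    ‖qPoch z q‖ ≤ Real.exp (r / (1 - ‖q‖)) := by
  have h := (multipliable_qPoch hq z).hasProd.tendsto_prod_nat.norm
  exact le_of_tendsto h (Eventually.of_forall fun n => norm_prod_one_sub_le hq hz n)

end Bounds

section Jackson

variable {N : ℕ} {ℓ : ℂ} {a : ℕ → ℂ}

/-- The factor by which `K(w - ℓ)` differs from `K(w)`, and the ratio of the Jackson sums. -/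
noncomputable def ratio (N : ℕ) (ℓ : ℂ) (a : ℕ → ℂ) : ℂ :=
  base ℓ ^ (N - 1) / ∏ j ∈ Finset.Icc 1 (2 * N), a j

/-- The part of `Q` which is a single-valued function of `z`, divided by `z⁻¹`. -/
noncomputable def qPart (N : ℕ) (ℓ : ℂ) (a : ℕ → ℂ) (x : ℂ) : ℂ :=
  (1 - x ^ 2) * ∏ j ∈ Finset.Icc 1 (2 * N),
    (qPoch (base ℓ * (a j)⁻¹ * x) (base ℓ) / qPoch (a j * x) (base ℓ))

/-- The terms of the regularised Jackson integral, multiplied by `θ(x²)`. -/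
noncomputable def jacksonTerm (N : ℕ) (ℓ : ℂ) (a : ℕ → ℂ) (ν : ℤ) (x : ℂ) : ℂ :=
  base ℓ ^ (N * ν ^ 2 - ν) * x ^ (2 * N * ν) * (1 - x ^ 2 * base ℓ ^ (2 * ν))
    * ∏ j ∈ Finset.Icc 1 (2 * N), (qPoch (base ℓ ^ (1 + ν) * x * (a j)⁻¹) (base ℓ)
      * qPoch (base ℓ ^ (1 - ν) * (a j * x)⁻¹) (base ℓ))

lemma jacksonTerm_reflect (m ν : ℤ) {x : ℂ} (hx : x ≠ 0) :
    jacksonTerm N ℓ a (-m - ν) (base ℓ ^ m * x⁻¹)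
      = -(base ℓ ^ (m - N * m ^ 2) * x ^ (2 * N * m - 2)) * jacksonTerm N ℓ a ν x := by
  have hq0 := base_ne_zero ℓ
  rw [jacksonTerm, jacksonTerm]
  have h1 : ∀ j, base ℓ ^ (1 + (-m - ν)) * (base ℓ ^ m * x⁻¹) * (a j)⁻¹
      = base ℓ ^ (1 - ν) * (a j * x)⁻¹ := by
    intro j
    rw [mul_inv, ← mul_assoc, ← zpow_add₀ hq0]
    ring_nf
  have h2 : ∀ j, base ℓ ^ (1 - (-m - ν)) * (a j * (base ℓ ^ m * x⁻¹))⁻¹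
      = base ℓ ^ (1 + ν) * x * (a j)⁻¹ := by
    intro j
    rw [show (1 - (-m - ν)) = (1 + ν) + m by ring, zpow_add₀ hq0 (1 + ν) m]
    field_simp
  simp only [h1, h2]
  have h3 : ∏ j ∈ Finset.Icc 1 (2 * N), (qPoch (base ℓ ^ (1 - ν) * (a j * x)⁻¹) (base ℓ)
        * qPoch (base ℓ ^ (1 + ν) * x * (a j)⁻¹) (base ℓ))
      = ∏ j ∈ Finset.Icc 1 (2 * N), (qPoch (base ℓ ^ (1 + ν) * x * (a j)⁻¹) (base ℓ)
        * qPoch (base ℓ ^ (1 - ν) * (a j * x)⁻¹) (base ℓ)) :=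
    Finset.prod_congr rfl fun _ _ => mul_comm _ _
  rw [h3]
  have h4 : (base ℓ ^ m * x⁻¹) ^ 2 * base ℓ ^ (2 * (-m - ν)) = (x ^ 2 * base ℓ ^ (2 * ν))⁻¹ := by
    rw [mul_pow, inv_pow, mul_inv, ← zpow_natCast, ← zpow_mul, mul_right_comm, ← zpow_add₀ hq0,
      ← zpow_neg, mul_comm]
    congr 2; push_cast; ring
  have h5 : (base ℓ ^ m * x⁻¹) ^ (2 * N * (-m - ν))
      = base ℓ ^ (m * (2 * N * (-m - ν))) * x ^ (2 * N * (m + ν)) := by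
    rw [mul_zpow, ← zpow_mul, inv_zpow', show -(2 * N * (-m - ν)) = 2 * N * (m + ν) by ring]
  have h6 : (x ^ (2 * N * (m + ν)) : ℂ) = x ^ (2 * N * m - 2) * x ^ (2 * N * ν) * x ^ 2 := by
    rw [← zpow_natCast x 2, ← zpow_add₀ hx, ← zpow_add₀ hx]; congr 1; push_cast; ring
  have h7 : base ℓ ^ (N * (-m - ν) ^ 2 - (-m - ν)) * base ℓ ^ (m * (2 * N * (-m - ν)))
      = base ℓ ^ (m - N * m ^ 2) * base ℓ ^ (N * ν ^ 2 - ν) * base ℓ ^ (2 * ν) := by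
    rw [← zpow_add₀ hq0, ← zpow_add₀ hq0, ← zpow_add₀ hq0]; congr 1; ring
  rw [h4, h5, h6]
  have hX : x ^ 2 * base ℓ ^ (2 * ν) ≠ 0 := mul_ne_zero (pow_ne_zero 2 hx) (zpow_ne_zero _ hq0)
  set X := x ^ 2 * base ℓ ^ (2 * ν) with hXdef
  set P := ∏ j ∈ Finset.Icc 1 (2 * N), (qPoch (base ℓ ^ (1 + ν) * x * (a j)⁻¹) (base ℓ)
        * qPoch (base ℓ ^ (1 - ν) * (a j * x)⁻¹) (base ℓ))
  have h8 : X * (1 - X⁻¹) = X - 1 := by field_simp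
  calc _ = (base ℓ ^ (N * (-m - ν) ^ 2 - (-m - ν)) * base ℓ ^ (m * (2 * N * (-m - ν))))
        * (x ^ (2 * N * m - 2) * x ^ (2 * N * ν)) * x ^ 2 * (1 - X⁻¹) * P := by ring
    _ = base ℓ ^ (m - N * m ^ 2) * base ℓ ^ (N * ν ^ 2 - ν)
        * (x ^ (2 * N * m - 2) * x ^ (2 * N * ν)) * (X * (1 - X⁻¹)) * P := by
        rw [h7, hXdef]; ring
    _ = _ := by rw [h8]; ring

lemma jacksonTerm_neg (ν : ℤ) {x : ℂ} (hx : x ≠ 0) :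
    jacksonTerm N ℓ a (-ν) x = -x ^ 2 * jacksonTerm N ℓ a ν x⁻¹ := by
  have h := jacksonTerm_reflect (N := N) (ℓ := ℓ) (a := a) 0 ν (inv_ne_zero hx)
  have h2 : (x⁻¹ : ℂ) ^ (2 * N * (0 : ℤ) - 2) = x ^ 2 := by
    rw [mul_zero, zero_sub, inv_zpow', neg_neg]; exact zpow_natCast x 2
  rw [h2] at h
  simpa using h

lemma jacksonTerm_natCast (hℓ : ℓ.re < 0) (hN : 2 ≤ N) (ha : ∀ j ∈ Finset.Icc 1 (2 * N), a j ≠ 0)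
    (ν : ℕ) {x : ℂ} (hx : x ≠ 0) :
    jacksonTerm N ℓ a ν x = ratio N ℓ a ^ ν * (1 - x ^ 2 * base ℓ ^ (2 * ν))
      * ∏ j ∈ Finset.Icc 1 (2 * N), (qPoch (base ℓ ^ (1 + ν) * x * (a j)⁻¹) (base ℓ)
        * (qPoch (base ℓ * (a j * x)⁻¹) (base ℓ)
          * ∏ k ∈ Finset.range ν, (1 - a j * x * base ℓ ^ k))) := by
  have hq := norm_base_lt_one hℓ
  have hq0 := base_ne_zero ℓ
  set J := Finset.Icc 1 (2 * N) with hJ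
  have hcard : J.card = 2 * N := by simp [hJ]
  have hpa : ∏ j ∈ J, a j ≠ 0 := Finset.prod_ne_zero_iff.mpr ha
  have key : base ℓ ^ (N * (ν : ℤ) ^ 2 - ν) * x ^ (2 * N * (ν : ℤ))
        * ∏ j ∈ J, qPoch (base ℓ ^ (1 - (ν : ℤ)) * (a j * x)⁻¹) (base ℓ)
      = ratio N ℓ a ^ ν * ∏ j ∈ J, (qPoch (base ℓ * (a j * x)⁻¹) (base ℓ)
          * ∏ k ∈ Finset.range ν, (1 - a j * x * base ℓ ^ k)) := by
    induction ν with
    | zero => simp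
    | succ ν ih =>
      have h1 : ∏ j ∈ J, qPoch (base ℓ ^ (1 - ((ν + 1 : ℕ) : ℤ)) * (a j * x)⁻¹) (base ℓ)
          = (∏ j ∈ J, (1 - base ℓ ^ (-(ν : ℤ)) * (a j * x)⁻¹))
            * ∏ j ∈ J, qPoch (base ℓ ^ (1 - (ν : ℤ)) * (a j * x)⁻¹) (base ℓ) := by
        rw [← Finset.prod_mul_distrib]
        refine Finset.prod_congr rfl fun j _ => ?_
        rw [show 1 - ((ν + 1 : ℕ) : ℤ) = -(ν : ℤ) by push_cast; ring, qPoch_eq_mul hq,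
          mul_right_comm, ← zpow_add_one₀ hq0, neg_add_eq_sub]
      have h2 : ∏ j ∈ J, (qPoch (base ℓ * (a j * x)⁻¹) (base ℓ)
            * ∏ k ∈ Finset.range (ν + 1), (1 - a j * x * base ℓ ^ k))
          = (∏ j ∈ J, (qPoch (base ℓ * (a j * x)⁻¹) (base ℓ)
            * ∏ k ∈ Finset.range ν, (1 - a j * x * base ℓ ^ k)))
            * ∏ j ∈ J, (1 - a j * x * base ℓ ^ ν) := by
        rw [← Finset.prod_mul_distrib]
        refine Finset.prod_congr rfl fun j _ => ?_
        rw [Finset.prod_range_succ]; ring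
      have h3 : ∏ j ∈ J, (1 - a j * x * base ℓ ^ ν)
          = (∏ j ∈ J, a j) * (x * base ℓ ^ ν) ^ (2 * N)
            * ∏ j ∈ J, (1 - base ℓ ^ (-(ν : ℤ)) * (a j * x)⁻¹) := by
        have h4 : (x * base ℓ ^ ν) ^ (2 * N) = ∏ j ∈ J, (-(x * base ℓ ^ ν)) := by
          rw [Finset.prod_const, hcard, (even_two_mul N).neg_pow]
        rw [h4, ← Finset.prod_mul_distrib, ← Finset.prod_mul_distrib]
        refine Finset.prod_congr rfl fun j hj => ?_
        have := ha j hj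
        rw [zpow_neg, zpow_natCast]
        field_simp
        ring
      have h5 : base ℓ ^ (N * ((ν + 1 : ℕ) : ℤ) ^ 2 - ((ν + 1 : ℕ) : ℤ))
            * x ^ (2 * N * ((ν + 1 : ℕ) : ℤ))
          = base ℓ ^ (N * (ν : ℤ) ^ 2 - ν) * x ^ (2 * N * (ν : ℤ))
            * (base ℓ ^ (N - 1) * (x * base ℓ ^ ν) ^ (2 * N)) := by
        have e1 : (N * ((ν + 1 : ℕ) : ℤ) ^ 2 - ((ν + 1 : ℕ) : ℤ))
            = (N * (ν : ℤ) ^ 2 - ν) + (((N - 1 : ℕ) : ℤ) + (ν * (2 * N) : ℕ)) := by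
          have : ((N - 1 : ℕ) : ℤ) = N - 1 := by omega
          rw [this]; push_cast; ring
        have e2 : 2 * N * ((ν + 1 : ℕ) : ℤ) = 2 * N * (ν : ℤ) + (2 * N : ℕ) := by push_cast; ring
        rw [e1, e2, zpow_add₀ hq0, zpow_add₀ hx, zpow_add₀ hq0, zpow_natCast, zpow_natCast,
          zpow_natCast, mul_pow, ← pow_mul]
        ring
      have h6 : ratio N ℓ a * ∏ j ∈ J, a j = base ℓ ^ (N - 1) := div_mul_cancel₀ _ hpa
      rw [h1, h2, h3, h5, pow_succ (ratio N ℓ a), ← h6]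
      generalize base ℓ ^ (N * (ν : ℤ) ^ 2 - ν) = A at ih ⊢
      generalize x ^ (2 * N * (ν : ℤ)) = B at ih ⊢
      linear_combination (ratio N ℓ a * (∏ j ∈ J, a j) * (x * base ℓ ^ ν) ^ (2 * N)
        * ∏ j ∈ J, (1 - base ℓ ^ (-(ν : ℤ)) * (a j * x)⁻¹)) * ih
  have h7 : (base ℓ ^ (2 * (ν : ℤ)) : ℂ) = base ℓ ^ (2 * ν) := by
    exact_mod_cast zpow_natCast (base ℓ) (2 * ν)
  have h8 : (base ℓ ^ (1 + (ν : ℤ)) : ℂ) = base ℓ ^ (1 + ν) := by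
    exact_mod_cast zpow_natCast (base ℓ) (1 + ν)
  rw [jacksonTerm, h7, h8, Finset.prod_mul_distrib, Finset.prod_mul_distrib]
  generalize base ℓ ^ (N * (ν : ℤ) ^ 2 - ν) = A at key ⊢
  generalize x ^ (2 * N * (ν : ℤ)) = B at key ⊢
  linear_combination ((1 - x ^ 2 * base ℓ ^ (2 * ν))
    * ∏ j ∈ J, qPoch (base ℓ ^ (1 + ν) * x * (a j)⁻¹) (base ℓ)) * key

lemma exists_bound_jacksonTerm (hℓ : ℓ.re < 0) (hN : 2 ≤ N)
    (ha : ∀ j ∈ Finset.Icc 1 (2 * N), a j ≠ 0) {R : ℝ} (hR : 0 < R) :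
    ∃ C : ℝ, ∀ (ν : ℤ) (x : ℂ), ‖x‖ < R → ‖x⁻¹‖ < R →  x ≠ 0 →
      ‖jacksonTerm N ℓ a ν x‖ ≤ C * ‖ratio N ℓ a‖ ^ ν.natAbs := by
  have hq := norm_base_lt_one hℓ
  have hqp : ∀ k : ℕ, ‖base ℓ ^ k‖ ≤ 1 := fun k => by
    rw [norm_pow]; exact pow_le_one₀ (norm_nonneg _) hq.le
  set E : ℝ → ℝ := fun r => Real.exp (r / (1 - ‖base ℓ‖)) with hE
  set C : ℝ := (1 + R ^ 2) * ∏ j ∈ Finset.Icc 1 (2 * N),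
    (E (R * ‖(a j)⁻¹‖) * (E (‖(a j)⁻¹‖ * R) * E (‖a j‖ * R))) with hC
  have hC0 : 0 ≤ C := by positivity
  have hnat : ∀ (ν : ℕ) (x : ℂ), ‖x‖ < R → ‖x⁻¹‖ < R → x ≠ 0 →
      ‖jacksonTerm N ℓ a ν x‖ ≤ C * ‖ratio N ℓ a‖ ^ ν := by
    intro ν x h1 h2 hx
    rw [jacksonTerm_natCast hℓ hN ha ν hx, norm_mul, norm_mul, norm_pow, norm_prod, mul_assoc,
      mul_comm C, hC]
    refine mul_le_mul_of_nonneg_left ?_ (by positivity)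
    refine mul_le_mul ?_ ?_ (Finset.prod_nonneg fun _ _ => norm_nonneg _) (by positivity)
    · refine (norm_sub_le _ _).trans ?_
      rw [norm_one, norm_mul, norm_pow]
      have := hqp (2 * ν)
      have h3 : ‖x‖ ^ 2 ≤ R ^ 2 := by gcongr
      nlinarith [sq_nonneg ‖x‖, norm_nonneg (base ℓ ^ (2 * ν))]
    · refine Finset.prod_le_prod (fun _ _ => norm_nonneg _) fun j _ => ?_
      rw [norm_mul, norm_mul]
      refine mul_le_mul ?_ (mul_le_mul ?_ ?_ (norm_nonneg _) (by positivity)) (by positivity)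
        (by positivity)
      · refine norm_qPoch_le hq ?_
        rw [norm_mul, norm_mul]
        have := hqp (1 + ν)
        have h4 : ‖base ℓ ^ (1 + ν)‖ * ‖x‖ ≤ 1 * R := by gcongr
        rw [one_mul] at h4
        gcongr
      · refine norm_qPoch_le hq ?_
        rw [mul_inv, norm_mul, norm_mul]
        have h4 : ‖base ℓ‖ * (‖(a j)⁻¹‖ * ‖x⁻¹‖) ≤ 1 * (‖(a j)⁻¹‖ * R) := by gcongr
        rwa [one_mul] at h4
      · refine norm_prod_one_sub_le hq ?_ ν
        rw [norm_mul]; gcongr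
  refine ⟨(1 + R ^ 2) * C, fun ν x h1 h2 hx => ?_⟩
  have hpos : 0 ≤ C * ‖ratio N ℓ a‖ ^ ν.natAbs := by positivity
  obtain ⟨k, rfl | rfl⟩ := ν.eq_nat_or_neg
  · refine (hnat k x h1 h2 hx).trans ?_
    rw [Int.natAbs_natCast] at hpos ⊢
    nlinarith [sq_nonneg R]
  · rw [jacksonTerm_neg _ hx, norm_mul, norm_neg, norm_pow]
    have h3 := hnat k x⁻¹ h2 (by rwa [inv_inv]) (inv_ne_zero hx)
    rw [Int.natAbs_neg, Int.natAbs_natCast] at hpos ⊢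
    have h4 : ‖x‖ ^ 2 ≤ R ^ 2 := by gcongr
    calc ‖x‖ ^ 2 * ‖jacksonTerm N ℓ a k x⁻¹‖ ≤ R ^ 2 * (C * ‖ratio N ℓ a‖ ^ k) := by gcongr
      _ ≤ _ := by nlinarith

lemma summable_pow_natAbs {r : ℝ} (h0 : 0 ≤ r) (h1 : r < 1) :
    Summable fun ν : ℤ => r ^ ν.natAbs := by
  refine Summable.of_nat_of_neg ?_ ?_ <;> simpa using summable_geometric_of_lt_one h0 h1

end Jackson


section Regularisation

variable {N : ℕ} {ℓ : ℂ} {a : ℕ → ℂ}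

lemma prod_theta_mul_zpow (hℓ : ℓ.re < 0) (hN : 2 ≤ N)
    (ha : ∀ j ∈ Finset.Icc 1 (2 * N), a j ≠ 0) (ν : ℤ) {x : ℂ} (hx : x ≠ 0) :
    base ℓ ^ (N * ν ^ 2 - ν) * x ^ (2 * N * ν)
        * ∏ j ∈ Finset.Icc 1 (2 * N), theta (a j * (x * base ℓ ^ ν)) (base ℓ)
      = ratio N ℓ a ^ ν * ∏ j ∈ Finset.Icc 1 (2 * N), theta (a j * x) (base ℓ) := by
  have hq := norm_base_lt_one hℓ
  have hq0 := base_ne_zero ℓ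
  set J := Finset.Icc 1 (2 * N) with hJ
  have hcard : J.card = 2 * N := by simp [hJ]
  have hpa : ∏ j ∈ J, a j ≠ 0 := Finset.prod_ne_zero_iff.mpr ha
  have hρ : ratio N ℓ a ≠ 0 := div_ne_zero (pow_ne_zero _ hq0) hpa
  have hper : Function.Periodic (fun ν : ℤ => (ratio N ℓ a ^ ν)⁻¹ * (base ℓ ^ (N * ν ^ 2 - ν)
      * x ^ (2 * N * ν) * ∏ j ∈ J, theta (a j * (x * base ℓ ^ ν)) (base ℓ))) 1 := by
    intro ν
    have h1 : ∏ j ∈ J, theta (a j * (x * base ℓ ^ (ν + 1))) (base ℓ)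
        = ((∏ j ∈ J, a j) * (x * base ℓ ^ ν) ^ (2 * N))⁻¹
          * ∏ j ∈ J, theta (a j * (x * base ℓ ^ ν)) (base ℓ) := by
      have h4 : (x * base ℓ ^ ν) ^ (2 * N) = ∏ j ∈ J, (-(x * base ℓ ^ ν)) := by
        rw [Finset.prod_const, hcard, (even_two_mul N).neg_pow]
      rw [h4, ← Finset.prod_mul_distrib, ← Finset.prod_inv_distrib, ← Finset.prod_mul_distrib]
      refine Finset.prod_congr rfl fun j hj => ?_
      have h5 : a j * (x * base ℓ ^ ν) ≠ 0 :=
        mul_ne_zero (ha j hj) (mul_ne_zero hx (zpow_ne_zero _ hq0))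
      rw [zpow_add_one₀ hq0,
        show a j * (x * (base ℓ ^ ν * base ℓ)) = base ℓ * (a j * (x * base ℓ ^ ν)) by ring,
        theta_mul_base hq hq0 h5, mul_neg, inv_neg]
    have h2 : base ℓ ^ (N * (ν + 1) ^ 2 - (ν + 1)) * x ^ (2 * N * (ν + 1))
        = base ℓ ^ (N * ν ^ 2 - ν) * x ^ (2 * N * ν)
          * (base ℓ ^ (N - 1) * (x * base ℓ ^ ν) ^ (2 * N)) := by
      have e1 : (N * (ν + 1) ^ 2 - (ν + 1))
          = (N * ν ^ 2 - ν) + (((N - 1 : ℕ) : ℤ) + (ν * (2 * N : ℕ))) := by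
        have : ((N - 1 : ℕ) : ℤ) = N - 1 := by omega
        rw [this]; push_cast; ring
      have e2 : 2 * N * (ν + 1) = 2 * N * ν + (2 * N : ℕ) := by push_cast; ring
      rw [e1, e2, zpow_add₀ hq0, zpow_add₀ hx, zpow_add₀ hq0, zpow_natCast, zpow_natCast,
        mul_pow, ← zpow_natCast (base ℓ ^ ν), ← zpow_mul]
      ring
    have h6 : ratio N ℓ a * ∏ j ∈ J, a j = base ℓ ^ (N - 1) := div_mul_cancel₀ _ hpa
    have h7 : (x * base ℓ ^ ν) ^ (2 * N) ≠ 0 :=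
      pow_ne_zero _ (mul_ne_zero hx (zpow_ne_zero _ hq0))
    beta_reduce
    rw [h1, h2, zpow_add_one₀ hρ, ← h6]
    generalize base ℓ ^ (N * ν ^ 2 - ν) = A
    generalize x ^ (2 * N * ν) = B
    generalize ∏ j ∈ J, theta (a j * (x * base ℓ ^ ν)) (base ℓ) = E
    generalize (x * base ℓ ^ ν) ^ (2 * N) = D at h7 ⊢
    field_simp
  have h := hper.int_mul_eq ν
  simp only [mul_one, Int.cast_id, zpow_zero, inv_one, one_mul, mul_zero, sub_zero, ne_eq,
    OfNat.ofNat_ne_zero, not_false_eq_true, zero_pow] at h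
  rw [← h, mul_inv_cancel_left₀ (zpow_ne_zero _ hρ)]

lemma jacksonTerm_eq (hℓ : ℓ.re < 0) (hN : 2 ≤ N) (ha : ∀ j ∈ Finset.Icc 1 (2 * N), a j ≠ 0)
    (ν : ℤ) {x : ℂ} (hx : x ≠ 0)
    (h : ∀ j ∈ Finset.Icc 1 (2 * N), qPoch (a j * (x * base ℓ ^ ν)) (base ℓ) ≠ 0) :
    jacksonTerm N ℓ a ν x = ratio N ℓ a ^ ν * qPart N ℓ a (x * base ℓ ^ ν)
      * ∏ j ∈ Finset.Icc 1 (2 * N), theta (a j * x) (base ℓ) := by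
  have hq0 := base_ne_zero ℓ
  have key := prod_theta_mul_zpow hℓ hN ha ν hx
  have h1 : ∏ j ∈ Finset.Icc 1 (2 * N), (qPoch (base ℓ ^ (1 + ν) * x * (a j)⁻¹) (base ℓ)
        * qPoch (base ℓ ^ (1 - ν) * (a j * x)⁻¹) (base ℓ))
      = (∏ j ∈ Finset.Icc 1 (2 * N), (qPoch (base ℓ * (a j)⁻¹ * (x * base ℓ ^ ν)) (base ℓ)
          / qPoch (a j * (x * base ℓ ^ ν)) (base ℓ)))
        * ∏ j ∈ Finset.Icc 1 (2 * N), theta (a j * (x * base ℓ ^ ν)) (base ℓ) := by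
    rw [← Finset.prod_mul_distrib]
    refine Finset.prod_congr rfl fun j hj => ?_
    have e1 : base ℓ ^ (1 + ν) * x * (a j)⁻¹ = base ℓ * (a j)⁻¹ * (x * base ℓ ^ ν) := by
      rw [zpow_add₀ hq0, zpow_one]; ring
    have e2 : base ℓ ^ (1 - ν) * (a j * x)⁻¹ = base ℓ * (a j * (x * base ℓ ^ ν))⁻¹ := by
      rw [zpow_sub₀ hq0, zpow_one, mul_inv, mul_inv, mul_inv]; ring
    rw [theta, e1, e2]
    generalize qPoch (base ℓ * (a j)⁻¹ * (x * base ℓ ^ ν)) (base ℓ) = A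
    have h0 := h j hj
    generalize qPoch (a j * (x * base ℓ ^ ν)) (base ℓ) = B at h0 ⊢
    field_simp
  have h2 : x ^ 2 * base ℓ ^ (2 * ν) = (x * base ℓ ^ ν) ^ 2 := by
    rw [mul_pow, ← zpow_natCast (base ℓ ^ ν), ← zpow_mul, mul_comm ν]; rfl
  rw [jacksonTerm, h1, h2, qPart]
  generalize base ℓ ^ (N * ν ^ 2 - ν) = A at key ⊢
  generalize x ^ (2 * N * ν) = B at key ⊢
  linear_combination ((1 - (x * base ℓ ^ ν) ^ 2)
    * ∏ j ∈ Finset.Icc 1 (2 * N), (qPoch (base ℓ * (a j)⁻¹ * (x * base ℓ ^ ν)) (base ℓ)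
          / qPoch (a j * (x * base ℓ ^ ν)) (base ℓ))) * key

lemma differentiableAt_jacksonTerm (hℓ : ℓ.re < 0) (ha : ∀ j ∈ Finset.Icc 1 (2 * N), a j ≠ 0)
    (ν : ℤ) {x : ℂ} (hx : x ≠ 0) : DifferentiableAt ℂ (jacksonTerm N ℓ a ν) x := by
  have hp := differentiable_qPoch (norm_base_lt_one hℓ)
  have h1 : DifferentiableAt ℂ (fun x : ℂ => x ^ (2 * N * ν)) x :=
    differentiableAt_zpow.mpr (Or.inl hx)
  have h2 : DifferentiableAt ℂ (fun x : ℂ => ∏ j ∈ Finset.Icc 1 (2 * N),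
      (qPoch (base ℓ ^ (1 + ν) * x * (a j)⁻¹) (base ℓ)
      * qPoch (base ℓ ^ (1 - ν) * (a j * x)⁻¹) (base ℓ))) x := by
    refine DifferentiableAt.fun_finsetProd fun j hj => ?_
    have h3 : DifferentiableAt ℂ (fun x : ℂ => base ℓ ^ (1 - ν) * (a j * x)⁻¹) x :=
      ((differentiableAt_id.const_mul (a j)).inv (mul_ne_zero (ha j hj) hx)).const_mul _
    have h4 : DifferentiableAt ℂ (fun x : ℂ => base ℓ ^ (1 + ν) * x * (a j)⁻¹) x := by fun_prop
    exact ((hp _).comp x h4).mul ((hp _).comp x h3)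
  unfold jacksonTerm
  exact ((h1.const_mul _).mul (by fun_prop)).mul h2

/-- The sum of the `jacksonTerm`s. -/
noncomputable def jacksonSum (N : ℕ) (ℓ : ℂ) (a : ℕ → ℂ) (x : ℂ) : ℂ :=
  ∑' ν : ℤ, jacksonTerm N ℓ a ν x

/-- The regularised Jackson integral. -/
noncomputable def regularised (N : ℕ) (ℓ : ℂ) (a : ℕ → ℂ) : ℂ → ℂ :=
  quot (jacksonSum N ℓ a) fun x => theta (x ^ 2) (base ℓ)

lemma exists_annulus_bound (hℓ : ℓ.re < 0) (hN : 2 ≤ N)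
    (ha : ∀ j ∈ Finset.Icc 1 (2 * N), a j ≠ 0) (hρ : ‖ratio N ℓ a‖ < 1) {x : ℂ} (hx : x ≠ 0) :
    ∃ (U : Set ℂ) (b : ℤ → ℝ), IsOpen U ∧ x ∈ U ∧ (∀ y ∈ U, y ≠ 0) ∧ Summable b ∧
      ∀ ν, ∀ y ∈ U, ‖jacksonTerm N ℓ a ν y‖ ≤ b ν := by
  have hR : 0 < ‖x‖ + ‖x⁻¹‖ + 1 := by positivity
  set R := ‖x‖ + ‖x⁻¹‖ + 1 with hRdef
  obtain ⟨C, hC⟩ := exists_bound_jacksonTerm hℓ hN ha hR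
  refine ⟨{y | R⁻¹ < ‖y‖} ∩ {y | ‖y‖ < R}, fun ν => C * ‖ratio N ℓ a‖ ^ ν.natAbs,
    (isOpen_lt continuous_const continuous_norm).inter
      (isOpen_lt continuous_norm continuous_const), ⟨?_, ?_⟩, fun y hy => ?_,
    (summable_pow_natAbs (norm_nonneg _) hρ).mul_left C, fun ν y hy => ?_⟩
  · change R⁻¹ < ‖x‖
    rw [inv_lt_comm₀ hR (norm_pos_iff.mpr hx), ← norm_inv]
    have := norm_nonneg x
    linarith
  · change ‖x‖ < R
    have := norm_nonneg x⁻¹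
    linarith
  · exact norm_pos_iff.mp ((inv_pos.mpr hR).trans hy.1)
  · have hy0 : 0 < ‖y‖ := (inv_pos.mpr hR).trans hy.1
    refine hC ν y hy.2 ?_ (norm_pos_iff.mp hy0)
    rw [norm_inv, inv_lt_comm₀ hy0 hR]
    exact hy.1

lemma summable_jacksonTerm (hℓ : ℓ.re < 0) (hN : 2 ≤ N)
    (ha : ∀ j ∈ Finset.Icc 1 (2 * N), a j ≠ 0) (hρ : ‖ratio N ℓ a‖ < 1) {x : ℂ} (hx : x ≠ 0) :
    Summable fun ν => jacksonTerm N ℓ a ν x := by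
  obtain ⟨U, b, -, hxU, -, hb, hle⟩ := exists_annulus_bound hℓ hN ha hρ hx
  exact Summable.of_norm_bounded hb fun ν => hle ν x hxU

lemma differentiableAt_jacksonSum (hℓ : ℓ.re < 0) (hN : 2 ≤ N)
    (ha : ∀ j ∈ Finset.Icc 1 (2 * N), a j ≠ 0) (hρ : ‖ratio N ℓ a‖ < 1) {x : ℂ} (hx : x ≠ 0) :
    DifferentiableAt ℂ (jacksonSum N ℓ a) x := by
  obtain ⟨U, b, hU, hxU, hU0, hb, hle⟩ := exists_annulus_bound hℓ hN ha hρ hx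
  exact (differentiableOn_tsum_of_summable_norm hb (fun ν y hy =>
    (differentiableAt_jacksonTerm hℓ ha ν (hU0 y hy)).differentiableWithinAt) hU hle).differentiableAt
    (hU.mem_nhds hxU)

lemma hasSum_deriv_jacksonTerm (hℓ : ℓ.re < 0) (hN : 2 ≤ N)
    (ha : ∀ j ∈ Finset.Icc 1 (2 * N), a j ≠ 0) (hρ : ‖ratio N ℓ a‖ < 1) {x : ℂ} (hx : x ≠ 0) :
    HasSum (fun ν => deriv (jacksonTerm N ℓ a ν) x) (deriv (jacksonSum N ℓ a) x) := by
  obtain ⟨U, b, hU, hxU, hU0, hb, hle⟩ := exists_annulus_bound hℓ hN ha hρ hx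
  exact hasSum_deriv_of_summable_norm hb (fun ν y hy =>
    (differentiableAt_jacksonTerm hℓ ha ν (hU0 y hy)).differentiableWithinAt) hU hle hxU

lemma zpow_reflect_eq_one {m : ℤ} {x : ℂ} (hx2 : x ^ 2 = base ℓ ^ m) :
    base ℓ ^ (m - N * m ^ 2) * x ^ (2 * N * m - 2) = 1 := by
  have h : (x : ℂ) ^ (2 * N * m - 2) = (x ^ 2) ^ (N * m - 1) := by
    rw [← zpow_natCast x 2, ← zpow_mul]; congr 1; push_cast; ring
  rw [h, hx2, ← zpow_mul, ← zpow_add₀ (base_ne_zero ℓ)]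
  convert zpow_zero (base ℓ) using 2
  ring

lemma reflect_eq_self {m : ℤ} {x : ℂ} (hx : x ≠ 0) (hx2 : x ^ 2 = base ℓ ^ m) :
    base ℓ ^ m * x⁻¹ = x := by
  rw [← hx2]; field_simp

lemma jacksonSum_eq_zero (hℓ : ℓ.re < 0) {x : ℂ} (hx : x ≠ 0)
    (h : theta (x ^ 2) (base ℓ) = 0) : jacksonSum N ℓ a x = 0 := by
  obtain ⟨m, hm⟩ := (theta_eq_zero_iff (norm_base_lt_one hℓ) (base_ne_zero ℓ)
    (pow_ne_zero 2 hx)).mp h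
  have h1 : ∀ ν : ℤ, jacksonTerm N ℓ a (Equiv.subLeft (-m) ν) x = -jacksonTerm N ℓ a ν x := by
    intro ν
    have h2 := jacksonTerm_reflect (N := N) (ℓ := ℓ) (a := a) m ν hx
    rw [reflect_eq_self hx hm, zpow_reflect_eq_one hm, neg_one_mul] at h2
    exact h2
  have h2 := (Equiv.subLeft (-m)).tsum_eq fun ν => jacksonTerm N ℓ a ν x
  simp only [h1, tsum_neg] at h2
  exact self_eq_neg.mp h2.symm

lemma differentiableAt_theta_sq (hℓ : ℓ.re < 0) {x : ℂ} (hx : x ≠ 0) :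
    DifferentiableAt ℂ (fun x : ℂ => theta (x ^ 2) (base ℓ)) x :=
  (differentiableAt_theta (norm_base_lt_one hℓ) (pow_ne_zero 2 hx)).comp x
    (differentiableAt_pow 2)

lemma deriv_theta_sq (hℓ : ℓ.re < 0) {x : ℂ} (hx : x ≠ 0) :
    deriv (fun x : ℂ => theta (x ^ 2) (base ℓ)) x
      = 2 * x * deriv (fun z => theta z (base ℓ)) (x ^ 2) := by
  have h := (differentiableAt_theta (norm_base_lt_one hℓ) (pow_ne_zero 2 hx)).hasDerivAt.comp x
    (hasDerivAt_pow 2 x)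
  rw [show (fun x : ℂ => theta (x ^ 2) (base ℓ))
    = (fun z => theta z (base ℓ)) ∘ (fun x => x ^ 2) from rfl, h.deriv]
  push_cast; ring

lemma differentiableOn_regularised (hℓ : ℓ.re < 0) (hN : 2 ≤ N)
    (ha : ∀ j ∈ Finset.Icc 1 (2 * N), a j ≠ 0) (hρ : ‖ratio N ℓ a‖ < 1) :
    DifferentiableOn ℂ (regularised N ℓ a) {z | z ≠ 0} := by
  refine differentiableOn_quot isOpen_ne (fun x hx => ?_) (fun x hx => ?_) (fun x hx h => ?_)
    fun x hx h => ?_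
  · exact (differentiableAt_jacksonSum hℓ hN ha hρ hx).differentiableWithinAt
  · exact (differentiableAt_theta_sq hℓ hx).differentiableWithinAt
  · exact jacksonSum_eq_zero hℓ hx h
  · rw [deriv_theta_sq hℓ hx]
    exact mul_ne_zero (mul_ne_zero two_ne_zero hx) (deriv_theta_ne_zero (norm_base_lt_one hℓ)
      (base_ne_zero ℓ) (pow_ne_zero 2 hx) h)

lemma Q_add_int_mul {s : ℕ → ℂ} (hs : ∀ j ∈ Finset.Icc 1 (2 * N), exp (s j * ℓ) = a j)
    (hN : 2 ≤ N) (w : ℂ) (ν : ℤ) :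
    Q N ℓ a s (w + ν * ℓ) = exp (((N : ℂ) - 1 - ∑ j ∈ Finset.Icc 1 (2 * N), s j) * w)
      * (ratio N ℓ a ^ ν * qPart N ℓ a (exp w * base ℓ ^ ν)) := by
  have hz : exp (w + ν * ℓ) = exp w * base ℓ ^ ν := by rw [exp_add, exp_int_mul]; rfl
  have h1 : ∑ j ∈ Finset.Icc 1 (2 * N), (1 / 2 - s j) * (w + ν * ℓ)
      = (N - ∑ j ∈ Finset.Icc 1 (2 * N), s j) * (w + ν * ℓ) := by
    rw [← Finset.sum_mul, Finset.sum_sub_distrib, Finset.sum_const, Nat.card_Icc]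
    congr 2
    simp
    ring
  have h2 : ratio N ℓ a = exp (((N : ℂ) - 1 - ∑ j ∈ Finset.Icc 1 (2 * N), s j) * ℓ) := by
    rw [ratio, ← Finset.prod_congr rfl hs, ← exp_sum, base, ← exp_nat_mul, ← exp_sub,
      Nat.cast_sub (by omega), ← Finset.sum_mul]
    congr 1; push_cast; ring
  rw [Q, Finset.prod_mul_distrib, ← exp_sum, h1, qPart, ← hz, h2, ← exp_int_mul]
  have h3 : exp (-(w + ν * ℓ)) - exp (w + ν * ℓ)
      = exp (-(w + ν * ℓ)) * (1 - exp (w + ν * ℓ) ^ 2) := by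
    rw [mul_sub, mul_one, sq, ← mul_assoc, ← exp_add, neg_add_cancel, exp_zero, one_mul]
  have h4 : exp ((N - ∑ j ∈ Finset.Icc 1 (2 * N), s j) * (w + ν * ℓ)) * exp (-(w + ν * ℓ))
      = exp (((N : ℂ) - 1 - ∑ j ∈ Finset.Icc 1 (2 * N), s j) * w)
        * exp (ν * (((N : ℂ) - 1 - ∑ j ∈ Finset.Icc 1 (2 * N), s j) * ℓ)) := by
    rw [← exp_add, ← exp_add]; congr 1; ring
  rw [h3]
  linear_combination ((1 - exp (w + ν * ℓ) ^ 2) * ∏ j ∈ Finset.Icc 1 (2 * N),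
    (qPoch (base ℓ * (a j)⁻¹ * exp (w + ν * ℓ)) (base ℓ)
              / qPoch (a j * exp (w + ν * ℓ)) (base ℓ))) * h4

lemma qPoch_ne_zero_of_theta (hℓ : ℓ.re < 0) {z : ℂ} (h : theta z (base ℓ) ≠ 0) (ν : ℤ)
    (hz : z ≠ 0) : qPoch (z * base ℓ ^ ν) (base ℓ) ≠ 0 := by
  have hq := norm_base_lt_one hℓ
  have hq0 := base_ne_zero ℓ
  intro h0
  obtain ⟨k, hk⟩ := (qPoch_eq_zero_iff hq).mp h0
  refine h ((theta_eq_zero_iff hq hq0 hz).mpr ⟨-(ν + k), ?_⟩)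
  rw [mul_assoc, ← zpow_natCast, ← zpow_add₀ hq0] at hk
  rw [zpow_neg]
  exact eq_inv_of_mul_eq_one_left hk

theorem isRegularisation_regularised (hℓ : ℓ.re < 0) (hN : 2 ≤ N)
    (ha : ∀ j ∈ Finset.Icc 1 (2 * N), a j ≠ 0) (hρ : ‖ratio N ℓ a‖ < 1) {s : ℕ → ℂ}
    (hs : ∀ j ∈ Finset.Icc 1 (2 * N), exp (s j * ℓ) = a j) :
    IsRegularisation N ℓ a s (regularised N ℓ a) := by
  refine ⟨differentiableOn_regularised hℓ hN ha hρ, fun w h1 h2 => ?_⟩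
  set X := exp w with hX
  have hx : X ≠ 0 := exp_ne_zero w
  have hP : ∏ j ∈ Finset.Icc 1 (2 * N), theta (a j * X) (base ℓ) ≠ 0 :=
    Finset.prod_ne_zero_iff.mpr h2
  have h3 : ∀ ν : ℤ, Q N ℓ a s (w + ν * ℓ)
      = exp (((N : ℂ) - 1 - ∑ j ∈ Finset.Icc 1 (2 * N), s j) * w)
        * (∏ j ∈ Finset.Icc 1 (2 * N), theta (a j * X) (base ℓ))⁻¹ * jacksonTerm N ℓ a ν X := by
    intro ν
    rw [Q_add_int_mul hs hN, jacksonTerm_eq hℓ hN ha ν hx, ← hX]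
    · generalize ∏ j ∈ Finset.Icc 1 (2 * N), theta (a j * X) (base ℓ) = P at hP ⊢
      field_simp
    · intro j hj
      rw [← mul_assoc]
      exact qPoch_ne_zero_of_theta hℓ (h2 j hj) ν (mul_ne_zero (ha j hj) hx)
  refine ⟨?_, ?_⟩
  · simp only [h3]
    exact (summable_jacksonTerm hℓ hN ha hρ hx).mul_left _
  · have h4 : regularised N ℓ a X = jacksonSum N ℓ a X / theta (X ^ 2) (base ℓ) := quot_of_ne h1
    rw [h4, jackson, hFactor, ← hX]
    simp only [h3, tsum_mul_left]
    rw [← jacksonSum]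
    have := exp_ne_zero (((N : ℂ) - 1 - ∑ j ∈ Finset.Icc 1 (2 * N), s j) * w)
    generalize ∏ j ∈ Finset.Icc 1 (2 * N), theta (a j * X) (base ℓ) = P at hP ⊢
    field_simp

end Regularisation


section Value

variable {N : ℕ} {ℓ : ℂ} {a : ℕ → ℂ} {i : ℕ}

lemma jacksonTerm_eq_zero_of_neg (hi : i ∈ Finset.Icc 1 (2 * N))
    (ha : a i ≠ 0) (hℓ : ℓ.re < 0) {ν : ℤ} (hν : ν < 0) : jacksonTerm N ℓ a ν (a i) = 0 := by
  rw [jacksonTerm, Finset.prod_eq_zero hi, mul_zero]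
  have : qPoch (base ℓ ^ (1 + ν) * a i * (a i)⁻¹) (base ℓ) = 0 := by
    rw [mul_assoc, mul_inv_cancel₀ ha, mul_one, qPoch_eq_zero_iff (norm_base_lt_one hℓ)]
    refine ⟨(-1 - ν).toNat, ?_⟩
    rw [← zpow_natCast, ← zpow_add₀ (base_ne_zero ℓ), Int.toNat_of_nonneg (by omega)]
    convert zpow_zero (base ℓ) using 2
    ring
  rw [this, zero_mul]

lemma qPoch_mul_ne_zero (hℓ : ℓ.re < 0) (ha1 : ∀ j ∈ Finset.Icc 1 (2 * N), ‖a j‖ < 1) {x : ℂ}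
    (hx : ‖x‖ ≤ 1) : ∀ j ∈ Finset.Icc 1 (2 * N), qPoch (a j * x) (base ℓ) ≠ 0 := by
  intro j hj
  refine qPoch_ne_zero_of_norm_lt (norm_base_lt_one hℓ) ?_
  rw [norm_mul]
  exact (mul_le_of_le_one_right (norm_nonneg _) hx).trans_lt (ha1 j hj)

lemma norm_mul_base_pow_le (hℓ : ℓ.re < 0) {x : ℂ} {r : ℝ} (hx : ‖x‖ ≤ r) (k : ℕ) :
    ‖x * base ℓ ^ k‖ ≤ r := by
  rw [norm_mul, norm_pow]
  exact (mul_le_of_le_one_right (norm_nonneg _)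
    (pow_le_one₀ (norm_nonneg _) (norm_base_lt_one hℓ).le)).trans hx

lemma differentiableAt_qPart (hℓ : ℓ.re < 0) {x : ℂ}
    (hx : ∀ j ∈ Finset.Icc 1 (2 * N), qPoch (a j * x) (base ℓ) ≠ 0) :
    DifferentiableAt ℂ (qPart N ℓ a) x := by
  have hp := differentiable_qPoch (norm_base_lt_one hℓ)
  unfold qPart
  refine DifferentiableAt.mul (by fun_prop) (DifferentiableAt.fun_finsetProd fun j hj => ?_)
  exact DifferentiableAt.div ((hp _).comp x (by fun_prop)) ((hp _).comp x (by fun_prop)) (hx j hj)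

lemma hasDerivAt_prod_theta (hℓ : ℓ.re < 0) (ha : ∀ j ∈ Finset.Icc 1 (2 * N), a j ≠ 0)
    (hi : i ∈ Finset.Icc 1 (2 * N)) (h0 : theta (a i ^ 2) (base ℓ) = 0) :
    HasDerivAt (fun x => ∏ j ∈ Finset.Icc 1 (2 * N), theta (a j * x) (base ℓ))
      (a i * deriv (fun z => theta z (base ℓ)) (a i ^ 2)
        * ∏ j ∈ (Finset.Icc 1 (2 * N)).erase i, theta (a j * a i) (base ℓ)) (a i) := by
  have hq := norm_base_lt_one hℓ
  have hth : ∀ j ∈ Finset.Icc 1 (2 * N), HasDerivAt (fun x => theta (a j * x) (base ℓ))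
      (a j * deriv (fun z => theta z (base ℓ)) (a j * a i)) (a i) := by
    intro j hj
    have h1 := (differentiableAt_theta hq (mul_ne_zero (ha j hj) (ha i hi))).hasDerivAt
    have h2 := h1.comp (a i) ((hasDerivAt_id (a i)).const_mul (a j))
    exact h2.congr_deriv (by rw [mul_one, mul_comm])
  have h3 : ∀ x, ∏ j ∈ Finset.Icc 1 (2 * N), theta (a j * x) (base ℓ)
      = theta (a i * x) (base ℓ)
        * ∏ j ∈ (Finset.Icc 1 (2 * N)).erase i, theta (a j * x) (base ℓ) :=
    fun x => (Finset.mul_prod_erase _ _ hi).symm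
  have h4 : DifferentiableAt ℂ
      (fun x => ∏ j ∈ (Finset.Icc 1 (2 * N)).erase i, theta (a j * x) (base ℓ)) (a i) :=
    DifferentiableAt.fun_finsetProd fun j hj =>
      (hth j (Finset.mem_of_mem_erase hj)).differentiableAt
  have h5 := (hth i hi).mul h4.hasDerivAt
  simp only [← sq] at h5
  rw [h0, zero_mul, add_zero] at h5
  exact h5.congr_of_eventuallyEq (Eventually.of_forall h3)

theorem regularised_apply (hℓ : ℓ.re < 0) (hN : 2 ≤ N)
    (ha : ∀ j ∈ Finset.Icc 1 (2 * N), a j ≠ 0) (ha1 : ∀ j ∈ Finset.Icc 1 (2 * N), ‖a j‖ < 1)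
    (hρ : ‖ratio N ℓ a‖ < 1) (hi : i ∈ Finset.Icc 1 (2 * N)) :
    regularised N ℓ a (a i)
      = (∏ j ∈ (Finset.Icc 1 (2 * N)).erase i, theta (a j * a i) (base ℓ))
        * ∑' k : ℕ, ratio N ℓ a ^ k * qPart N ℓ a (a i * base ℓ ^ k) := by
  have hq := norm_base_lt_one hℓ
  have hq0 := base_ne_zero ℓ
  have hai := ha i hi
  have hle : ∀ k : ℕ, ‖a i * base ℓ ^ k‖ ≤ 1 := norm_mul_base_pow_le hℓ (ha1 i hi).le
  have hne := fun k => qPoch_mul_ne_zero hℓ ha1 (hle k)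
  set P := ∏ j ∈ (Finset.Icc 1 (2 * N)).erase i, theta (a j * a i) (base ℓ) with hP
  have hinj : Function.Injective (fun k : ℕ => (k : ℤ)) := Nat.cast_injective
  have hneg : ∀ ν : ℤ, ν ∉ Set.range (fun k : ℕ => (k : ℤ)) → ν < 0 := by
    intro ν hν
    by_contra h
    exact hν ⟨ν.toNat, Int.toNat_of_nonneg (not_lt.mp h)⟩
  by_cases h0 : theta (a i ^ 2) (base ℓ) = 0
  · obtain ⟨m, hm⟩ := (theta_eq_zero_iff hq hq0 (pow_ne_zero 2 hai)).mp h0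
    have hm1 : 0 < m := by
      by_contra h
      have h1 : ‖a i ^ 2‖ < 1 := by
        rw [norm_pow]; exact pow_lt_one₀ (norm_nonneg _) (ha1 i hi) two_ne_zero
      rw [hm, norm_zpow] at h1
      exact absurd h1 (not_lt.mpr (one_le_zpow_of_nonpos₀ (norm_pos_iff.mpr hq0) hq.le
        (not_lt.mp h)))
    set δ := a i * deriv (fun z => theta z (base ℓ)) (a i ^ 2) with hδ
    have hδ0 : δ ≠ 0 := mul_ne_zero hai (deriv_theta_ne_zero hq hq0 (pow_ne_zero 2 hai) h0)
    set d : ℤ → ℂ := fun ν => deriv (jacksonTerm N ℓ a ν) (a i) with hd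
    have hsum : HasSum d (deriv (jacksonSum N ℓ a) (a i)) :=
      hasSum_deriv_jacksonTerm hℓ hN ha hρ hai
    have hnat : ∀ k : ℕ, d k = δ * P * (ratio N ℓ a ^ k * qPart N ℓ a (a i * base ℓ ^ k)) := by
      intro k
      have h1 : DifferentiableAt ℂ (fun x => qPart N ℓ a (x * base ℓ ^ k)) (a i) :=
        DifferentiableAt.comp (a i) (g := qPart N ℓ a) (f := fun x => x * base ℓ ^ k)
          (differentiableAt_qPart hℓ (hne k)) (by fun_prop)
      have hc : ∀ j, Continuous fun x => qPoch (a j * (x * base ℓ ^ k)) (base ℓ) := fun j =>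
        (continuous_qPoch hq).comp (by fun_prop)
      have h2 : ∀ᶠ x in 𝓝 (a i), jacksonTerm N ℓ a k x
          = ratio N ℓ a ^ k * qPart N ℓ a (x * base ℓ ^ k)
            * ∏ j ∈ Finset.Icc 1 (2 * N), theta (a j * x) (base ℓ) := by
        have h3 : ∀ᶠ x in 𝓝 (a i), ∀ j ∈ Finset.Icc 1 (2 * N),
            qPoch (a j * (x * base ℓ ^ k)) (base ℓ) ≠ 0 :=
          (Finset.eventually_all _).mpr fun j hj =>
            (hc j).continuousAt.eventually_ne (hne k j hj)
        filter_upwards [h3, eventually_ne_nhds hai] with x hx hx0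
        have := jacksonTerm_eq hℓ hN ha k hx0 (by simpa only [zpow_natCast] using hx)
        simpa only [zpow_natCast] using this
      have h4 := ((h1.hasDerivAt.const_mul (ratio N ℓ a ^ k)).mul
        (hasDerivAt_prod_theta hℓ ha hi h0)).congr_of_eventuallyEq h2
      have h5 : ∏ j ∈ Finset.Icc 1 (2 * N), theta (a j * a i) (base ℓ) = 0 :=
        Finset.prod_eq_zero hi (by rw [← sq]; exact h0)
      rw [hd]
      dsimp only
      rw [h4.deriv, h5]
      ring
    have hzero : ∀ ν : ℤ, jacksonTerm N ℓ a ν (a i) = 0 := by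
      intro ν
      rcases lt_or_ge ν 0 with hν | hν
      · exact jacksonTerm_eq_zero_of_neg hi hai hℓ hν
      · obtain ⟨k, rfl⟩ := Int.eq_ofNat_of_zero_le hν
        rw [jacksonTerm_eq hℓ hN ha k hai (by simpa only [zpow_natCast] using hne k),
          Finset.prod_eq_zero hi, mul_zero]
        rw [← sq]; exact h0
    have hrefl : ∀ ν : ℤ, d (-m - ν) = d ν := by
      intro ν
      have h1 : HasDerivAt (fun x : ℂ => base ℓ ^ m * x⁻¹) (-1) (a i) := by
        refine ((hasDerivAt_inv hai).const_mul (base ℓ ^ m)).congr_deriv ?_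
        rw [← hm, mul_neg, mul_inv_cancel₀ (pow_ne_zero 2 hai)]
      have h2 := (differentiableAt_jacksonTerm (N := N) hℓ ha (-m - ν)
        (x := base ℓ ^ m * (a i)⁻¹)
        (mul_ne_zero (zpow_ne_zero _ hq0) (inv_ne_zero hai))).hasDerivAt.comp (a i) h1
      rw [reflect_eq_self hai hm] at h2
      have h3 : DifferentiableAt ℂ (fun x : ℂ => -(base ℓ ^ (m - N * m ^ 2)
          * x ^ (2 * N * m - 2))) (a i) :=
        (DifferentiableAt.const_mul (differentiableAt_zpow.mpr (Or.inl hai)) _).neg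
      have h4 := h3.hasDerivAt.mul (differentiableAt_jacksonTerm (N := N) hℓ ha ν hai).hasDerivAt
      rw [hzero, mul_zero, zero_add, zpow_reflect_eq_one hm] at h4
      have h5 : jacksonTerm N ℓ a (-m - ν) ∘ (fun x : ℂ => base ℓ ^ m * x⁻¹)
          =ᶠ[𝓝 (a i)] (fun x : ℂ => -(base ℓ ^ (m - N * m ^ 2) * x ^ (2 * N * m - 2)))
            * jacksonTerm N ℓ a ν := by
        filter_upwards [eventually_ne_nhds hai] with x hx
        exact jacksonTerm_reflect m ν hx
      have h6 := h2.unique (h4.congr_of_eventuallyEq h5)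
      have h7 : d (-m - ν) * (-1) = -1 * d ν := h6
      linear_combination -h7
    have hmid : ∀ ν : ℤ, ν < 0 → -m < ν → d ν = 0 := by
      intro ν h1 h2
      have hp := differentiable_qPoch hq
      set A : ℂ → ℂ := fun x => qPoch (base ℓ ^ (1 + ν) * x * (a i)⁻¹) (base ℓ) with hA
      set B : ℂ → ℂ := fun x => qPoch (base ℓ ^ (1 - ν) * (a i * x)⁻¹) (base ℓ) with hB
      have hA0 : A (a i) = 0 := by
        rw [hA]
        dsimp only
        rw [mul_assoc, mul_inv_cancel₀ hai, mul_one, qPoch_eq_zero_iff hq]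
        refine ⟨(-1 - ν).toNat, ?_⟩
        rw [← zpow_natCast, ← zpow_add₀ hq0, Int.toNat_of_nonneg (by omega)]
        convert zpow_zero (base ℓ) using 2
        ring
      have hB0 : B (a i) = 0 := by
        rw [hB]
        dsimp only
        rw [← sq, hm, ← zpow_neg, ← zpow_add₀ hq0, qPoch_eq_zero_iff hq]
        refine ⟨(m + ν - 1).toNat, ?_⟩
        rw [← zpow_natCast, ← zpow_add₀ hq0, Int.toNat_of_nonneg (by omega)]
        convert zpow_zero (base ℓ) using 2
        ring
      have hinvd : ∀ j, a j ≠ 0 →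
          DifferentiableAt ℂ (fun x : ℂ => base ℓ ^ (1 - ν) * (a j * x)⁻¹) (a i) := fun j hj =>
        (((hasDerivAt_id (a i)).const_mul (a j)).differentiableAt.inv
          (mul_ne_zero hj hai)).const_mul _
      have hAd : DifferentiableAt ℂ A (a i) := (hp _).comp (a i) (by fun_prop)
      have hBd : DifferentiableAt ℂ B (a i) :=
        (hp _).comp (a i) (hinvd i hai)
      set E : ℂ → ℂ := fun x => base ℓ ^ (N * ν ^ 2 - ν) * x ^ (2 * N * ν)
        * (1 - x ^ 2 * base ℓ ^ (2 * ν))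
        * ∏ j ∈ (Finset.Icc 1 (2 * N)).erase i,
          (qPoch (base ℓ ^ (1 + ν) * x * (a j)⁻¹) (base ℓ)
            * qPoch (base ℓ ^ (1 - ν) * (a j * x)⁻¹) (base ℓ)) with hE
      have hEd : DifferentiableAt ℂ E (a i) := by
        have e1 : DifferentiableAt ℂ (fun x : ℂ => x ^ (2 * N * ν)) (a i) :=
          differentiableAt_zpow.mpr (Or.inl hai)
        refine ((e1.const_mul _).mul (by fun_prop)).mul (DifferentiableAt.fun_finsetProd
          fun j hj => ?_)
        exact ((hp _).comp (a i) (by fun_prop)).mul ((hp _).comp (a i)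
          (hinvd j (ha j (Finset.mem_of_mem_erase hj))))
      have hfac : jacksonTerm N ℓ a ν = fun x => A x * (B x * E x) := by
        funext x
        rw [jacksonTerm, ← Finset.mul_prod_erase _ _ hi]
        ring
      have h3 := hAd.hasDerivAt.mul (hBd.hasDerivAt.mul hEd.hasDerivAt)
      have h4 : HasDerivAt (jacksonTerm N ℓ a ν) 0 (a i) := by
        rw [hfac]
        refine h3.congr_deriv ?_
        rw [Pi.mul_apply, hA0, hB0]
        ring
      exact h4.deriv
    set S := ∑' k : ℕ, ratio N ℓ a ^ k * qPart N ℓ a (a i * base ℓ ^ k) with hS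
    have hD1 : HasSum (Set.indicator (Set.range fun k : ℕ => (k : ℤ)) d) (δ * P * S) := by
      rw [← hinj.hasSum_iff fun ν hν => Set.indicator_of_notMem hν d]
      have h0 : Set.indicator (Set.range fun k : ℕ => (k : ℤ)) d ∘ (fun k : ℕ => (k : ℤ))
          = fun k : ℕ => d k := funext fun k => Set.indicator_of_mem (Set.mem_range_self k) d
      rw [h0]
      have h1 : Summable fun k : ℕ => d k := hsum.summable.comp_injective hinj
      simp only [hnat] at h1 ⊢
      have h2 := h1.hasSum
      rwa [tsum_mul_left] at h2
    have hD2 := (Equiv.subLeft (-m)).hasSum_iff.mpr hD1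
    have hD := hD1.add hD2
    have hdec : (fun ν => Set.indicator (Set.range fun k : ℕ => (k : ℤ)) d ν
        + (Set.indicator (Set.range fun k : ℕ => (k : ℤ)) d ∘ (Equiv.subLeft (-m))) ν) = d := by
      funext ν
      rw [Function.comp_apply, Equiv.subLeft_apply]
      rcases lt_or_ge ν 0 with hν | hν
      · have h1 : ν ∉ Set.range fun k : ℕ => (k : ℤ) := by rintro ⟨k, rfl⟩; simp at hν; omega
        rw [Set.indicator_of_notMem h1, zero_add]
        rcases lt_or_ge (-m) ν with h2 | h2
        · rw [Set.indicator_of_notMem, hmid ν hν h2]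
          rintro ⟨k, hk⟩; simp at hk; omega
        · rw [Set.indicator_of_mem, hrefl]
          exact ⟨(-m - ν).toNat, Int.toNat_of_nonneg (by omega)⟩
      · have h1 : ν ∈ Set.range fun k : ℕ => (k : ℤ) := ⟨ν.toNat, Int.toNat_of_nonneg hν⟩
        rw [Set.indicator_of_mem h1, Set.indicator_of_notMem, add_zero]
        rintro ⟨k, hk⟩; simp at hk; omega
    rw [hdec] at hD
    have h1 := hsum.unique hD
    have h2 : regularised N ℓ a (a i) = deriv (jacksonSum N ℓ a) (a i)
        / deriv (fun x : ℂ => theta (x ^ 2) (base ℓ)) (a i) := quot_of_eq h0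
    rw [h2, h1, deriv_theta_sq hℓ hai, mul_assoc 2, ← hδ]
    field_simp
    ring
  · have h1 : regularised N ℓ a (a i) = jacksonSum N ℓ a (a i) / theta (a i ^ 2) (base ℓ) :=
      quot_of_ne h0
    have h2 : jacksonSum N ℓ a (a i) = ∑' k : ℕ, jacksonTerm N ℓ a k (a i) := by
      rw [jacksonSum, ← hinj.tsum_eq]
      intro ν hν
      by_contra h
      exact hν (jacksonTerm_eq_zero_of_neg hi hai hℓ (hneg ν h))
    have h3 : ∀ k : ℕ, jacksonTerm N ℓ a k (a i) = theta (a i ^ 2) (base ℓ) * P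
        * (ratio N ℓ a ^ k * qPart N ℓ a (a i * base ℓ ^ k)) := by
      intro k
      rw [jacksonTerm_eq hℓ hN ha k hai (by simpa only [zpow_natCast] using hne k),
        ← Finset.mul_prod_erase _ _ hi, ← sq]
      simp only [zpow_natCast]
      ring
    rw [h1, h2]
    simp only [h3, tsum_mul_left]
    field_simp

end Value


section Contour

/-- The point `-t ℓ + i v` of the logarithmic plane. -/
noncomputable def contourPoint (ℓ : ℂ) (t v : ℝ) : ℂ := -(t * ℓ) + v * I

variable {ℓ : ℂ}

lemma hasFDerivAt_comp_contourPoint {G : ℂ → ℂ} {p : ℝ × ℝ}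
    (hG : DifferentiableAt ℂ G (contourPoint ℓ p.1 p.2)) (c : ℂ) :
    HasFDerivAt (fun p : ℝ × ℝ => c * G (contourPoint ℓ p.1 p.2))
      ((ContinuousLinearMap.fst ℝ ℝ ℝ).smulRight
          (-(c * (deriv G (contourPoint ℓ p.1 p.2) * ℓ)))
        + (ContinuousLinearMap.snd ℝ ℝ ℝ).smulRight
          (c * (deriv G (contourPoint ℓ p.1 p.2) * I))) p := by
  have h1 : HasFDerivAt (fun p : ℝ × ℝ => contourPoint ℓ p.1 p.2)
      ((ContinuousLinearMap.fst ℝ ℝ ℝ).smulRight (-ℓ)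
        + (ContinuousLinearMap.snd ℝ ℝ ℝ).smulRight I) p := by
    have e1 : HasFDerivAt (fun p : ℝ × ℝ => ((ContinuousLinearMap.fst ℝ ℝ ℝ).smulRight (-ℓ)
        + (ContinuousLinearMap.snd ℝ ℝ ℝ).smulRight I) p) _ p := ContinuousLinearMap.hasFDerivAt _
    refine e1.congr_of_eventuallyEq (Eventually.of_forall fun x => ?_)
    simp [contourPoint]
  have h2 := (hG.hasDerivAt.hasFDerivAt.restrictScalars ℝ).comp p h1
  have h3 := h2.const_smul c
  refine h3.congr_fderiv ?_
  ext <;> simp <;> left <;> ring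

theorem integral_parallelogram {G : ℂ → ℂ} {T : ℝ} (hT : 0 ≤ T)
    (hG : ∀ t ∈ Set.Icc 0 T, ∀ v ∈ Set.Icc (-Real.pi) Real.pi,
      DifferentiableAt ℂ G (contourPoint ℓ t v)) :
    (∫ v in (-Real.pi)..Real.pi, I * G (contourPoint ℓ 0 v))
        - (∫ v in (-Real.pi)..Real.pi, I * G (contourPoint ℓ T v))
        + ((∫ t in (0 : ℝ)..T, -ℓ * G (contourPoint ℓ t Real.pi))
          - ∫ t in (0 : ℝ)..T, -ℓ * G (contourPoint ℓ t (-Real.pi))) = 0 := by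
  have hπ : -Real.pi ≤ Real.pi := by linarith [Real.pi_pos]
  have hd : ∀ c : ℂ, ∀ p ∈ Set.uIcc 0 T ×ˢ Set.uIcc (-Real.pi) Real.pi, HasFDerivAt
      (fun p : ℝ × ℝ => c * G (contourPoint ℓ p.1 p.2))
      ((ContinuousLinearMap.fst ℝ ℝ ℝ).smulRight
          (-(c * (deriv G (contourPoint ℓ p.1 p.2) * ℓ)))
        + (ContinuousLinearMap.snd ℝ ℝ ℝ).smulRight
          (c * (deriv G (contourPoint ℓ p.1 p.2) * I))) p := by
    intro c p hp
    rw [Set.uIcc_of_le hT, Set.uIcc_of_le hπ] at hp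
    exact hasFDerivAt_comp_contourPoint (hG _ hp.1 _ hp.2) c
  have hsub : ∀ p ∈ Set.Ioo (min 0 T) (max 0 T) ×ˢ Set.Ioo (min (-Real.pi) Real.pi)
      (max (-Real.pi) Real.pi) \ (∅ : Set (ℝ × ℝ)),
      p ∈ Set.uIcc 0 T ×ˢ Set.uIcc (-Real.pi) Real.pi := fun p hp =>
    ⟨Set.Ioo_subset_Icc_self hp.1.1, Set.Ioo_subset_Icc_self hp.1.2⟩
  have h := MeasureTheory.integral2_divergence_prod_of_hasFDerivAt_off_countable
    (fun p : ℝ × ℝ => I * G (contourPoint ℓ p.1 p.2))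
    (fun p : ℝ × ℝ => ℓ * G (contourPoint ℓ p.1 p.2)) _ _ 0 (-Real.pi) T Real.pi ∅
    Set.countable_empty
    (fun p hp => (hd I p hp).continuousAt.continuousWithinAt)
    (fun p hp => (hd ℓ p hp).continuousAt.continuousWithinAt)
    (fun p hp => hd I p (hsub p hp)) (fun p hp => hd ℓ p (hsub p hp)) (by
      refine MeasureTheory.integrableOn_zero.congr_fun (fun p _ => ?_)
        (measurableSet_uIcc.prod measurableSet_uIcc)
      simp
      ring)
  have hz : ∀ p : ℝ × ℝ, ((ContinuousLinearMap.fst ℝ ℝ ℝ).smulRight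
          (-(I * (deriv G (contourPoint ℓ p.1 p.2) * ℓ)))
        + (ContinuousLinearMap.snd ℝ ℝ ℝ).smulRight
          (I * (deriv G (contourPoint ℓ p.1 p.2) * I))) (1, 0)
      + ((ContinuousLinearMap.fst ℝ ℝ ℝ).smulRight
          (-(ℓ * (deriv G (contourPoint ℓ p.1 p.2) * ℓ)))
        + (ContinuousLinearMap.snd ℝ ℝ ℝ).smulRight
          (ℓ * (deriv G (contourPoint ℓ p.1 p.2) * I))) (0, 1) = 0 := by
    intro p
    simp
    ring
  have hz' := fun x y : ℝ => hz (x, y)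
  simp only [hz', intervalIntegral.integral_zero] at h
  simp only [neg_mul, intervalIntegral.integral_neg]
  linear_combination h

lemma integral_circle_of_diffContOnCl {f : ℂ → ℂ} (hf : DiffContOnCl ℂ f (Metric.ball 0 1)) :
    ∫ v in (-Real.pi)..Real.pi, f (exp (v * I)) = 2 * Real.pi * f 0 := by
  have h := hf.circleIntegral_sub_inv_smul (w := 0) (by simp)
  have h1 : ∫ v in (-Real.pi)..Real.pi, f (exp (v * I))
      = ∫ v in (0 : ℝ)..2 * Real.pi, f (exp (v * I)) := by
    have hp : Function.Periodic (fun v : ℝ => f (exp (v * I))) (2 * Real.pi) := by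
      intro v
      beta_reduce
      congr 1
      push_cast
      rw [add_mul, exp_periodic]
    have := hp.intervalIntegral_add_eq (-Real.pi) 0
    rwa [zero_add, show -Real.pi + 2 * Real.pi = Real.pi by ring] at this
  have h2 : (∮ z in C(0, 1), (z - 0)⁻¹ • f z) = I * ∫ v in (0 : ℝ)..2 * Real.pi, f (exp (v * I)) := by
    rw [circleIntegral, ← intervalIntegral.integral_const_mul]
    refine intervalIntegral.integral_congr fun v _ => ?_
    simp only [deriv_circleMap, circleMap, ofReal_one, one_mul, zero_add, sub_zero, smul_eq_mul]
    have := exp_ne_zero (v * I)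
    field_simp
  rw [h2, smul_eq_mul] at h
  rw [h1]
  have hI := I_ne_zero
  refine mul_left_cancel₀ hI ?_
  rw [h]; ring

lemma integral_inv_one_sub_of_norm_lt {b : ℂ} (hb : ‖b‖ < 1) :
    ∫ v in (-Real.pi)..Real.pi, (1 - b * exp (v * I))⁻¹ = 2 * Real.pi := by
  have h := integral_circle_of_diffContOnCl (f := fun z => (1 - b * z)⁻¹) ?_
  · simpa using h
  · refine DifferentiableOn.diffContOnCl fun z hz => ?_
    rw [closure_ball _ one_ne_zero, Metric.mem_closedBall, dist_zero_right] at hz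
    refine DifferentiableAt.differentiableWithinAt (DifferentiableAt.inv (by fun_prop) ?_)
    intro h0
    have : ‖b * z‖ < 1 := by
      rw [norm_mul]; exact (mul_le_of_le_one_right (norm_nonneg _) hz).trans_lt hb
    rw [← sub_eq_zero.mp h0, norm_one] at this
    exact lt_irrefl _ this

lemma integral_inv_one_sub_of_lt_norm {b : ℂ} (hb : 1 < ‖b‖) :
    ∫ v in (-Real.pi)..Real.pi, (1 - b * exp (v * I))⁻¹ = 0 := by
  have h := integral_circle_of_diffContOnCl (f := fun z => z / (z - b)) ?_
  · rw [zero_div, mul_zero, ← neg_neg Real.pi, ← intervalIntegral.integral_comp_neg, neg_neg] at h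
    rw [← h]
    refine intervalIntegral.integral_congr fun v _ => ?_
    have := exp_ne_zero (v * I)
    simp only [ofReal_neg, neg_mul, exp_neg]
    rw [← one_div, ← mul_div_mul_left (1 : ℂ) _ (inv_ne_zero this), mul_one, mul_sub, mul_one,
      mul_left_comm, inv_mul_cancel₀ this, mul_one]
  · refine DifferentiableOn.diffContOnCl fun z hz => ?_
    rw [closure_ball _ one_ne_zero, Metric.mem_closedBall, dist_zero_right] at hz
    refine DifferentiableAt.differentiableWithinAt (DifferentiableAt.div (by fun_prop)
      (by fun_prop) ?_)
    intro h0
    rw [sub_eq_zero.mp h0] at hz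
    exact absurd hb (not_lt.mpr hz)

theorem exists_sub_poles {Ω : Set ℂ} (hΩ : IsOpen Ω) {E D : ℂ → ℂ} (hE : DifferentiableOn ℂ E Ω)
    (hD : DifferentiableOn ℂ D Ω) {ι : Type*} (S : Finset ι) (b c : ι → ℂ)
    (hb : Set.InjOn b S)
    (h1 : ∀ s ∈ S, ∀ w ∈ Ω, b s * exp w = 1 → D w = 0 ∧ E w = -(c s * deriv D w))
    (h2 : ∀ w ∈ Ω, D w = 0 → (∀ s ∈ S, b s * exp w ≠ 1) → E w = 0)
    (h3 : ∀ w ∈ Ω, D w = 0 → deriv D w ≠ 0) :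
    ∃ G : ℂ → ℂ, DifferentiableOn ℂ G Ω ∧ ∀ w ∈ Ω, D w ≠ 0 →
      G w = E w / D w - ∑ s ∈ S, c s * (1 - b s * exp w)⁻¹ := by
  set d : ι → ℂ → ℂ := fun s w => 1 - b s * exp w with hd
  have hdd : ∀ s, Differentiable ℂ (d s) := fun s => by
    simp only [hd]; fun_prop
  have hd0 : ∀ s w, d s w = 0 ↔ b s * exp w = 1 := fun s w => by
    simp only [hd]; rw [sub_eq_zero, eq_comm]
  have hder : ∀ s w, d s w = 0 → deriv (d s) w = -1 := by
    intro s w h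
    have : HasDerivAt (d s) (-(b s * exp w)) w :=
      ((hasDerivAt_exp w).const_mul (b s)).const_sub 1
    rw [this.deriv, (hd0 s w).mp h]
  have hDd : ∀ s ∈ S, ∀ w ∈ Ω, d s w = 0 → D w = 0 := fun s hs w hw h =>
    (h1 s hs w hw ((hd0 s w).mp h)).1
  have hR : ∀ s ∈ S, DifferentiableOn ℂ (quot D (d s)) Ω := fun s hs =>
    differentiableOn_quot hΩ hD (hdd s).differentiableOn (hDd s hs) fun w _ h => by
      rw [hder s w h]; exact neg_ne_zero.mpr one_ne_zero
  set num : ℂ → ℂ := fun w => E w - ∑ s ∈ S, c s * quot D (d s) w with hnum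
  have hnumd : DifferentiableOn ℂ num Ω :=
    hE.sub (DifferentiableOn.fun_sum fun s hs => (hR s hs).const_mul _)
  have hnum0 : ∀ w ∈ Ω, D w = 0 → num w = 0 := by
    intro w hw hw0
    have hq0 : ∀ s, d s w ≠ 0 → quot D (d s) w = 0 := fun s h => by
      rw [quot_of_ne h, hw0, zero_div]
    by_cases h : ∃ s ∈ S, d s w = 0
    · obtain ⟨s, hs, hsw⟩ := h
      have hsw' := (hd0 s w).mp hsw
      simp only [hnum]
      rw [Finset.sum_eq_single_of_mem s hs, quot_of_eq hsw, hder s w hsw,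
        (h1 s hs w hw hsw').2]
      · ring
      · intro t ht hts
        rw [hq0 t, mul_zero]
        intro htw
        refine hts (hb ht hs (mul_right_cancel₀ (exp_ne_zero w) ?_))
        rw [(hd0 t w).mp htw, hsw']
    · push Not at h
      simp only [hnum]
      rw [h2 w hw hw0 fun s hs h' => h s hs ((hd0 s w).mpr h'), Finset.sum_eq_zero, sub_zero]
      intro s hs
      rw [hq0 s (h s hs), mul_zero]
  refine ⟨quot num D, differentiableOn_quot hΩ hnumd hD hnum0 h3, fun w hw hw0 => ?_⟩
  rw [quot_of_ne hw0]
  simp only [hnum]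
  rw [sub_div, Finset.sum_div]
  congr 1
  refine Finset.sum_congr rfl fun s hs => ?_
  have hsw : d s w ≠ 0 := fun h => hw0 (hDd s hs w hw h)
  rw [quot_of_ne hsw]
  change c s * (D w / d s w) / D w = c s * (d s w)⁻¹
  field_simp

end Contour


/-- The hypotheses on the parameters of the integral. -/
structure IsAdmissible (N : ℕ) (ℓ : ℂ) (a : ℕ → ℂ) : Prop where
  two_le : 2 ≤ N
  re_neg : ℓ.re < 0
  norm_lt : ∀ j ∈ Finset.Icc 1 (2 * N), ‖a j‖ < 1
  mem : ∀ j ∈ Finset.Icc 1 (2 * N), a j ∈ varDomain N ℓ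
  ratio_lt : ‖ratio N ℓ a‖ < 1
  theta_mul : ∀ i ∈ Finset.Icc 1 (2 * N), ∀ j ∈ Finset.Icc 1 (2 * N), i ≠ j →
    theta (a i * a j) (base ℓ) ≠ 0
  theta_div : ∀ i ∈ Finset.Icc 1 (N - 1), ∀ j ∈ Finset.Icc 1 (N - 1), i ≠ j →
    theta (a i / a j) (base ℓ) ≠ 0

section Poles

variable {N : ℕ} {ℓ : ℂ} {a : ℕ → ℂ} {i : ℕ}

namespace IsAdmissible

variable (h : IsAdmissible N ℓ a)
include h

lemma ne_zero : ∀ j ∈ Finset.Icc 1 (2 * N), a j ≠ 0 := fun j hj => (h.mem j hj).1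

end IsAdmissible

lemma mem_Icc_of_mem_left (hi : i ∈ Finset.Icc 1 (N - 1)) : i ∈ Finset.Icc 1 (2 * N) := by
  rw [Finset.mem_Icc] at hi ⊢; omega

lemma mem_Icc_of_fin (hN : 2 ≤ N) (k : Fin (N + 1)) : N + (k : ℕ) ∈ Finset.Icc 1 (2 * N) := by
  rw [Finset.mem_Icc]; omega

lemma prod_fin_eq_prod_Icc (F : ℕ → ℂ) :
    ∏ k : Fin (N + 1), F (N + k) = ∏ j ∈ Finset.Icc N (2 * N), F j := by
  rw [Fin.prod_univ_eq_prod_range fun k => F (N + k), Finset.range_eq_Ico,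
    Finset.prod_Ico_add F 0 (N + 1) N, ← Finset.Ico_add_one_right_eq_Icc]
  congr 2 <;> omega

lemma prod_Icc_mul_prod_Icc (hN : 2 ≤ N) (F : ℕ → ℂ) :
    (∏ j ∈ Finset.Icc 1 (N - 1), F j) * ∏ j ∈ Finset.Icc N (2 * N), F j
      = ∏ j ∈ Finset.Icc 1 (2 * N), F j := by
  rw [← Finset.Ico_add_one_right_eq_Icc, ← Finset.Ico_add_one_right_eq_Icc,
    ← Finset.Ico_add_one_right_eq_Icc, Nat.sub_add_cancel (by omega)]
  exact Finset.prod_Ico_consecutive F (by omega) (by omega)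

/-- The logarithms of the parameters `a_N, …, a_{2N}`. -/
noncomputable def logTail (N : ℕ) (ℓ : ℂ) (a : ℕ → ℂ) (k : Fin (N + 1)) : ℂ := qLog ℓ (a (N + k))

/-- The coefficient function in the variable `1/z`. -/
noncomputable def coeffAt (N : ℕ) (ℓ : ℂ) (a : ℕ → ℂ) (H : (Fin (N + 2) → ℂ) → ℂ) (w : ℂ) : ℂ :=
  H (Fin.cons (-w) (logTail N ℓ a))

/-- The region around the contour on which everything is holomorphic. -/
def strip (N : ℕ) (ℓ : ℂ) (a : ℕ → ℂ) : Set ℂ :=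
  {w | Odd N → ∀ j ∈ Finset.Icc 1 (2 * N), |height ℓ w + height ℓ (qLog ℓ (a j))| < 2 * Real.pi}

/-- The theta product which carries the poles. -/
noncomputable def poleProd (N : ℕ) (ℓ : ℂ) (a : ℕ → ℂ) (w : ℂ) : ℂ :=
  ∏ i ∈ Finset.Icc 1 (N - 1), theta (a i * exp w) (base ℓ)

/-- The quasi-period factor of `poleProd`. -/
noncomputable def poleFactor (N : ℕ) (ℓ : ℂ) (a : ℕ → ℂ) (w : ℂ) : ℂ :=
  (-1) ^ (N - 1) * exp w ^ (N - 1) * (∏ i ∈ Finset.Icc 1 (N - 1), a i) / base ℓ ^ (N - 1)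

lemma isOpen_strip : IsOpen (strip N ℓ a) := by
  have hc := continuous_height ℓ
  refine isOpen_imp ?_
  simp only [Set.ofPred_forall]
  exact isOpen_biInter_finset fun j _ => isOpen_lt (by fun_prop) continuous_const

variable {H : (Fin (N + 2) → ℂ) → ℂ}

lemma exp_logTail (h : IsAdmissible N ℓ a) (k : Fin (N + 1)) :
    exp (logTail N ℓ a k) = a (N + k) :=
  exp_qLog h.re_neg (h.ne_zero _ (mem_Icc_of_fin h.two_le k))

lemma abs_height_qLog_lt (h : IsAdmissible N ℓ a) (hN : Odd N) {j : ℕ}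
    (hj : j ∈ Finset.Icc 1 (2 * N)) : |height ℓ (qLog ℓ (a j))| < Real.pi :=
  height_qLog_lt h.re_neg hN (h.mem j hj)

lemma mem_strip_of_abs_height_le (h : IsAdmissible N ℓ a) {w : ℂ}
    (hw : |height ℓ w| ≤ Real.pi) : w ∈ strip N ℓ a := by
  intro hN j hj
  have h1 := abs_height_qLog_lt h hN hj
  have h2 := abs_add_le (height ℓ w) (height ℓ (qLog ℓ (a j)))
  linarith

lemma mem_strip_sub (hℓ : ℓ.re < 0) {w : ℂ} (hw : w ∈ strip N ℓ a) :
    w - ℓ ∈ strip N ℓ a := by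
  intro hN j hj
  rw [height_sub, height_base hℓ, sub_zero]
  exact hw hN j hj

lemma cons_mem_logDomain (h : IsAdmissible N ℓ a) {w : ℂ} (hw : w ∈ strip N ℓ a) :
    (Fin.cons (-w) (logTail N ℓ a) : Fin (N + 2) → ℂ) ∈ logDomain N ℓ := by
  intro hN i j
  have hk : ∀ k, |height ℓ (logTail N ℓ a k)| < Real.pi := fun k =>
    abs_height_qLog_lt h hN (mem_Icc_of_fin h.two_le k)
  have hwk : ∀ k, |height ℓ w + height ℓ (logTail N ℓ a k)| < 2 * Real.pi := fun k =>
    hw hN _ (mem_Icc_of_fin h.two_le k)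
  refine Fin.cases ?_ (fun k => ?_) i <;> refine Fin.cases ?_ (fun l => ?_) j
  · simp [Real.pi_pos]
  · rw [Fin.cons_zero, Fin.cons_succ, height_neg, ← neg_add', abs_neg]
    exact hwk l
  · rw [Fin.cons_zero, Fin.cons_succ, height_neg, sub_neg_eq_add, add_comm]
    exact hwk k
  · rw [Fin.cons_succ, Fin.cons_succ]
    have h1 := abs_lt.mp (hk k)
    have h2 := abs_lt.mp (hk l)
    rw [abs_lt]; constructor <;> linarith

lemma differentiableOn_coeffAt (h : IsAdmissible N ℓ a) (hH : IsLogCoefficient N ℓ H) :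
    DifferentiableOn ℂ (coeffAt N ℓ a H) (strip N ℓ a) := by
  refine (hH.1.differentiableOn one_ne_zero).comp (Differentiable.differentiableOn ?_)
    fun w hw => cons_mem_logDomain h hw
  refine differentiable_pi.mpr fun i => Fin.cases ?_ (fun k => ?_) i
  · simpa using differentiable_neg
  · simp

lemma coeffAt_sub (h : IsAdmissible N ℓ a) (hH : IsLogCoefficient N ℓ H) {w : ℂ}
    (hw : w ∈ strip N ℓ a) :
    coeffAt N ℓ a H (w - ℓ) = ratio N ℓ a * poleFactor N ℓ a w * coeffAt N ℓ a H w := by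
  have hq0 := base_ne_zero ℓ
  have h1 := hH.add_base h.two_le h.re_neg (cons_mem_logDomain h hw) 0
  rw [Fin.update_cons_zero, Fin.cons_zero, Fin.prod_univ_succ, Fin.cons_zero] at h1
  simp only [Fin.cons_succ, exp_logTail h] at h1
  rw [prod_fin_eq_prod_Icc a, exp_neg] at h1
  rw [coeffAt, coeffAt, neg_sub, sub_eq_neg_add, h1, ratio, poleFactor,
    ← prod_Icc_mul_prod_Icc h.two_le]
  have h2 : ∏ j ∈ Finset.Icc 1 (N - 1), a j ≠ 0 :=
    Finset.prod_ne_zero_iff.mpr fun j hj => h.ne_zero j (mem_Icc_of_mem_left hj)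
  have h3 : ∏ j ∈ Finset.Icc N (2 * N), a j ≠ 0 :=
    Finset.prod_ne_zero_iff.mpr fun j hj => h.ne_zero j (by
      have := h.two_le; rw [Finset.mem_Icc] at hj ⊢; omega)
  have h4 := exp_ne_zero w
  obtain ⟨n, rfl⟩ : ∃ n, N = n + 2 := ⟨N - 2, by have := h.two_le; omega⟩
  rw [show n + 2 - 1 = n + 1 by omega, show n + 2 - 2 = n by omega] at *
  have h5 : base ℓ ^ (n + 1) ≠ 0 := pow_ne_zero _ hq0
  generalize ∏ j ∈ Finset.Icc 1 (n + 1), a j = A at *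
  generalize ∏ j ∈ Finset.Icc (n + 2) (2 * (n + 2)), a j = B at *
  rw [inv_pow]
  field_simp
  ring

lemma poleProd_sub (h : IsAdmissible N ℓ a) (w : ℂ) :
    poleProd N ℓ a (w - ℓ) = poleFactor N ℓ a w * poleProd N ℓ a w := by
  have hq := norm_base_lt_one h.re_neg
  have hq0 := base_ne_zero ℓ
  have h1 : poleFactor N ℓ a w = ∏ i ∈ Finset.Icc 1 (N - 1), (-(a i * exp w / base ℓ)) := by
    rw [poleFactor]
    simp only [← neg_one_mul (_ / _), Finset.prod_mul_distrib, Finset.prod_div_distrib,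
      Finset.prod_const, Nat.card_Icc, Nat.add_sub_cancel]
    ring
  rw [h1, poleProd, poleProd, ← Finset.prod_mul_distrib]
  refine Finset.prod_congr rfl fun i hi => ?_
  have h0 := h.ne_zero i (mem_Icc_of_mem_left hi)
  have h2 : a i * exp (w - ℓ) ≠ 0 := mul_ne_zero h0 (exp_ne_zero _)
  have h3 : a i * exp w = base ℓ * (a i * exp (w - ℓ)) := by
    rw [exp_sub, base]; field_simp
  rw [h3, theta_mul_base hq hq0 h2]
  field_simp

lemma differentiable_poleProd (h : IsAdmissible N ℓ a) : Differentiable ℂ (poleProd N ℓ a) := by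
  intro w
  refine DifferentiableAt.fun_finsetProd fun j hj => ?_
  exact DifferentiableAt.comp w (f := fun w => a j * exp w) (g := fun z => theta z (base ℓ))
    (differentiableAt_theta (norm_base_lt_one h.re_neg)
      (mul_ne_zero (h.ne_zero j (mem_Icc_of_mem_left hj)) (exp_ne_zero w))) (by fun_prop)

lemma deriv_poleProd (h : IsAdmissible N ℓ a) (hi : i ∈ Finset.Icc 1 (N - 1)) {w : ℂ}
    (h0 : theta (a i * exp w) (base ℓ) = 0) :
    deriv (poleProd N ℓ a) w = a i * exp w * deriv (fun z => theta z (base ℓ)) (a i * exp w)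
      * ∏ j ∈ (Finset.Icc 1 (N - 1)).erase i, theta (a j * exp w) (base ℓ) := by
  have hd : ∀ j ∈ Finset.Icc 1 (N - 1), HasDerivAt (fun w => theta (a j * exp w) (base ℓ))
      (deriv (fun z => theta z (base ℓ)) (a j * exp w) * (a j * exp w)) w := fun j hj =>
    HasDerivAt.comp w (h := fun w => a j * exp w) (h₂ := fun z => theta z (base ℓ))
      (differentiableAt_theta (norm_base_lt_one h.re_neg)
        (mul_ne_zero (h.ne_zero j (mem_Icc_of_mem_left hj)) (exp_ne_zero w))).hasDerivAt
      ((hasDerivAt_exp w).const_mul (a j))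
  have h1 : DifferentiableAt ℂ
      (fun w => ∏ j ∈ (Finset.Icc 1 (N - 1)).erase i, theta (a j * exp w) (base ℓ)) w :=
    DifferentiableAt.fun_finsetProd fun j hj => (hd j (Finset.mem_of_mem_erase hj)).differentiableAt
  have h2 := (hd i hi).mul h1.hasDerivAt
  rw [h0, zero_mul, add_zero] at h2
  have h3 : poleProd N ℓ a = (fun w => theta (a i * exp w) (base ℓ))
      * fun w => ∏ j ∈ (Finset.Icc 1 (N - 1)).erase i, theta (a j * exp w) (base ℓ) :=
    funext fun w => (Finset.mul_prod_erase _ _ hi).symm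
  rw [h3, h2.deriv]
  ring

lemma theta_ne_zero_of_theta_eq_zero (h : IsAdmissible N ℓ a) (hi : i ∈ Finset.Icc 1 (N - 1))
    {j : ℕ} (hj : j ∈ Finset.Icc 1 (N - 1)) (hij : j ≠ i) {w : ℂ}
    (h0 : theta (a i * exp w) (base ℓ) = 0) : theta (a j * exp w) (base ℓ) ≠ 0 := by
  have hq := norm_base_lt_one h.re_neg
  have hq0 := base_ne_zero ℓ
  have hai := h.ne_zero i (mem_Icc_of_mem_left hi)
  have haj := h.ne_zero j (mem_Icc_of_mem_left hj)
  have hw := exp_ne_zero w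
  intro h1
  obtain ⟨m, hm⟩ := (theta_eq_zero_iff hq hq0 (mul_ne_zero hai hw)).mp h0
  obtain ⟨n, hn⟩ := (theta_eq_zero_iff hq hq0 (mul_ne_zero haj hw)).mp h1
  refine h.theta_div j hj i hi hij ((theta_eq_zero_iff hq hq0 (div_ne_zero haj hai)).mpr
    ⟨n - m, ?_⟩)
  rw [zpow_sub₀ hq0, ← hm, ← hn]
  field_simp

lemma deriv_poleProd_ne_zero (h : IsAdmissible N ℓ a) {w : ℂ} (h0 : poleProd N ℓ a w = 0) :
    deriv (poleProd N ℓ a) w ≠ 0 := by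
  obtain ⟨i, hi, hi0⟩ := Finset.prod_eq_zero_iff.mp h0
  have hz : a i * exp w ≠ 0 := mul_ne_zero (h.ne_zero i (mem_Icc_of_mem_left hi)) (exp_ne_zero w)
  rw [deriv_poleProd h hi hi0]
  refine mul_ne_zero (mul_ne_zero hz (deriv_theta_ne_zero (norm_base_lt_one h.re_neg)
    (base_ne_zero ℓ) hz hi0)) (Finset.prod_ne_zero_iff.mpr fun j hj => ?_)
  exact theta_ne_zero_of_theta_eq_zero h hi (Finset.mem_of_mem_erase hj)
    (Finset.ne_of_mem_erase hj) hi0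

lemma deriv_poleProd_sub (h : IsAdmissible N ℓ a) {w : ℂ} (h0 : poleProd N ℓ a w = 0) :
    deriv (poleProd N ℓ a) (w - ℓ) = poleFactor N ℓ a w * deriv (poleProd N ℓ a) w := by
  have h1 : (fun w => poleProd N ℓ a (w - ℓ)) = fun w => poleFactor N ℓ a w * poleProd N ℓ a w :=
    funext fun w => poleProd_sub h w
  have h2 : DifferentiableAt ℂ (poleFactor N ℓ a) w := by
    unfold poleFactor; fun_prop
  have h3 := h2.hasDerivAt.mul (differentiable_poleProd h w).hasDerivAt
  rw [h0, mul_zero, zero_add] at h3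
  rw [← deriv_comp_sub_const, h1]
  exact h3.deriv

lemma poleFactor_ne_zero (h : IsAdmissible N ℓ a) (w : ℂ) : poleFactor N ℓ a w ≠ 0 := by
  have h2 : ∏ j ∈ Finset.Icc 1 (N - 1), a j ≠ 0 :=
    Finset.prod_ne_zero_iff.mpr fun j hj => h.ne_zero j (mem_Icc_of_mem_left hj)
  exact div_ne_zero (mul_ne_zero (mul_ne_zero (pow_ne_zero _ (neg_ne_zero.mpr one_ne_zero))
    (pow_ne_zero _ (exp_ne_zero w))) h2) (pow_ne_zero _ (base_ne_zero ℓ))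

/-- The quotient of the coefficient function by the derivative of `poleProd`. -/
noncomputable def poleRatio (N : ℕ) (ℓ : ℂ) (a : ℕ → ℂ) (H : (Fin (N + 2) → ℂ) → ℂ) (w : ℂ) : ℂ :=
  coeffAt N ℓ a H w / deriv (poleProd N ℓ a) w

lemma poleRatio_sub (h : IsAdmissible N ℓ a) (hH : IsLogCoefficient N ℓ H) {w : ℂ}
    (hw : w ∈ strip N ℓ a) (h0 : poleProd N ℓ a w = 0) :
    poleRatio N ℓ a H (w - ℓ) = ratio N ℓ a * poleRatio N ℓ a H w := by
  rw [poleRatio, coeffAt_sub h hH hw, deriv_poleProd_sub h h0, poleRatio]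
  have := poleFactor_ne_zero h w
  have := deriv_poleProd_ne_zero h h0
  field_simp

lemma neg_qLog_sub_mem_strip (h : IsAdmissible N ℓ a) (hi : i ∈ Finset.Icc 1 (2 * N)) (k : ℕ) :
    -qLog ℓ (a i) - k * ℓ ∈ strip N ℓ a := by
  intro hN j hj
  have hk : height ℓ (k * ℓ) = 0 := by simpa using height_real_mul h.re_neg k
  rw [height_sub, height_neg, hk, sub_zero]
  have h1 := abs_lt.mp (abs_height_qLog_lt h hN hi)
  have h2 := abs_lt.mp (abs_height_qLog_lt h hN hj)
  rw [abs_lt]; constructor <;> linarith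

lemma exp_neg_qLog_sub (h : IsAdmissible N ℓ a) (hi : i ∈ Finset.Icc 1 (2 * N)) (k : ℕ) :
    exp (-qLog ℓ (a i) - k * ℓ) = (a i * base ℓ ^ k)⁻¹ := by
  rw [exp_sub, exp_neg, exp_qLog h.re_neg (h.ne_zero i hi), exp_nat_mul, mul_inv]; rfl

lemma theta_pole (h : IsAdmissible N ℓ a) {w : ℂ} {k : ℕ} (hw : a i * base ℓ ^ k * exp w = 1) :
    theta (a i * exp w) (base ℓ) = 0 := by
  have hq0 := base_ne_zero ℓ
  have h0 : a i * exp w ≠ 0 := by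
    intro h0
    rw [mul_right_comm, h0, zero_mul] at hw
    exact zero_ne_one hw
  refine (theta_eq_zero_iff (norm_base_lt_one h.re_neg) hq0 h0).mpr ⟨-k, ?_⟩
  rw [zpow_neg, zpow_natCast]
  exact eq_inv_of_mul_eq_one_left (by rw [mul_right_comm]; exact hw)

lemma poleRatio_neg_qLog_sub (h : IsAdmissible N ℓ a) (hH : IsLogCoefficient N ℓ H)
    (hi : i ∈ Finset.Icc 1 (N - 1)) (k : ℕ) :
    poleRatio N ℓ a H (-qLog ℓ (a i) - k * ℓ)
      = ratio N ℓ a ^ k * poleRatio N ℓ a H (-qLog ℓ (a i)) := by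
  have hi' := mem_Icc_of_mem_left hi
  induction k with
  | zero => simp
  | succ k ih =>
    have h1 : -qLog ℓ (a i) - (k + 1 : ℕ) * ℓ = -qLog ℓ (a i) - k * ℓ - ℓ := by push_cast; ring
    rw [h1, poleRatio_sub h hH (neg_qLog_sub_mem_strip h hi' k), ih, pow_succ']
    · ring
    · refine Finset.prod_eq_zero hi (theta_pole (k := k) h ?_)
      rw [exp_neg_qLog_sub h hi']
      exact mul_inv_cancel₀ (mul_ne_zero (h.ne_zero i hi') (pow_ne_zero _ (base_ne_zero ℓ)))

end Poles


section Residues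

variable {N : ℕ} {ℓ : ℂ} {a : ℕ → ℂ} {i : ℕ} {H f : (Fin (N + 2) → ℂ) → ℂ}

/-- The theta product of the pairs among `a_N, …, a_{2N}`. -/
noncomputable def tailPairs (N : ℕ) (ℓ : ℂ) (a : ℕ → ℂ) : ℂ :=
  thetaPairs (base ℓ) fun k : Fin (N + 1) => a (N + k)

lemma tailPairs_ne_zero (h : IsAdmissible N ℓ a) : tailPairs N ℓ a ≠ 0 := by
  rw [tailPairs, thetaPairs, Finset.prod_ne_zero_iff]
  intro k _
  rw [Finset.prod_ne_zero_iff]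
  intro l hl
  have hkl : k < l := Finset.mem_Ioi.mp hl
  exact h.theta_mul _ (mem_Icc_of_fin h.two_le k) _ (mem_Icc_of_fin h.two_le l)
    (by have := Fin.lt_def.mp hkl; omega)

/-- The numerator of the part of the integrand which has a non-zero integral. -/
noncomputable def numer (N : ℕ) (ℓ : ℂ) (a : ℕ → ℂ) (H : (Fin (N + 2) → ℂ) → ℂ) (w : ℂ) : ℂ :=
  qPart N ℓ a (exp (-w)) * coeffAt N ℓ a H w / tailPairs N ℓ a

/-- The part of the plane outside the circles of radii `|a_j|` and inside that of `|q|^{-M-1}`. -/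
def annulus (N : ℕ) (ℓ : ℂ) (a : ℕ → ℂ) (M : ℕ) : Set ℂ :=
  strip N ℓ a ∩ ({w | ∀ j ∈ Finset.Icc 1 (2 * N), ‖a j * exp (-w)‖ < 1}
    ∩ {w | ‖exp w * base ℓ ^ (M + 1)‖ < 1})

lemma isOpen_annulus (M : ℕ) : IsOpen (annulus N ℓ a M) := by
  refine isOpen_strip.inter (IsOpen.inter ?_ (isOpen_lt (by fun_prop) continuous_const))
  simp only [Set.ofPred_forall]
  exact isOpen_biInter_finset fun j _ => isOpen_lt (by fun_prop) continuous_const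

lemma differentiableAt_qPart_exp_neg (hℓ : ℓ.re < 0) {w : ℂ}
    (hw : ∀ j ∈ Finset.Icc 1 (2 * N), ‖a j * exp (-w)‖ < 1) :
    DifferentiableAt ℂ (fun w => qPart N ℓ a (exp (-w))) w :=
  DifferentiableAt.comp w (f := fun w => exp (-w)) (g := qPart N ℓ a)
    (differentiableAt_qPart hℓ fun j hj =>
      qPoch_ne_zero_of_norm_lt (norm_base_lt_one hℓ) (hw j hj)) (by fun_prop)

lemma differentiableOn_numer (h : IsAdmissible N ℓ a) (hH : IsLogCoefficient N ℓ H) (M : ℕ) :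
    DifferentiableOn ℂ (numer N ℓ a H) (annulus N ℓ a M) := by
  intro w hw
  have h1 := differentiableAt_qPart_exp_neg h.re_neg hw.2.1
  have h2 := (differentiableOn_coeffAt h hH).differentiableAt (isOpen_strip.mem_nhds hw.1)
  exact ((h1.mul h2).div_const _).differentiableWithinAt

/-- The residue at `1 / a_i` of the reciprocal of `poleProd`, with the coefficient function. -/
noncomputable def poleConst (N : ℕ) (ℓ : ℂ) (a : ℕ → ℂ) (H : (Fin (N + 2) → ℂ) → ℂ) (i : ℕ) : ℂ :=
  -(poleRatio N ℓ a H (-qLog ℓ (a i)) / tailPairs N ℓ a)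

/-- The negatives of the residues at the poles `1 / (a_i q^k)`. -/
noncomputable def poleCoeff (N : ℕ) (ℓ : ℂ) (a : ℕ → ℂ) (H : (Fin (N + 2) → ℂ) → ℂ) (s : ℕ × ℕ) :
    ℂ :=
  ratio N ℓ a ^ s.2 * qPart N ℓ a (a s.1 * base ℓ ^ s.2) * poleConst N ℓ a H s.1

lemma poleRatio_congr (h : IsAdmissible N ℓ a)
    (hHf : ∀ u : Fin (N + 2) → ℂ, (Odd N → ∀ i, |height ℓ (u i)| < Real.pi) →
      H u = f fun i => exp (u i))
    (hi : i ∈ Finset.Icc 1 (N - 1)) {w : ℂ} {k : ℕ} (hw : w ∈ strip N ℓ a)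
    (hwk : a i * base ℓ ^ k * exp w = 1) :
    poleRatio N ℓ a H w = poleRatio N ℓ a H (-qLog ℓ (a i) - k * ℓ) := by
  have hi' := mem_Icc_of_mem_left hi
  have he : exp w = exp (-qLog ℓ (a i) - k * ℓ) := by
    rw [exp_neg_qLog_sub h hi']
    exact eq_inv_of_mul_eq_one_right hwk
  rcases N.even_or_odd with hN | hN
  · have hno : ¬ Odd N := Nat.not_odd_iff_even.mpr hN
    have h0 := theta_pole h hwk
    rw [poleRatio, poleRatio, deriv_poleProd h hi h0, deriv_poleProd h hi (by rwa [← he]), ← he,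
      coeffAt, coeffAt, hHf _ fun h => absurd h hno, hHf _ fun h => absurd h hno]
    congr 2
    funext l
    refine Fin.cases ?_ (fun m => ?_) l
    · rw [Fin.cons_zero, Fin.cons_zero, exp_neg, exp_neg, he]
    · rw [Fin.cons_succ, Fin.cons_succ]
  · congr 1
    refine eq_of_exp_eq_of_height (ℓ := ℓ) he ?_
    have hk : height ℓ (k * ℓ) = 0 := by simpa using height_real_mul h.re_neg k
    rw [height_sub, height_neg, hk, sub_zero, sub_neg_eq_add]
    exact hw hN i hi'

lemma numer_eq (h : IsAdmissible N ℓ a) (hH : IsLogCoefficient N ℓ H)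
    (hHf : ∀ u : Fin (N + 2) → ℂ, (Odd N → ∀ i, |height ℓ (u i)| < Real.pi) →
      H u = f fun i => exp (u i))
    (hi : i ∈ Finset.Icc 1 (N - 1)) {w : ℂ} {k : ℕ} (hw : w ∈ strip N ℓ a)
    (hwk : a i * base ℓ ^ k * exp w = 1) :
    numer N ℓ a H w = -(poleCoeff N ℓ a H (i, k) * deriv (poleProd N ℓ a) w) := by
  have h0 : poleProd N ℓ a w = 0 := Finset.prod_eq_zero hi (theta_pole h hwk)
  have h1 : coeffAt N ℓ a H w = ratio N ℓ a ^ k * poleRatio N ℓ a H (-qLog ℓ (a i))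
      * deriv (poleProd N ℓ a) w := by
    rw [← poleRatio_neg_qLog_sub h hH hi, ← poleRatio_congr h hHf hi hw hwk, poleRatio,
      div_mul_cancel₀ _ (deriv_poleProd_ne_zero h h0)]
  have h2 : exp (-w) = a i * base ℓ ^ k := by
    rw [exp_neg]; exact (eq_inv_of_mul_eq_one_left hwk).symm
  rw [numer, h1, h2, poleCoeff, poleConst]
  ring

lemma injOn_poles (h : IsAdmissible N ℓ a) (M : ℕ) :
    Set.InjOn (fun s : ℕ × ℕ => a s.1 * base ℓ ^ s.2)
      (Finset.Icc 1 (N - 1) ×ˢ Finset.range (M + 1) : Finset (ℕ × ℕ)) := by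
  have hq := norm_base_lt_one h.re_neg
  have hq0 := base_ne_zero ℓ
  rintro ⟨i, k⟩ hs ⟨j, l⟩ ht hst
  have hi := (Finset.mem_product.mp hs).1
  have hj := (Finset.mem_product.mp ht).1
  dsimp only at hst hi hj
  have hai := h.ne_zero i (mem_Icc_of_mem_left hi)
  have haj := h.ne_zero j (mem_Icc_of_mem_left hj)
  by_cases hij : i = j
  · subst hij
    have h1 := congrArg norm (mul_left_cancel₀ hai hst)
    rw [norm_pow, norm_pow] at h1
    rw [pow_right_injective₀ (norm_pos_iff.mpr hq0) hq.ne h1]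
  · refine absurd ((theta_eq_zero_iff hq hq0 (div_ne_zero hai haj)).mpr ⟨l - k, ?_⟩)
      (h.theta_div i hi j hj hij)
    rw [zpow_sub₀ hq0, zpow_natCast, zpow_natCast, div_eq_div_iff haj (pow_ne_zero _ hq0), hst,
      mul_comm]

lemma numer_eq_zero (h : IsAdmissible N ℓ a) {M : ℕ} {w : ℂ}
    (hw : w ∈ annulus N ℓ a M) (h0 : poleProd N ℓ a w = 0)
    (hs : ∀ s ∈ Finset.Icc 1 (N - 1) ×ˢ Finset.range (M + 1), a s.1 * base ℓ ^ s.2 * exp w ≠ 1) :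
    numer N ℓ a H w = 0 := by
  have hq := norm_base_lt_one h.re_neg
  have hq0 := base_ne_zero ℓ
  obtain ⟨i, hi, hi0⟩ := Finset.prod_eq_zero_iff.mp h0
  have hi' := mem_Icc_of_mem_left hi
  have hai := h.ne_zero i hi'
  obtain ⟨m, hm⟩ := (theta_eq_zero_iff hq hq0 (mul_ne_zero hai (exp_ne_zero w))).mp hi0
  rcases lt_or_ge 0 m with hm0 | hm0
  · have h1 : qPart N ℓ a (exp (-w)) = 0 := by
      rw [qPart, Finset.prod_eq_zero hi', mul_zero]
      have h2 : qPoch (base ℓ * (a i)⁻¹ * exp (-w)) (base ℓ) = 0 := by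
        refine (qPoch_eq_zero_iff hq).mpr ⟨(m - 1).toNat, ?_⟩
        rw [exp_neg, mul_assoc (base ℓ), ← mul_inv, hm, ← zpow_natCast,
          Int.toNat_of_nonneg (by omega), zpow_sub_one₀ hq0]
        have := zpow_ne_zero m hq0
        field_simp
      rw [h2, zero_div]
    rw [numer, h1, zero_mul, zero_div]
  · exfalso
    obtain ⟨k, hk⟩ : ∃ k : ℕ, m = -k := ⟨(-m).toNat, by omega⟩
    have hk1 : a i * base ℓ ^ k * exp w = 1 := by
      rw [mul_right_comm, hm, hk, zpow_neg, zpow_natCast,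
        inv_mul_cancel₀ (pow_ne_zero _ hq0)]
    have hkM : M + 1 ≤ k := by
      by_contra hlt
      exact hs (i, k) (Finset.mem_product.mpr ⟨hi, Finset.mem_range.mpr (by omega)⟩) hk1
    have h1 := congrArg norm hk1
    have h2 : ‖exp w * base ℓ ^ (M + 1)‖ < 1 := hw.2.2
    rw [norm_mul, norm_mul, norm_pow, norm_one] at h1
    rw [norm_mul, norm_pow] at h2
    have h3 : ‖base ℓ‖ ^ k ≤ ‖base ℓ‖ ^ (M + 1) :=
      pow_le_pow_of_le_one (norm_nonneg _) hq.le hkM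
    have h4 := h.norm_lt i hi'
    have h5 : ‖a i‖ * (‖exp w‖ * ‖base ℓ‖ ^ k) ≤ 1 * (‖exp w‖ * ‖base ℓ‖ ^ (M + 1)) := by
      gcongr
    linarith

theorem exists_sub_poleCoeff (h : IsAdmissible N ℓ a) (hH : IsLogCoefficient N ℓ H)
    (hHf : ∀ u : Fin (N + 2) → ℂ, (Odd N → ∀ i, |height ℓ (u i)| < Real.pi) →
      H u = f fun i => exp (u i)) (M : ℕ) :
    ∃ G : ℂ → ℂ, DifferentiableOn ℂ G (annulus N ℓ a M) ∧ ∀ w ∈ annulus N ℓ a M,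
      poleProd N ℓ a w ≠ 0 → G w = numer N ℓ a H w / poleProd N ℓ a w
        - ∑ s ∈ Finset.Icc 1 (N - 1) ×ˢ Finset.range (M + 1),
          poleCoeff N ℓ a H s * (1 - a s.1 * base ℓ ^ s.2 * exp w)⁻¹ := by
  refine exists_sub_poles (isOpen_annulus M) (differentiableOn_numer h hH M)
    (differentiable_poleProd h).differentiableOn _ _ _ (injOn_poles h M)
    (fun s hs w hw hsw => ⟨?_, ?_⟩) (fun w hw => numer_eq_zero h hw)
    fun w _ => deriv_poleProd_ne_zero h
  · exact Finset.prod_eq_zero (Finset.mem_product.mp hs).1 (theta_pole h hsw)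
  · exact numer_eq h hH hHf (Finset.mem_product.mp hs).1 hw.1 hsw

lemma poleConst_eq (h : IsAdmissible N ℓ a)
    (hHf : ∀ u : Fin (N + 2) → ℂ, (Odd N → ∀ i, |height ℓ (u i)| < Real.pi) →
      H u = f fun i => exp (u i)) (hi : i ∈ Finset.Icc 1 (N - 1)) :
    poleConst N ℓ a H i = f (Fin.cons (a i) fun k : Fin (N + 1) => a (N + k))
      / (qPoch (base ℓ) (base ℓ) ^ 2
        * (∏ j ∈ (Finset.Icc 1 (N - 1)).erase i, theta (a j / a i) (base ℓ))
        * tailPairs N ℓ a) := by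
  have hi' := mem_Icc_of_mem_left hi
  have hai := h.ne_zero i hi'
  have he : exp (-qLog ℓ (a i)) = (a i)⁻¹ := by rw [exp_neg, exp_qLog h.re_neg hai]
  have h1 : coeffAt N ℓ a H (-qLog ℓ (a i))
      = f (Fin.cons (a i) fun k : Fin (N + 1) => a (N + k)) := by
    rw [coeffAt, hHf]
    · congr 1
      funext l
      refine Fin.cases ?_ (fun m => ?_) l
      · rw [Fin.cons_zero, Fin.cons_zero, neg_neg, exp_qLog h.re_neg hai]
      · rw [Fin.cons_succ, Fin.cons_succ, exp_logTail h]
    · intro hN l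
      refine Fin.cases ?_ (fun m => ?_) l
      · rw [Fin.cons_zero, neg_neg]; exact abs_height_qLog_lt h hN hi'
      · rw [Fin.cons_succ]; exact abs_height_qLog_lt h hN (mem_Icc_of_fin h.two_le m)
  have h2 : theta (a i * exp (-qLog ℓ (a i))) (base ℓ) = 0 := by
    rw [he, mul_inv_cancel₀ hai]
    exact (theta_eq_zero_iff (norm_base_lt_one h.re_neg) (base_ne_zero ℓ) one_ne_zero).mpr
      ⟨0, by simp⟩
  rw [poleConst, poleRatio, h1, deriv_poleProd h hi h2, he, mul_inv_cancel₀ hai,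
    deriv_theta_one (norm_base_lt_one h.re_neg)]
  simp only [← div_eq_mul_inv]
  rw [one_mul, neg_mul, div_neg, neg_div, neg_neg, div_div]

end Residues


section Points

variable {N : ℕ} {ℓ : ℂ} {a : ℕ → ℂ}

lemma height_contourPoint (hℓ : ℓ.re < 0) (t v : ℝ) : height ℓ (contourPoint ℓ t v) = v := by
  rw [contourPoint, height_add, height_neg, height_real_mul hℓ, height_real_mul_I, neg_zero,
    zero_add]

lemma norm_exp_contourPoint (t v : ℝ) :
    ‖exp (contourPoint ℓ t v)‖ = Real.exp (-(t * ℓ.re)) := by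
  rw [norm_exp, contourPoint]
  simp

lemma norm_exp_neg_contourPoint (t v : ℝ) :
    ‖exp (-contourPoint ℓ t v)‖ = Real.exp (t * ℓ.re) := by
  rw [exp_neg, norm_inv, norm_exp_contourPoint, ← Real.exp_neg, neg_neg]

lemma norm_exp_neg_contourPoint_le (hℓ : ℓ.re < 0) {t : ℝ} (ht : 0 ≤ t) (v : ℝ) :
    ‖exp (-contourPoint ℓ t v)‖ ≤ 1 := by
  rw [norm_exp_neg_contourPoint, Real.exp_le_one_iff]
  exact mul_nonpos_of_nonneg_of_nonpos ht hℓ.le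

lemma contourPoint_add_nat (t v : ℝ) (n : ℕ) :
    contourPoint ℓ (t + n) v = contourPoint ℓ t v - n * ℓ := by
  simp only [contourPoint]; push_cast; ring

lemma contourPoint_pi (t : ℝ) :
    contourPoint ℓ t Real.pi = contourPoint ℓ t (-Real.pi) + 2 * Real.pi * I := by
  simp only [contourPoint]; push_cast; ring

lemma contourPoint_zero (v : ℝ) : contourPoint ℓ 0 v = v * I := by simp [contourPoint]

lemma mem_strip_contourPoint (h : IsAdmissible N ℓ a) (t : ℝ) {v : ℝ}
    (hv : v ∈ Set.Icc (-Real.pi) Real.pi) : contourPoint ℓ t v ∈ strip N ℓ a := by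
  refine mem_strip_of_abs_height_le h ?_
  rw [height_contourPoint h.re_neg, abs_le]
  exact hv

lemma norm_mul_exp_neg_lt (h : IsAdmissible N ℓ a) {w : ℂ} (hw : ‖exp (-w)‖ ≤ 1) :
    ∀ j ∈ Finset.Icc 1 (2 * N), ‖a j * exp (-w)‖ < 1 := fun j hj => by
  rw [norm_mul]
  exact (mul_le_of_le_one_right (norm_nonneg _) hw).trans_lt (h.norm_lt j hj)

lemma mem_annulus_contourPoint (h : IsAdmissible N ℓ a) {M : ℕ} {t v : ℝ}
    (ht : t ∈ Set.Ico 0 ((M : ℝ) + 1)) (hv : v ∈ Set.Icc (-Real.pi) Real.pi) :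
    contourPoint ℓ t v ∈ annulus N ℓ a M := by
  refine ⟨mem_strip_contourPoint h t hv,
    norm_mul_exp_neg_lt h (norm_exp_neg_contourPoint_le h.re_neg ht.1 v), ?_⟩
  change ‖_‖ < 1
  rw [norm_mul, norm_exp_contourPoint, norm_pow, base, norm_exp, ← Real.exp_nat_mul,
    ← Real.exp_add, Real.exp_lt_one_iff]
  push_cast
  have := h.re_neg
  nlinarith [ht.2]

/-- The points where one of the formulas for the integrand may fail. -/
def exceptional (N : ℕ) (ℓ : ℂ) (a : ℕ → ℂ) : Set ℂ :=
  {w | (∃ j ∈ Finset.Icc 1 (2 * N), theta (a j * exp w) (base ℓ) = 0) ∨ exp (N * w) = 1}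

lemma countable_exceptional (h : IsAdmissible N ℓ a) : (exceptional N ℓ a).Countable := by
  have h1 : (⋃ j : ℕ, Set.range fun m : ℤ => base ℓ ^ m / a j).Countable :=
    Set.countable_iUnion fun j => Set.countable_range _
  have h2 : ((fun w : ℂ => N * w) ⁻¹' (exp ⁻¹' {1})).Countable := by
    refine Set.Countable.preimage (Set.countable_singleton 1).preimage_cexp ?_
    have := h.two_le
    exact mul_right_injective₀ (Nat.cast_ne_zero.mpr (by omega))
  refine (h1.preimage_cexp.union h2).mono ?_
  rintro w (⟨j, hj, hw⟩ | hw)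
  · left
    have hj0 := h.ne_zero j hj
    obtain ⟨m, hm⟩ := (theta_eq_zero_iff (norm_base_lt_one h.re_neg) (base_ne_zero ℓ)
      (mul_ne_zero hj0 (exp_ne_zero w))).mp hw
    refine Set.mem_iUnion.mpr ⟨j, m, ?_⟩
    dsimp only
    rw [← hm, mul_div_cancel_left₀ _ hj0]
  · right; exact hw

lemma ae_contourPoint_left (h : IsAdmissible N ℓ a) (t : ℝ) :
    ∀ᵐ v : ℝ, contourPoint ℓ t v ∉ exceptional N ℓ a := by
  refine Set.Countable.ae_notMem ((countable_exceptional h).preimage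
    (f := fun v : ℝ => contourPoint ℓ t v) fun v v' hv => ?_) _
  have := congrArg (height ℓ) hv
  dsimp only at this
  rwa [height_contourPoint h.re_neg, height_contourPoint h.re_neg] at this

lemma ae_contourPoint_right (h : IsAdmissible N ℓ a) (v : ℝ) :
    ∀ᵐ t : ℝ, contourPoint ℓ t v ∉ exceptional N ℓ a := by
  refine Set.Countable.ae_notMem ((countable_exceptional h).preimage
    (f := fun t : ℝ => contourPoint ℓ t v) fun t t' ht => ?_) _
  have h1 := congrArg re ht
  simp only [contourPoint, add_re, neg_re, re_ofReal_mul] at h1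
  have := h.re_neg.ne
  have h2 : t * ℓ.re = t' * ℓ.re := by linarith
  exact mul_right_cancel₀ this h2

lemma poleProd_ne_zero (w : ℂ) (hw : w ∉ exceptional N ℓ a) : poleProd N ℓ a w ≠ 0 :=
  Finset.prod_ne_zero_iff.mpr fun j hj h0 => hw (Or.inl ⟨j, mem_Icc_of_mem_left hj, h0⟩)

lemma poleProd_sub_nat (h : IsAdmissible N ℓ a) {w : ℂ} (hw : poleProd N ℓ a w ≠ 0) (n : ℕ) :
    poleProd N ℓ a (w - n * ℓ) ≠ 0 := by
  induction n with
  | zero => simpa using hw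
  | succ n ih =>
    rw [show w - ((n + 1 : ℕ) : ℂ) * ℓ = w - n * ℓ - ℓ by push_cast; ring, poleProd_sub h]
    exact mul_ne_zero (poleFactor_ne_zero h _) ih

lemma exists_poleProd_ne_zero (h : IsAdmissible N ℓ a) :
    ∃ t ∈ Set.Ioo (0 : ℝ) 1, ∀ v : ℝ, poleProd N ℓ a (contourPoint ℓ t v) ≠ 0 := by
  have hc : (⋃ j : ℕ, Set.range fun m : ℤ => Real.log ‖a j‖ / ℓ.re - m).Countable :=
    Set.countable_iUnion fun j => Set.countable_range _
  obtain ⟨t, ht, ht'⟩ := (hc.dense_compl ℝ).exists_between (zero_lt_one (α := ℝ))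
  refine ⟨t, ht', fun v h0 => ht ?_⟩
  obtain ⟨j, hj, hj0⟩ := Finset.prod_eq_zero_iff.mp h0
  have haj := h.ne_zero j (mem_Icc_of_mem_left hj)
  obtain ⟨m, hm⟩ := (theta_eq_zero_iff (norm_base_lt_one h.re_neg) (base_ne_zero ℓ)
      (mul_ne_zero haj (exp_ne_zero _))).mp hj0
  refine Set.mem_iUnion.mpr ⟨j, m, ?_⟩
  have h1 := congrArg (fun z : ℂ => Real.log ‖z‖) hm
  dsimp only at h1 ⊢
  rw [norm_mul, norm_exp_contourPoint, norm_zpow, base, norm_exp,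
    Real.log_mul (norm_ne_zero_iff.mpr haj) (Real.exp_ne_zero _), Real.log_exp, Real.log_zpow,
    Real.log_exp] at h1
  have := h.re_neg.ne
  field_simp
  linarith

end Points

section Decomposition

variable {N : ℕ} {ℓ : ℂ} {a : ℕ → ℂ} {H : (Fin (N + 2) → ℂ) → ℂ}

/-- The denominator of the integrand. -/
noncomputable def denom (N : ℕ) (ℓ : ℂ) (a : ℕ → ℂ) (w : ℂ) : ℂ :=
  ∏ j ∈ Finset.Icc 1 (2 * N), (qPoch (a j * exp w) (base ℓ) * qPoch (a j * exp (-w)) (base ℓ))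

/-- The part of the integrand which carries the whole integral. -/
noncomputable def mainPart (N : ℕ) (ℓ : ℂ) (a : ℕ → ℂ) (H : (Fin (N + 2) → ℂ) → ℂ) (w : ℂ) : ℂ :=
  numer N ℓ a H w / poleProd N ℓ a w

/-- The part of the integrand which does not contribute to the integral. -/
noncomputable def oddPart (N : ℕ) (ℓ : ℂ) (a : ℕ → ℂ) (H : (Fin (N + 2) → ℂ) → ℂ) (w : ℂ) : ℂ :=
  (1 - exp (-w) ^ 2) * remainder N ℓ H (logTail N ℓ a) (-w)
    / (tailPairs N ℓ a * denom N ℓ a w)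

lemma Phi_eq_gExp (h : IsAdmissible N ℓ a) {w : ℂ} (hw : exp (N * w) ≠ 1) :
    Phi N ℓ a w = (1 - exp (-w) ^ 2) * gExp N ℓ (-w) / denom N ℓ a w := by
  have hp := norm_halfBase_lt_one h.two_le h.re_neg
  set Z := exp ((N : ℂ) / 2 * w) with hZ
  have hZ0 : Z ≠ 0 := exp_ne_zero _
  have h1 : exp (N * w) = Z ^ 2 := by
    rw [hZ, ← exp_nat_mul]; congr 1; push_cast; ring
  have h2 : Z ^ 2 ≠ 1 := by rwa [← h1]
  have h3 : exp (((N : ℂ) / 2 - 1) * -w) = exp w * Z⁻¹ := by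
    rw [hZ, ← exp_neg, ← exp_add]; congr 1; ring
  rw [Phi, gExp, ← denom, thetaExp, theta, h3, mul_neg, neg_neg, exp_neg (_ * w), ← hZ,
    exp_neg (N * w), h1, qPoch_eq_mul hp (Z ^ 2)⁻¹, mul_comm (halfBase N ℓ)]
  congr 1
  have h4 : Z - Z⁻¹ ≠ 0 := by
    intro h0
    apply h2
    have : Z * (Z - Z⁻¹) = Z ^ 2 - 1 := by field_simp
    rw [h0, mul_zero] at this
    linear_combination -this
  have h5 : (exp w - exp (-w)) = (1 - exp (-w) ^ 2) * exp w := by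
    rw [exp_neg]
    have := exp_ne_zero w
    field_simp
  rw [h5]
  have h6 : (1 - (Z ^ 2)⁻¹) = (Z - Z⁻¹) * Z⁻¹ := by field_simp
  rw [h6]
  field_simp

lemma denom_ne_zero (h : IsAdmissible N ℓ a) {w : ℂ} (hw : ‖exp (-w)‖ ≤ 1)
    (h0 : ∀ j ∈ Finset.Icc 1 (2 * N), qPoch (a j * exp w) (base ℓ) ≠ 0) :
    denom N ℓ a w ≠ 0 :=
  Finset.prod_ne_zero_iff.mpr fun j hj => mul_ne_zero (h0 j hj)
    (qPoch_mul_ne_zero h.re_neg h.norm_lt hw j hj)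

lemma mainPart_eq (h : IsAdmissible N ℓ a) {w : ℂ}
    (hw : ‖exp (-w)‖ ≤ 1) (hZ : w ∉ exceptional N ℓ a) :
    mainPart N ℓ a H w = (1 - exp (-w) ^ 2) * (coeffAt N ℓ a H w
      * ∏ j ∈ Finset.Icc N (2 * N), theta (a j * exp w) (base ℓ))
      / (tailPairs N ℓ a * denom N ℓ a w) := by
  have hth : ∀ j ∈ Finset.Icc 1 (2 * N), theta (a j * exp w) (base ℓ) ≠ 0 :=
    fun j hj h0 => hZ (Or.inl ⟨j, hj, h0⟩)
  have h1 : ∀ j ∈ Finset.Icc 1 (2 * N), qPoch (a j * exp w) (base ℓ) ≠ 0 := fun j hj =>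
    left_ne_zero_of_mul (hth j hj)
  have hD : poleProd N ℓ a w ≠ 0 := poleProd_ne_zero w hZ
  have hB := denom_ne_zero h hw h1
  have hc := tailPairs_ne_zero h
  have h2 : (∏ j ∈ Finset.Icc 1 (2 * N), (qPoch (base ℓ * (a j)⁻¹ * exp (-w)) (base ℓ)
        / qPoch (a j * exp (-w)) (base ℓ))) * denom N ℓ a w
      = poleProd N ℓ a w * ∏ j ∈ Finset.Icc N (2 * N), theta (a j * exp w) (base ℓ) := by
    rw [poleProd, prod_Icc_mul_prod_Icc h.two_le fun j => theta (a j * exp w) (base ℓ), denom,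
      ← Finset.prod_mul_distrib]
    refine Finset.prod_congr rfl fun j hj => ?_
    have h3 : base ℓ * (a j)⁻¹ * exp (-w) = base ℓ * (a j * exp w)⁻¹ := by
      rw [exp_neg, mul_inv, mul_assoc]
    have h4 := qPoch_mul_ne_zero h.re_neg h.norm_lt hw j hj
    rw [theta, h3]
    generalize qPoch (a j * exp (-w)) (base ℓ) = A at h4 ⊢
    field_simp
  rw [mainPart, numer, qPart]
  generalize (∏ j ∈ Finset.Icc 1 (2 * N), (qPoch (base ℓ * (a j)⁻¹ * exp (-w)) (base ℓ)
        / qPoch (a j * exp (-w)) (base ℓ))) = A at h2 ⊢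
  generalize ∏ j ∈ Finset.Icc N (2 * N), theta (a j * exp w) (base ℓ) = P at h2 ⊢
  rw [div_div, div_eq_div_iff (mul_ne_zero hc hD) (mul_ne_zero hc hB)]
  linear_combination ((1 - exp (-w) ^ 2) * coeffAt N ℓ a H w * tailPairs N ℓ a) * h2

lemma remainder_logTail (h : IsAdmissible N ℓ a) (w : ℂ) :
    remainder N ℓ H (logTail N ℓ a) (-w) = tailPairs N ℓ a * gExp N ℓ (-w)
      - coeffAt N ℓ a H w * ∏ j ∈ Finset.Icc N (2 * N), theta (a j * exp w) (base ℓ) := by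
  rw [remainder, tailPairs, coeffAt]
  simp only [exp_logTail h, exp_neg, div_inv_eq_mul]
  rw [prod_fin_eq_prod_Icc fun j => theta (a j * exp w) (base ℓ)]

lemma Phi_eq_add (h : IsAdmissible N ℓ a) {w : ℂ}
    (hw : ‖exp (-w)‖ ≤ 1) (hZ : w ∉ exceptional N ℓ a) :
    Phi N ℓ a w = mainPart N ℓ a H w + oddPart N ℓ a H w := by
  have hc := tailPairs_ne_zero h
  rw [Phi_eq_gExp h fun h0 => hZ (Or.inr h0), mainPart_eq h hw hZ, oddPart, remainder_logTail h,
    ← add_div, ← mul_add, add_sub_cancel, mul_left_comm, mul_div_mul_left _ _ hc]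

lemma denom_neg (w : ℂ) : denom N ℓ a (-w) = denom N ℓ a w := by
  rw [denom, denom, neg_neg]
  exact Finset.prod_congr rfl fun _ _ => mul_comm _ _

lemma oddPart_neg (h : IsAdmissible N ℓ a) (hH : IsLogCoefficient N ℓ H) {w : ℂ}
    (h1 : w ∈ strip N ℓ a) (h2 : -w ∈ strip N ℓ a) :
    oddPart N ℓ a H (-w) = -oddPart N ℓ a H w := by
  have h3 := remainder_neg hH h.two_le h.re_neg (cons_mem_logDomain h h1)
    (cons_mem_logDomain h h2)
  rw [oddPart, oddPart, denom_neg, h3, ← neg_div, neg_neg]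
  congr 1
  rw [exp_neg]
  have := exp_ne_zero w
  field_simp
  ring

lemma denom_add_two_pi (w : ℂ) : denom N ℓ a (w + 2 * Real.pi * I) = denom N ℓ a w := by
  simp only [denom, neg_add, exp_periodic w, exp_add (-w), exp_neg (2 * Real.pi * I),
    exp_two_pi_mul_I, inv_one, mul_one]

lemma oddPart_add_two_pi (h : IsAdmissible N ℓ a) (hH : IsLogCoefficient N ℓ H) {w : ℂ}
    (h1 : w ∈ strip N ℓ a) (h2 : w + 2 * Real.pi * I ∈ strip N ℓ a) :
    oddPart N ℓ a H (w + 2 * Real.pi * I) = oddPart N ℓ a H w := by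
  have h4 : -(w + 2 * Real.pi * I) + 2 * Real.pi * I = -w := by ring
  have h3 := remainder_add_two_pi hH h.two_le h.re_neg (cons_mem_logDomain h h2)
    (by rw [h4]; exact cons_mem_logDomain h h1)
  rw [h4] at h3
  have h5 : exp (-(w + 2 * Real.pi * I)) = exp (-w) := by
    rw [exp_neg, exp_periodic, exp_neg]
  rw [oddPart, oddPart, denom_add_two_pi, ← h3, h5]

end Decomposition


section Estimates

variable {N : ℕ} {ℓ : ℂ} {a : ℕ → ℂ} {H : (Fin (N + 2) → ℂ) → ℂ}

lemma coeffAt_div_poleProd_sub_nat (h : IsAdmissible N ℓ a) (hH : IsLogCoefficient N ℓ H) {w : ℂ}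
    (hw : w ∈ strip N ℓ a) (n : ℕ) :
    coeffAt N ℓ a H (w - n * ℓ) / poleProd N ℓ a (w - n * ℓ)
      = ratio N ℓ a ^ n * (coeffAt N ℓ a H w / poleProd N ℓ a w) := by
  have hs : ∀ n : ℕ, w - n * ℓ ∈ strip N ℓ a := by
    intro n
    induction n with
    | zero => simpa using hw
    | succ n ih =>
      rw [show w - ((n + 1 : ℕ) : ℂ) * ℓ = w - n * ℓ - ℓ by push_cast; ring]
      exact mem_strip_sub h.re_neg ih
  induction n with
  | zero => simp
  | succ n ih =>
    have := poleFactor_ne_zero h (w - n * ℓ)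
    rw [show w - ((n + 1 : ℕ) : ℂ) * ℓ = w - n * ℓ - ℓ by push_cast; ring,
      coeffAt_sub h hH (hs n), poleProd_sub h, mul_assoc, mul_div_assoc,
      mul_div_mul_left _ _ this, ih, pow_succ']
    ring

lemma exists_bound_qPart (h : IsAdmissible N ℓ a) :
    ∃ B : ℝ, ∀ x : ℂ, ‖x‖ ≤ 1 → ‖qPart N ℓ a x‖ ≤ B := by
  obtain ⟨B, hB⟩ := (isCompact_closedBall (0 : ℂ) 1).exists_bound_of_continuousOn
    (f := qPart N ℓ a) fun x hx => (differentiableAt_qPart h.re_neg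
      (qPoch_mul_ne_zero h.re_neg h.norm_lt
        (mem_closedBall_zero_iff.mp hx))).continuousAt.continuousWithinAt
  exact ⟨B, fun x hx => hB x (mem_closedBall_zero_iff.mpr hx)⟩

lemma exists_bound_mainPart (h : IsAdmissible N ℓ a) (hH : IsLogCoefficient N ℓ H) :
    ∃ B : ℝ, 0 ≤ B ∧ ∀ t : ℝ, 0 ≤ t → ∀ v ∈ Set.Icc (-Real.pi) Real.pi, ∀ n : ℕ,
      ‖mainPart N ℓ a H (contourPoint ℓ (t + n) v)‖ ≤ ‖ratio N ℓ a‖ ^ n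
        * (B * ‖coeffAt N ℓ a H (contourPoint ℓ t v) / poleProd N ℓ a (contourPoint ℓ t v)‖) := by
  obtain ⟨B, hB⟩ := exists_bound_qPart h
  have hB0 : 0 ≤ B := (norm_nonneg _).trans (hB 0 (by simp))
  refine ⟨B / ‖tailPairs N ℓ a‖, by positivity, fun t ht v hv n => ?_⟩
  have h1 : mainPart N ℓ a H (contourPoint ℓ (t + n) v)
      = qPart N ℓ a (exp (-contourPoint ℓ (t + n) v)) / tailPairs N ℓ a
        * (coeffAt N ℓ a H (contourPoint ℓ (t + n) v)
          / poleProd N ℓ a (contourPoint ℓ (t + n) v)) := by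
    rw [mainPart, numer]; ring
  have h2 := hB _ (norm_exp_neg_contourPoint_le h.re_neg (t := t + n) (by positivity) v)
  rw [h1, contourPoint_add_nat, coeffAt_div_poleProd_sub_nat h hH (mem_strip_contourPoint h t hv),
    ← contourPoint_add_nat, norm_mul, norm_mul, norm_pow, norm_div]
  calc _ ≤ B / ‖tailPairs N ℓ a‖ * (‖ratio N ℓ a‖ ^ n
      * ‖coeffAt N ℓ a H (contourPoint ℓ t v) / poleProd N ℓ a (contourPoint ℓ t v)‖) := by gcongr
    _ = _ := by ring

lemma continuousOn_coeffAt_div (h : IsAdmissible N ℓ a) (hH : IsLogCoefficient N ℓ H)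
    {X : Type*} [TopologicalSpace X] {p : X → ℂ} {s : Set X} (hp : Continuous p)
    (hs : ∀ x ∈ s, p x ∈ strip N ℓ a) (h0 : ∀ x ∈ s, poleProd N ℓ a (p x) ≠ 0) :
    ContinuousOn (fun x => coeffAt N ℓ a H (p x) / poleProd N ℓ a (p x)) s :=
  ((differentiableOn_coeffAt h hH).continuousOn.comp hp.continuousOn hs).div
    ((differentiable_poleProd h).continuous.comp hp).continuousOn h0

lemma continuous_contourPoint_left (ℓ : ℂ) (t : ℝ) : Continuous fun v => contourPoint ℓ t v := by
  unfold contourPoint; fun_prop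

lemma continuous_contourPoint_right (ℓ : ℂ) (v : ℝ) : Continuous fun t => contourPoint ℓ t v := by
  unfold contourPoint; fun_prop

lemma tendsto_integral_mainPart (h : IsAdmissible N ℓ a) (hH : IsLogCoefficient N ℓ H) {t : ℝ}
    (ht : 0 ≤ t) (h0 : ∀ v : ℝ, poleProd N ℓ a (contourPoint ℓ t v) ≠ 0) :
    Tendsto (fun M : ℕ => ∫ v in (-Real.pi)..Real.pi,
      I * mainPart N ℓ a H (contourPoint ℓ (t + M) v)) atTop (𝓝 0) := by
  obtain ⟨B, hB0, hB⟩ := exists_bound_mainPart h hH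
  obtain ⟨C, hC⟩ := isCompact_Icc.exists_bound_of_continuousOn
    (continuousOn_coeffAt_div h hH (continuous_contourPoint_left ℓ t)
      (fun v hv => mem_strip_contourPoint h t hv) fun v _ => h0 v)
  have hρ := tendsto_pow_atTop_nhds_zero_of_lt_one (norm_nonneg _) h.ratio_lt
  have hlim := (hρ.mul_const (B * C)).mul_const |Real.pi - -Real.pi|
  rw [zero_mul, zero_mul] at hlim
  refine squeeze_zero_norm (fun M => ?_) hlim
  refine intervalIntegral.norm_integral_le_of_norm_le_const fun v hv => ?_
  have hv' : v ∈ Set.Icc (-Real.pi) Real.pi := by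
    rw [Set.uIoc_of_le (by linarith [Real.pi_pos])] at hv
    exact Set.Ioc_subset_Icc_self hv
  rw [norm_mul, norm_I, one_mul]
  refine (hB t ht v hv' M).trans ?_
  have := hC v hv'
  gcongr

lemma theta_ne_zero_on_cut (h : IsAdmissible N ℓ a) (hN : Odd N) {j : ℕ}
    (hj : j ∈ Finset.Icc 1 (2 * N)) (t : ℝ) {v : ℝ} (hv : exp (v * I) = -1) :
    theta (a j * exp (contourPoint ℓ t v)) (base ℓ) ≠ 0 := by
  intro h0
  obtain ⟨m, hm⟩ := (theta_eq_zero_iff (norm_base_lt_one h.re_neg) (base_ne_zero ℓ)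
      (mul_ne_zero (h.ne_zero j hj) (exp_ne_zero _))).mp h0
  refine (h.mem j hj).2 hN (m + t) ?_
  rw [contourPoint, exp_add, hv, exp_neg, base, ← exp_int_mul] at hm
  have h1 : ((m + t : ℝ) : ℂ) * ℓ = m * ℓ + t * ℓ := by push_cast; ring
  rw [h1, exp_add, ← hm]
  have := exp_ne_zero (t * ℓ)
  field_simp

lemma integrableOn_mainPart (h : IsAdmissible N ℓ a) (hH : IsLogCoefficient N ℓ H) (hN : Odd N)
    {v : ℝ} (hvI : v ∈ Set.Icc (-Real.pi) Real.pi) (hv : exp (v * I) = -1) :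
    MeasureTheory.IntegrableOn (fun t => mainPart N ℓ a H (contourPoint ℓ t v)) (Set.Ioi 0) := by
  have h0 : ∀ t, poleProd N ℓ a (contourPoint ℓ t v) ≠ 0 := fun t =>
    Finset.prod_ne_zero_iff.mpr fun j hj => theta_ne_zero_on_cut h hN (mem_Icc_of_mem_left hj) t hv
  obtain ⟨B, hB0, hB⟩ := exists_bound_mainPart h hH
  have hcK : Continuous fun t => coeffAt N ℓ a H (contourPoint ℓ t v)
      / poleProd N ℓ a (contourPoint ℓ t v) := by
    rw [← continuousOn_univ]
    exact continuousOn_coeffAt_div h hH (continuous_contourPoint_right ℓ v)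
      (fun t _ => mem_strip_contourPoint h t hvI) fun t _ => h0 t
  obtain ⟨C, hC⟩ := (isCompact_Icc (a := (0 : ℝ)) (b := 1)).exists_bound_of_continuousOn
    hcK.continuousOn
  set r := ‖ratio N ℓ a‖ with hr
  have hr0 : 0 < r := norm_pos_iff.mpr (div_ne_zero (pow_ne_zero _ (base_ne_zero ℓ))
    (Finset.prod_ne_zero_iff.mpr h.ne_zero))
  have hlog : Real.log r < 0 := Real.log_neg hr0 h.ratio_lt
  have hC0 : 0 ≤ C := (norm_nonneg _).trans (hC 0 (by simp))
  have hdom := ((integrableOn_exp_mul_Ioi hlog 0).const_mul (Real.exp (-Real.log r))).mul_const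
    (B * C)
  have hcont : ContinuousOn (fun t => mainPart N ℓ a H (contourPoint ℓ t v)) (Set.Ioi 0) := by
    have hq : ContinuousOn (fun t => qPart N ℓ a (exp (-contourPoint ℓ t v))) (Set.Ioi 0) := by
      intro t ht
      have := (differentiableAt_qPart_exp_neg h.re_neg (norm_mul_exp_neg_lt h
        (norm_exp_neg_contourPoint_le h.re_neg (le_of_lt ht) v))).continuousAt
      exact (ContinuousAt.comp (f := fun t => contourPoint ℓ t v) this
        (continuous_contourPoint_right ℓ v).continuousAt).continuousWithinAt
    refine ((hq.mul hcK.continuousOn).div_const (tailPairs N ℓ a)).congr fun t _ => ?_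
    simp only [mainPart, numer, Pi.mul_apply]; ring
  refine MeasureTheory.Integrable.mono' hdom
    (hcont.aestronglyMeasurable measurableSet_Ioi) ?_
  filter_upwards [MeasureTheory.self_mem_ae_restrict measurableSet_Ioi] with t ht
  have ht0 : 0 ≤ t := le_of_lt ht
  have hfl := Nat.floor_le ht0
  have hfl' := Nat.lt_floor_add_one t
  have h1 := hB (t - ⌊t⌋₊) (by linarith) v hvI ⌊t⌋₊
  rw [sub_add_cancel] at h1
  refine h1.trans ?_
  have h2 := hC (t - ⌊t⌋₊) ⟨by linarith, by linarith⟩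
  have h3 : r ^ ⌊t⌋₊ ≤ Real.exp (-Real.log r) * Real.exp (Real.log r * t) := by
    rw [← Real.exp_add, ← Real.rpow_natCast, Real.rpow_def_of_pos hr0]
    gcongr
    nlinarith
  gcongr

end Estimates


section Integrability

variable {N : ℕ} {ℓ : ℂ} {a : ℕ → ℂ} {H : (Fin (N + 2) → ℂ) → ℂ}

lemma neg_pi_le_pi : -Real.pi ≤ Real.pi := by linarith [Real.pi_pos]

lemma mem_Icc_of_mem_uIoc {v : ℝ} (hv : v ∈ Set.uIoc (-Real.pi) Real.pi) :
    v ∈ Set.Icc (-Real.pi) Real.pi := by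
  rw [Set.uIoc_of_le neg_pi_le_pi] at hv
  exact Set.Ioc_subset_Icc_self hv

lemma norm_exp_real_mul_I_neg (v : ℝ) : ‖exp (-(v * I))‖ = 1 := by
  rw [← neg_mul, ← ofReal_neg, norm_exp_ofReal_mul_I]

lemma denom_circle_ne_zero (h : IsAdmissible N ℓ a) (v : ℝ) : denom N ℓ a (v * I) ≠ 0 :=
  denom_ne_zero h (norm_exp_real_mul_I_neg v).le
    (qPoch_mul_ne_zero h.re_neg h.norm_lt (norm_exp_ofReal_mul_I v).le)

lemma continuous_denom (hℓ : ℓ.re < 0) : Continuous (denom N ℓ a) := by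
  have hp := continuous_qPoch (norm_base_lt_one hℓ)
  unfold denom
  refine continuous_finsetProd _ fun j _ => ?_
  exact (hp.comp (by fun_prop)).mul (hp.comp (by fun_prop))

lemma intervalIntegrable_Phi (h : IsAdmissible N ℓ a) :
    IntervalIntegrable (fun v : ℝ => Phi N ℓ a (v * I)) MeasureTheory.volume
      (-Real.pi) Real.pi := by
  have hg := (differentiable_gExp h.two_le h.re_neg).continuous
  have hd := continuous_denom (N := N) (a := a) h.re_neg
  have h1 : Continuous fun v : ℝ => (1 - exp (-(v * I)) ^ 2) * gExp N ℓ (-(v * I))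
      / denom N ℓ a (v * I) :=
    Continuous.div (by fun_prop) (by fun_prop) (denom_circle_ne_zero h)
  refine (h1.intervalIntegrable _ _).congr_ae ?_
  refine MeasureTheory.ae_restrict_of_ae ?_
  filter_upwards [ae_contourPoint_left h 0] with v hv
  rw [contourPoint_zero] at hv
  exact (Phi_eq_gExp h fun h0 => hv (Or.inr h0)).symm

lemma mem_strip_circle (h : IsAdmissible N ℓ a) {v : ℝ} (hv : v ∈ Set.Icc (-Real.pi) Real.pi) :
    (v * I : ℂ) ∈ strip N ℓ a := by
  rw [← contourPoint_zero (ℓ := ℓ)]; exact mem_strip_contourPoint h 0 hv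

lemma intervalIntegrable_oddPart (h : IsAdmissible N ℓ a) (hH : IsLogCoefficient N ℓ H) :
    IntervalIntegrable (fun v : ℝ => oddPart N ℓ a H (v * I)) MeasureTheory.volume
      (-Real.pi) Real.pi := by
  have hg := (differentiable_gExp h.two_le h.re_neg).continuous
  have hd := continuous_denom (N := N) (a := a) h.re_neg
  have hth : ∀ j ∈ Finset.Icc N (2 * N), Continuous fun v : ℝ =>
      theta (a j * exp (v * I)) (base ℓ) := by
    intro j hj
    have hj0 : a j ≠ 0 := h.ne_zero j (by
      have := h.two_le; rw [Finset.mem_Icc] at hj ⊢; omega)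
    refine continuous_iff_continuousAt.mpr fun v => ?_
    exact ContinuousAt.comp (f := fun v : ℝ => a j * exp (v * I)) (g := fun z => theta z (base ℓ))
      (differentiableAt_theta (norm_base_lt_one h.re_neg)
        (mul_ne_zero hj0 (exp_ne_zero _))).continuousAt (by fun_prop)
  have hc : ContinuousOn (fun v : ℝ => coeffAt N ℓ a H (v * I)) (Set.Icc (-Real.pi) Real.pi) :=
    (differentiableOn_coeffAt h hH).continuousOn.comp (by fun_prop)
      fun v hv => mem_strip_circle h hv
  refine ContinuousOn.intervalIntegrable ?_
  rw [Set.uIcc_of_le neg_pi_le_pi]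
  simp only [oddPart, remainder_logTail h]
  refine ContinuousOn.div (ContinuousOn.mul (by fun_prop) (ContinuousOn.sub (by fun_prop)
    (hc.mul (continuous_finsetProd _ hth).continuousOn))) (by fun_prop) fun v _ => ?_
  exact mul_ne_zero (tailPairs_ne_zero h) (denom_circle_ne_zero h v)

lemma integral_oddPart (h : IsAdmissible N ℓ a) (hH : IsLogCoefficient N ℓ H) :
    ∫ v in (-Real.pi)..Real.pi, oddPart N ℓ a H (v * I) = 0 := by
  have h1 := intervalIntegral.integral_comp_neg (a := -Real.pi) (b := Real.pi)
    fun v : ℝ => oddPart N ℓ a H (v * I)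
  have h2 : ∫ v in (-Real.pi)..Real.pi, oddPart N ℓ a H ((-v : ℝ) * I)
      = ∫ v in (-Real.pi)..Real.pi, -oddPart N ℓ a H (v * I) := by
    refine intervalIntegral.integral_congr fun v hv => ?_
    rw [Set.uIcc_of_le neg_pi_le_pi] at hv
    have hv' : -v ∈ Set.Icc (-Real.pi) Real.pi := ⟨by linarith [hv.2], by linarith [hv.1]⟩
    have := mem_strip_circle h hv'
    simp only [ofReal_neg, neg_mul] at this ⊢
    exact oddPart_neg h hH (mem_strip_circle h hv) this
  rw [h2, neg_neg, intervalIntegral.integral_neg] at h1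
  exact self_eq_neg.mp h1.symm

lemma integral_circle_mainPart (h : IsAdmissible N ℓ a) (hH : IsLogCoefficient N ℓ H) :
    ∫ v in (-Real.pi)..Real.pi, I * mainPart N ℓ a H (contourPoint ℓ 0 v)
      = ∫ v in (-Real.pi)..Real.pi, Phi N ℓ a (v * I) * I := by
  have h1 : ∫ v in (-Real.pi)..Real.pi, I * mainPart N ℓ a H (contourPoint ℓ 0 v)
      = ∫ v in (-Real.pi)..Real.pi, I * (Phi N ℓ a (v * I) - oddPart N ℓ a H (v * I)) := by
    refine intervalIntegral.integral_congr_ae ?_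
    filter_upwards [ae_contourPoint_left h 0] with v hv _
    rw [contourPoint_zero] at hv ⊢
    rw [Phi_eq_add (H := H) h (norm_exp_real_mul_I_neg v).le hv, add_sub_cancel_right]
  rw [h1, intervalIntegral.integral_const_mul, intervalIntegral.integral_sub
    (intervalIntegrable_Phi h) (intervalIntegrable_oddPart h hH), integral_oddPart h hH, sub_zero,
    intervalIntegral.integral_mul_const, mul_comm]

lemma tailPhi_eq (t : ℝ) : tailPhi N ℓ a t
    = Phi N ℓ a (contourPoint ℓ t Real.pi) - Phi N ℓ a (contourPoint ℓ t (-Real.pi)) := by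
  simp only [tailPhi, contourPoint, ofReal_neg, neg_mul, sub_eq_add_neg]

lemma pi_mem_Icc : Real.pi ∈ Set.Icc (-Real.pi) Real.pi := ⟨neg_pi_le_pi, le_rfl⟩

lemma neg_pi_mem_Icc : -Real.pi ∈ Set.Icc (-Real.pi) Real.pi := ⟨le_rfl, neg_pi_le_pi⟩

lemma tailPhi_eq_mainPart (h : IsAdmissible N ℓ a) (hH : IsLogCoefficient N ℓ H) {t : ℝ}
    (ht : 0 ≤ t) (h1 : contourPoint ℓ t Real.pi ∉ exceptional N ℓ a)
    (h2 : contourPoint ℓ t (-Real.pi) ∉ exceptional N ℓ a) :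
    tailPhi N ℓ a t = mainPart N ℓ a H (contourPoint ℓ t Real.pi)
      - mainPart N ℓ a H (contourPoint ℓ t (-Real.pi)) := by
  have h3 := oddPart_add_two_pi h hH (mem_strip_contourPoint h t neg_pi_mem_Icc)
    (by rw [← contourPoint_pi]; exact mem_strip_contourPoint h t pi_mem_Icc)
  rw [← contourPoint_pi] at h3
  rw [tailPhi_eq, Phi_eq_add (H := H) h (norm_exp_neg_contourPoint_le h.re_neg ht _) h1,
    Phi_eq_add (H := H) h (norm_exp_neg_contourPoint_le h.re_neg ht _) h2, h3]
  ring

lemma Phi_add_two_pi (hN : Even N) (w : ℂ) :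
    Phi N ℓ a (w + 2 * Real.pi * I) = Phi N ℓ a w := by
  obtain ⟨n, rfl⟩ := hN
  have h0 : ∀ w : ℂ, exp (((n + n : ℕ) : ℂ) / 2 * w) = exp w ^ n := fun w => by
    rw [← exp_nat_mul]; congr 1; push_cast; ring
  have h1 : ∀ w : ℂ, exp (((n + n : ℕ) : ℂ) * w) = exp w ^ (n + n) := fun w => exp_nat_mul _ _
  simp only [Phi, exp_neg, h0, h1, exp_periodic w]

lemma tailPhi_eq_zero (hN : Even N) : tailPhi N ℓ a = fun _ => 0 := by
  funext t
  rw [tailPhi_eq, contourPoint_pi, Phi_add_two_pi hN, sub_self]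

lemma integrableOn_tailPhi (h : IsAdmissible N ℓ a) (hH : IsLogCoefficient N ℓ H) :
    MeasureTheory.IntegrableOn (tailPhi N ℓ a) (Set.Ioi 0) := by
  rcases N.even_or_odd with hN | hN
  · rw [tailPhi_eq_zero hN]; exact MeasureTheory.integrableOn_zero
  · have h1 : exp ((Real.pi : ℝ) * I) = -1 := exp_pi_mul_I
    have h2 : exp (((-Real.pi : ℝ) : ℂ) * I) = -1 := by
      rw [ofReal_neg, neg_mul, exp_neg, exp_pi_mul_I]; norm_num
    refine ((integrableOn_mainPart h hH hN pi_mem_Icc h1).sub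
      (integrableOn_mainPart h hH hN neg_pi_mem_Icc h2)).congr ?_
    filter_upwards [MeasureTheory.self_mem_ae_restrict measurableSet_Ioi,
      MeasureTheory.ae_restrict_of_ae (ae_contourPoint_right h Real.pi),
      MeasureTheory.ae_restrict_of_ae (ae_contourPoint_right h (-Real.pi))] with t ht h3 h4
    exact (tailPhi_eq_mainPart h hH (le_of_lt ht) h3 h4).symm

end Integrability

section Truncated

variable {N : ℕ} {ℓ : ℂ} {a : ℕ → ℂ} {H f : (Fin (N + 2) → ℂ) → ℂ}

/-- The indices of the poles up to level `M`. -/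
def poleIndex (N M : ℕ) : Finset (ℕ × ℕ) := Finset.Icc 1 (N - 1) ×ˢ Finset.range (M + 1)

/-- The pole `1 / b` in the coordinate `e^{iv}` of the circle of height `t`. -/
noncomputable def scaledPole (ℓ : ℂ) (a : ℕ → ℂ) (t : ℝ) (s : ℕ × ℕ) : ℂ :=
  a s.1 * base ℓ ^ s.2 * exp (-(t * ℓ))

lemma scaledPole_mul (t v : ℝ) (s : ℕ × ℕ) : scaledPole ℓ a t s * exp (v * I)
    = a s.1 * base ℓ ^ s.2 * exp (contourPoint ℓ t v) := by
  rw [scaledPole, contourPoint, exp_add]; ring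

lemma norm_scaledPole (t : ℝ) (s : ℕ × ℕ) :
    ‖scaledPole ℓ a t s‖ = ‖a s.1‖ * ‖base ℓ‖ ^ s.2 * Real.exp (-(t * ℓ.re)) := by
  rw [scaledPole, norm_mul, norm_mul, norm_pow, norm_exp]; simp

lemma norm_scaledPole_ne_one (h : IsAdmissible N ℓ a) {t : ℝ}
    (h0 : ∀ v : ℝ, poleProd N ℓ a (contourPoint ℓ t v) ≠ 0) {s : ℕ × ℕ}
    (hs : s.1 ∈ Finset.Icc 1 (N - 1)) : ‖scaledPole ℓ a t s‖ ≠ 1 := by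
  intro h1
  refine h0 (-arg (scaledPole ℓ a t s)) (Finset.prod_eq_zero hs (theta_pole (k := s.2) h ?_))
  rw [← scaledPole_mul]
  have h2 := norm_mul_exp_arg_mul_I (scaledPole ℓ a t s)
  rw [h1, ofReal_one, one_mul] at h2
  nth_rewrite 1 [← h2]
  rw [← exp_add, ofReal_neg, neg_mul, add_neg_cancel, exp_zero]

lemma integral_mainPart_eq (h : IsAdmissible N ℓ a) {M : ℕ} {G : ℂ → ℂ}
    (hGd : DifferentiableOn ℂ G (annulus N ℓ a M))
    (hG : ∀ w ∈ annulus N ℓ a M, poleProd N ℓ a w ≠ 0 → G w = numer N ℓ a H w / poleProd N ℓ a w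
        - ∑ s ∈ Finset.Icc 1 (N - 1) ×ˢ Finset.range (M + 1),
          poleCoeff N ℓ a H s * (1 - a s.1 * base ℓ ^ s.2 * exp w)⁻¹) {t : ℝ}
    (ht : t ∈ Set.Ico 0 ((M : ℝ) + 1))
    (hs : ∀ s ∈ poleIndex N M, ‖scaledPole ℓ a t s‖ ≠ 1) :
    ∫ v in (-Real.pi)..Real.pi, I * mainPart N ℓ a H (contourPoint ℓ t v)
      = (∫ v in (-Real.pi)..Real.pi, I * G (contourPoint ℓ t v))
        + ∑ s ∈ poleIndex N M, I * poleCoeff N ℓ a H s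
          * ∫ v in (-Real.pi)..Real.pi, (1 - scaledPole ℓ a t s * exp (v * I))⁻¹ := by
  have h1 : ∫ v in (-Real.pi)..Real.pi, I * mainPart N ℓ a H (contourPoint ℓ t v)
      = ∫ v in (-Real.pi)..Real.pi, (I * G (contourPoint ℓ t v) + ∑ s ∈ poleIndex N M,
        I * poleCoeff N ℓ a H s * (1 - scaledPole ℓ a t s * exp (v * I))⁻¹) := by
    refine intervalIntegral.integral_congr_ae ?_
    filter_upwards [ae_contourPoint_left h t] with v hv hvI
    rw [hG _ (mem_annulus_contourPoint h ht (mem_Icc_of_mem_uIoc hvI)) (poleProd_ne_zero _ hv),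
      mainPart, poleIndex, mul_sub, Finset.mul_sum]
    simp only [scaledPole_mul, mul_assoc]
    rw [sub_add_cancel]
  have h2 : IntervalIntegrable (fun v => I * G (contourPoint ℓ t v)) MeasureTheory.volume
      (-Real.pi) Real.pi := by
    refine ContinuousOn.intervalIntegrable ?_
    rw [Set.uIcc_of_le neg_pi_le_pi]
    exact continuousOn_const.mul (hGd.continuousOn.comp
      (continuous_contourPoint_left ℓ t).continuousOn
      fun v hv => mem_annulus_contourPoint h ht hv)
  have h3 : ∀ s ∈ poleIndex N M, IntervalIntegrable
      (fun v : ℝ => I * poleCoeff N ℓ a H s * (1 - scaledPole ℓ a t s * exp (v * I))⁻¹)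
      MeasureTheory.volume (-Real.pi) Real.pi := by
    intro s hsM
    refine Continuous.intervalIntegrable (continuous_const.mul (Continuous.inv₀ (by fun_prop)
      fun v h0 => hs s hsM ?_)) _ _
    have := congrArg norm (sub_eq_zero.mp h0)
    rwa [norm_one, norm_mul, norm_exp_ofReal_mul_I, mul_one, eq_comm] at this
  have h4 : IntervalIntegrable (fun v : ℝ => ∑ s ∈ poleIndex N M,
      I * poleCoeff N ℓ a H s * (1 - scaledPole ℓ a t s * exp (v * I))⁻¹)
      MeasureTheory.volume (-Real.pi) Real.pi := by
    have := IntervalIntegrable.sum _ h3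
    rw [Finset.sum_fn] at this
    exact this
  rw [h1, intervalIntegral.integral_add h2 h4, intervalIntegral.integral_finsetSum h3]
  simp only [intervalIntegral.integral_const_mul]

theorem integral_truncated (h : IsAdmissible N ℓ a) (hH : IsLogCoefficient N ℓ H)
    (hHf : ∀ u : Fin (N + 2) → ℂ, (Odd N → ∀ i, |height ℓ (u i)| < Real.pi) →
      H u = f fun i => exp (u i)) {M : ℕ} {T : ℝ} (hT : T ∈ Set.Ico 0 ((M : ℝ) + 1))
    (h0 : ∀ v : ℝ, poleProd N ℓ a (contourPoint ℓ T v) ≠ 0) :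
    (∫ v in (-Real.pi)..Real.pi, Phi N ℓ a (v * I) * I)
        - (∫ v in (-Real.pi)..Real.pi, I * mainPart N ℓ a H (contourPoint ℓ T v))
        + (∫ t in (0 : ℝ)..T, tailPhi N ℓ a t * (-ℓ))
      = ∑ s ∈ poleIndex N M, I * poleCoeff N ℓ a H s * (2 * Real.pi
          - ∫ v in (-Real.pi)..Real.pi, (1 - scaledPole ℓ a T s * exp (v * I))⁻¹) := by
  have hM0 : (0 : ℝ) ∈ Set.Ico 0 ((M : ℝ) + 1) := ⟨le_rfl, by positivity⟩
  have hmem : ∀ s ∈ poleIndex N M, s.1 ∈ Finset.Icc 1 (N - 1) := fun s hs =>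
    (Finset.mem_product.mp hs).1
  obtain ⟨G, hGd, hG⟩ := exists_sub_poleCoeff h hH hHf M
  have hlt : ∀ s ∈ poleIndex N M, ‖scaledPole ℓ a 0 s‖ < 1 := by
    intro s hs
    have h1 := norm_mul_base_pow_le h.re_neg (le_refl ‖a s.1‖) s.2
    have h2 := h.norm_lt s.1 (mem_Icc_of_mem_left (hmem s hs))
    rw [norm_scaledPole, zero_mul, neg_zero, Real.exp_zero, mul_one, ← norm_pow, ← norm_mul]
    exact h1.trans_lt h2
  have hpar := integral_parallelogram (ℓ := ℓ) hT.1 (G := G) fun t ht v hv =>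
    hGd.differentiableAt ((isOpen_annulus M).mem_nhds
      (mem_annulus_contourPoint h ⟨ht.1, ht.2.trans_lt hT.2⟩ hv))
  have hc0 := integral_mainPart_eq h hGd hG hM0 fun s hs => (hlt s hs).ne
  have hcT := integral_mainPart_eq h hGd hG hT fun s hs => norm_scaledPole_ne_one h h0 (hmem s hs)
  have hinner : ∀ s ∈ poleIndex N M, I * poleCoeff N ℓ a H s
      * (∫ v in (-Real.pi)..Real.pi, (1 - scaledPole ℓ a 0 s * exp (v * I))⁻¹)
      = I * poleCoeff N ℓ a H s * (2 * Real.pi) := fun s hs => by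
    rw [integral_inv_one_sub_of_norm_lt (hlt s hs)]
  rw [integral_circle_mainPart h hH, Finset.sum_congr rfl hinner] at hc0
  have hGc : ∀ v ∈ Set.Icc (-Real.pi) Real.pi, IntervalIntegrable
      (fun t => -ℓ * G (contourPoint ℓ t v)) MeasureTheory.volume 0 T := by
    intro v hv
    refine ContinuousOn.intervalIntegrable ?_
    rw [Set.uIcc_of_le hT.1]
    exact continuousOn_const.mul (hGd.continuousOn.comp
      (continuous_contourPoint_right ℓ v).continuousOn
      fun t ht => mem_annulus_contourPoint h ⟨ht.1, ht.2.trans_lt hT.2⟩ hv)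
  have htail : (∫ t in (0 : ℝ)..T, -ℓ * G (contourPoint ℓ t Real.pi))
      - (∫ t in (0 : ℝ)..T, -ℓ * G (contourPoint ℓ t (-Real.pi)))
      = ∫ t in (0 : ℝ)..T, tailPhi N ℓ a t * (-ℓ) := by
    rw [← intervalIntegral.integral_sub (hGc _ pi_mem_Icc) (hGc _ neg_pi_mem_Icc)]
    refine intervalIntegral.integral_congr_ae ?_
    filter_upwards [ae_contourPoint_right h Real.pi, ae_contourPoint_right h (-Real.pi)]
      with t h1 h2 ht
    rw [Set.uIoc_of_le hT.1] at ht
    have htM : t ∈ Set.Ico 0 ((M : ℝ) + 1) := ⟨ht.1.le, ht.2.trans_lt hT.2⟩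
    have he : exp (contourPoint ℓ t Real.pi) = exp (contourPoint ℓ t (-Real.pi)) := by
      rw [contourPoint_pi, exp_periodic]
    rw [tailPhi_eq_mainPart h hH ht.1.le h1 h2,
      hG _ (mem_annulus_contourPoint h htM pi_mem_Icc) (poleProd_ne_zero _ h1),
      hG _ (mem_annulus_contourPoint h htM neg_pi_mem_Icc) (poleProd_ne_zero _ h2), he,
      mainPart, mainPart]
    ring
  rw [htail] at hpar
  simp only [mul_sub, Finset.sum_sub_distrib]
  linear_combination hc0 - hcT + hpar

end Truncated


section Limit

variable {N : ℕ} {ℓ : ℂ} {a : ℕ → ℂ} {H f : (Fin (N + 2) → ℂ) → ℂ}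

lemma summable_norm_poleCoeff (h : IsAdmissible N ℓ a) {i : ℕ} (hi : i ∈ Finset.Icc 1 (N - 1)) :
    Summable fun k : ℕ => ‖poleCoeff N ℓ a H (i, k)‖ := by
  obtain ⟨B, hB⟩ := exists_bound_qPart h
  refine Summable.of_nonneg_of_le (fun _ => norm_nonneg _) (fun k => ?_)
    (((summable_geometric_of_lt_one (norm_nonneg _) h.ratio_lt).mul_right B).mul_right
      ‖poleConst N ℓ a H i‖)
  rw [poleCoeff, norm_mul, norm_mul, norm_pow]
  have := hB _ (norm_mul_base_pow_le h.re_neg (h.norm_lt i (mem_Icc_of_mem_left hi)).le k)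
  gcongr

lemma tendsto_norm_scaledPole (h : IsAdmissible N ℓ a) (t : ℝ) {i : ℕ}
    (hi : i ∈ Finset.Icc 1 (N - 1)) (k : ℕ) :
    Tendsto (fun M : ℕ => ‖scaledPole ℓ a (t + M) (i, k)‖) atTop atTop := by
  simp only [norm_scaledPole]
  refine Tendsto.const_mul_atTop ?_ (Real.tendsto_exp_atTop.comp ?_)
  · have h1 := norm_pos_iff.mpr (h.ne_zero i (mem_Icc_of_mem_left hi))
    have h2 := norm_pos_iff.mpr (base_ne_zero ℓ)
    positivity
  · have h1 : Tendsto (fun M : ℕ => t + (M : ℝ)) atTop atTop :=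
      tendsto_atTop_add_const_left _ t tendsto_natCast_atTop_atTop
    have h2 := h1.atTop_mul_const (neg_pos.mpr h.re_neg)
    simpa only [mul_neg] using h2

lemma norm_two_pi_sub_integral_le (h : IsAdmissible N ℓ a) {t : ℝ}
    (h0 : ∀ v : ℝ, poleProd N ℓ a (contourPoint ℓ t v) ≠ 0) {s : ℕ × ℕ}
    (hs : s.1 ∈ Finset.Icc 1 (N - 1)) :
    ‖(2 * Real.pi : ℂ)
      - ∫ v in (-Real.pi)..Real.pi, (1 - scaledPole ℓ a t s * exp (v * I))⁻¹‖ ≤ 2 * Real.pi := by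
  rcases lt_or_gt_of_ne (norm_scaledPole_ne_one h h0 hs) with h1 | h1
  · rw [integral_inv_one_sub_of_norm_lt h1, sub_self, norm_zero]; positivity
  · rw [integral_inv_one_sub_of_lt_norm h1, sub_zero, norm_mul, norm_real]
    simp [abs_of_pos Real.pi_pos]

lemma tendsto_sum_poles (h : IsAdmissible N ℓ a) {t : ℝ} {i : ℕ}
    (hi : i ∈ Finset.Icc 1 (N - 1))
    (h0 : ∀ (M : ℕ) (v : ℝ), poleProd N ℓ a (contourPoint ℓ (t + M) v) ≠ 0) :
    Tendsto (fun M : ℕ => ∑ k ∈ Finset.range (M + 1), I * poleCoeff N ℓ a H (i, k) * (2 * Real.pi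
        - ∫ v in (-Real.pi)..Real.pi, (1 - scaledPole ℓ a (t + M) (i, k) * exp (v * I))⁻¹)) atTop
      (𝓝 (∑' k : ℕ, I * poleCoeff N ℓ a H (i, k) * (2 * Real.pi))) := by
  set F : ℕ → ℕ → ℂ := fun M k => I * poleCoeff N ℓ a H (i, k) * (2 * Real.pi
        - ∫ v in (-Real.pi)..Real.pi, (1 - scaledPole ℓ a (t + M) (i, k) * exp (v * I))⁻¹) with hF
  have h1 : ∀ M, ∑ k ∈ Finset.range (M + 1), F M k
      = ∑' k : ℕ, (if k ∈ Finset.range (M + 1) then F M k else 0) := by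
    intro M
    rw [tsum_eq_sum (s := Finset.range (M + 1)) fun k hk => if_neg hk]
    exact Finset.sum_congr rfl fun k hk => (if_pos hk).symm
  change Tendsto (fun M => ∑ k ∈ Finset.range (M + 1), F M k) _ _
  simp only [h1]
  refine tendsto_tsum_of_dominated_convergence
    ((summable_norm_poleCoeff (H := H) h hi).mul_right (2 * Real.pi)) (fun k => ?_)
    (Eventually.of_forall fun M k => ?_)
  · refine Tendsto.congr' ?_ tendsto_const_nhds
    filter_upwards [(tendsto_norm_scaledPole h t hi k).eventually_gt_atTop 1,
      eventually_ge_atTop k] with M h2 h3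
    rw [if_pos (Finset.mem_range.mpr (by omega))]
    simp only [hF]
    rw [integral_inv_one_sub_of_lt_norm h2, sub_zero]
  · split_ifs
    · simp only [hF]
      rw [norm_mul, norm_mul, norm_I, one_mul]
      exact mul_le_mul_of_nonneg_left (norm_two_pi_sub_integral_le h (h0 M) hi) (norm_nonneg _)
    · rw [norm_zero]; positivity

theorem integralI_eq_sum (h : IsAdmissible N ℓ a) (hH : IsLogCoefficient N ℓ H)
    (hHf : ∀ u : Fin (N + 2) → ℂ, (Odd N → ∀ i, |height ℓ (u i)| < Real.pi) →
      H u = f fun i => exp (u i)) :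
    integralI N ℓ a = ∑ i ∈ Finset.Icc 1 (N - 1), ∑' k : ℕ, poleCoeff N ℓ a H (i, k) := by
  obtain ⟨t, ht, ht0⟩ := exists_poleProd_ne_zero h
  have h0 : ∀ (M : ℕ) (v : ℝ), poleProd N ℓ a (contourPoint ℓ (t + M) v) ≠ 0 := fun M v => by
    rw [contourPoint_add_nat]; exact poleProd_sub_nat h (ht0 v) M
  have htr := fun M : ℕ => integral_truncated h hH hHf (M := M) (T := t + M)
    ⟨by have := ht.1; positivity, by linarith [ht.2]⟩ (h0 M)
  have h1 := tendsto_integral_mainPart h hH ht.1.le ht0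
  have h2 := MeasureTheory.intervalIntegral_tendsto_integral_Ioi 0
    ((integrableOn_tailPhi h hH).mul_const (-ℓ))
    (tendsto_atTop_add_const_left atTop t tendsto_natCast_atTop_atTop)
  have h3 := ((tendsto_const_nhds (x := ∫ v in (-Real.pi)..Real.pi,
    Phi N ℓ a (v * I) * I)).sub h1).add h2
  have h4 : Tendsto (fun M : ℕ => ∑ i ∈ Finset.Icc 1 (N - 1), ∑ k ∈ Finset.range (M + 1),
      I * poleCoeff N ℓ a H (i, k) * (2 * Real.pi
        - ∫ v in (-Real.pi)..Real.pi, (1 - scaledPole ℓ a (t + M) (i, k) * exp (v * I))⁻¹)) atTop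
      (𝓝 (∑ i ∈ Finset.Icc 1 (N - 1), ∑' k : ℕ, I * poleCoeff N ℓ a H (i, k) * (2 * Real.pi))) :=
    tendsto_finsetSum _ fun i hi => tendsto_sum_poles h hi h0
  simp only [htr, poleIndex, Finset.sum_product] at h3
  have h5 := tendsto_nhds_unique h3 h4
  rw [sub_zero] at h5
  rw [integralI, h5, Finset.mul_sum]
  refine Finset.sum_congr rfl fun i _ => ?_
  rw [tsum_mul_right, tsum_mul_left]
  have hπ : (Real.pi : ℂ) ≠ 0 := ofReal_ne_zero.mpr Real.pi_ne_zero
  have hI := I_ne_zero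
  field_simp

lemma tailPairs_eq : tailPairs N ℓ a
    = ∏ l ∈ Finset.Icc N (2 * N), ∏ m ∈ Finset.Ioc l (2 * N), theta (a l * a m) (base ℓ) := by
  rw [tailPairs, thetaPairs,
    ← prod_fin_eq_prod_Icc fun l => ∏ m ∈ Finset.Ioc l (2 * N), theta (a l * a m) (base ℓ)]
  refine Finset.prod_congr rfl fun k _ => ?_
  refine Finset.prod_bij (fun l _ => N + (l : ℕ)) (fun l hl => ?_) (fun l _ l' _ hll => ?_)
    (fun m hm => ?_) fun l _ => rfl
  · have := Fin.lt_def.mp (Finset.mem_Ioi.mp hl)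
    rw [Finset.mem_Ioc]; omega
  · exact Fin.ext (by omega)
  · rw [Finset.mem_Ioc] at hm
    exact ⟨⟨m - N, by omega⟩, Finset.mem_Ioi.mpr (Fin.lt_def.mpr (by simp; omega)), by simp; omega⟩

lemma erase_prod_eq (hN : 2 ≤ N) {i : ℕ} (hi : i ∈ Finset.Icc 1 (N - 1)) (F : ℕ → ℂ) :
    ∏ j ∈ (Finset.Icc 1 (2 * N)).erase i, F j
      = (∏ j ∈ (Finset.Icc 1 (N - 1)).erase i, F j) * ∏ j ∈ Finset.Icc N (2 * N), F j := by
  rw [← Finset.prod_union]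
  · congr 1
    ext j
    rw [Finset.mem_Icc] at hi
    simp only [Finset.mem_erase, Finset.mem_union, Finset.mem_Icc]
    omega
  · rw [Finset.disjoint_left]
    intro j hj hj'
    simp only [Finset.mem_erase, Finset.mem_Icc] at hj hj'
    omega

lemma connCoeff_mul_regularised (h : IsAdmissible N ℓ a)
    (hHf : ∀ u : Fin (N + 2) → ℂ, (Odd N → ∀ i, |height ℓ (u i)| < Real.pi) →
      H u = f fun i => exp (u i)) {i : ℕ} (hi : i ∈ Finset.Icc 1 (N - 1)) :
    connCoeff N ℓ a f i * regularised N ℓ a (a i) = ∑' k : ℕ, poleCoeff N ℓ a H (i, k) := by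
  have hi' := mem_Icc_of_mem_left hi
  have hNi : ∀ k ∈ Finset.Icc N (2 * N), k ∈ Finset.Icc 1 (2 * N) ∧ i ≠ k := by
    intro k hk
    have := h.two_le
    rw [Finset.mem_Icc] at hi hk ⊢
    omega
  have h1 : ∏ j ∈ (Finset.Icc 1 (N - 1)).erase i, theta (a j * a i) (base ℓ) ≠ 0 :=
    Finset.prod_ne_zero_iff.mpr fun j hj => h.theta_mul j
      (mem_Icc_of_mem_left (Finset.mem_of_mem_erase hj)) i hi' (Finset.ne_of_mem_erase hj)
  have h2 : ∏ k ∈ Finset.Icc N (2 * N), theta (a i * a k) (base ℓ) ≠ 0 :=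
    Finset.prod_ne_zero_iff.mpr fun k hk => h.theta_mul i hi' k (hNi k hk).1 (hNi k hk).2
  have h3 : ∏ k ∈ Finset.Icc N (2 * N), theta (a k * a i) (base ℓ)
      = ∏ k ∈ Finset.Icc N (2 * N), theta (a i * a k) (base ℓ) :=
    Finset.prod_congr rfl fun k _ => by rw [mul_comm]
  have h4 : ∏ j ∈ (Finset.Icc 1 (N - 1)).erase i, theta (a j / a i) (base ℓ) ≠ 0 :=
    Finset.prod_ne_zero_iff.mpr fun j hj => h.theta_div j (Finset.mem_of_mem_erase hj) i hi
      (Finset.ne_of_mem_erase hj)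
  have h5 := tailPairs_ne_zero h
  have h6 : qPoch (base ℓ) (base ℓ) ≠ 0 :=
    qPoch_ne_zero_of_norm_lt (norm_base_lt_one h.re_neg) (norm_base_lt_one h.re_neg)
  have h7 : ∑' k : ℕ, poleCoeff N ℓ a H (i, k)
      = (∑' k : ℕ, ratio N ℓ a ^ k * qPart N ℓ a (a i * base ℓ ^ k)) * poleConst N ℓ a H i := by
    simp only [poleCoeff]
    rw [tsum_mul_right]
  rw [h7, poleConst_eq h hHf hi,
    regularised_apply h.re_neg h.two_le h.ne_zero h.norm_lt h.ratio_lt hi',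
    erase_prod_eq h.two_le hi, h3, connCoeff, ← tailPairs_eq, Finset.prod_mul_distrib]
  generalize ∏ j ∈ (Finset.Icc 1 (N - 1)).erase i, theta (a j * a i) (base ℓ) = A at h1 ⊢
  generalize ∏ k ∈ Finset.Icc N (2 * N), theta (a i * a k) (base ℓ) = B at h2 ⊢
  generalize ∏ j ∈ (Finset.Icc 1 (N - 1)).erase i, theta (a j / a i) (base ℓ) = D at h4 ⊢
  field_simp

theorem integralI_eq_sum_connCoeff (h : IsAdmissible N ℓ a) (hH : IsLogCoefficient N ℓ H)
    (hHf : ∀ u : Fin (N + 2) → ℂ, (Odd N → ∀ i, |height ℓ (u i)| < Real.pi) →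
      H u = f fun i => exp (u i)) :
    integralI N ℓ a
      = ∑ i ∈ Finset.Icc 1 (N - 1), connCoeff N ℓ a f i * regularised N ℓ a (a i) := by
  rw [integralI_eq_sum h hH hHf]
  exact Finset.sum_congr rfl fun i hi => (connCoeff_mul_regularised h hHf hi).symm

end Limit

end QIntegral

theorem mainTheorem7 (N : ℕ) (hN : 2 ≤ N) (ℓ : ℂ) (hℓ : ℓ.re < 0) :
    -- divisibility of the skew-symmetric theta sum, in any number of variables
    (∀ (n : ℕ), 2 < n → ∀ (U : Set ℂ), IsOpen U → (0 : ℂ) ∉ U →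
      (∀ x : ℂ, QIntegral.base ℓ * x ∈ U ↔ x ∈ U) →
      ∀ g : ℂ → ℂ, DifferentiableOn ℂ g U →
      (∀ x ∈ U, g (QIntegral.base ℓ * x)
          = g x / (QIntegral.base ℓ ^ (n - 1) * x ^ (2 * n - 4))) →
      ∃ h h' : (Fin n → ℂ) → ℂ,
        QIntegral.IsSymmHolomorphic U h ∧ QIntegral.IsSymmHolomorphic U h' ∧
        ∀ x : Fin n → ℂ, (∀ i, x i ∈ U) →
          h x = (∏ i, x i) ^ (n - 2) * h' x ∧
          (QIntegral.Generic (QIntegral.base ℓ) x →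
            QIntegral.skewSum (QIntegral.base ℓ) g x
                = h' x * ∏ i, ∏ j ∈ Finset.Ioi i,
                    (x j * QIntegral.theta (x i / x j) (QIntegral.base ℓ)) ∧
            QIntegral.thetaSum (QIntegral.base ℓ) g x
                = h x / QIntegral.thetaPairs (QIntegral.base ℓ) x)) ∧
    -- the function `f` and the connection coefficients
    ∃ f : (Fin (N + 2) → ℂ) → ℂ,
      QIntegral.IsSymmHolomorphic (QIntegral.varDomain N ℓ) f ∧
      (∀ x : Fin (N + 2) → ℂ, (∀ i, x i ∈ QIntegral.varDomain N ℓ) →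
        QIntegral.Generic (QIntegral.base ℓ) x →
        QIntegral.thetaSum (QIntegral.base ℓ) (QIntegral.gFun N ℓ) x
          = f x / QIntegral.thetaPairs (QIntegral.base ℓ) x) ∧
      (∀ x : Fin (N + 2) → ℂ, (∀ i, x i ∈ QIntegral.varDomain N ℓ) →
        ∀ i : Fin (N + 2), f (Function.update x i (QIntegral.base ℓ * x i))
          = (-1) ^ (N + 1) * (f x / ((∏ j, x j) * x i ^ (N - 2)))) ∧
      ∀ a s : ℕ → ℂ,
        (∀ j ∈ Finset.Icc 1 (2 * N), Complex.exp (s j * ℓ) = a j) →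
        (∀ j ∈ Finset.Icc 1 (2 * N), ‖a j‖ < 1) →
        (∀ j ∈ Finset.Icc 1 (2 * N), a j ∈ QIntegral.varDomain N ℓ) →
        ‖QIntegral.base ℓ ^ (N - 1)‖ < ‖∏ j ∈ Finset.Icc 1 (2 * N), a j‖ →
        (∀ i ∈ Finset.Icc 1 (2 * N), ∀ j ∈ Finset.Icc 1 (2 * N), i ≠ j →
          QIntegral.theta (a i * a j) (QIntegral.base ℓ) ≠ 0) →
        (∀ i ∈ Finset.Icc 1 (N - 1), ∀ j ∈ Finset.Icc 1 (N - 1), i ≠ j →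
          QIntegral.theta (a i / a j) (QIntegral.base ℓ) ≠ 0) →
        IntervalIntegrable (fun v : ℝ => QIntegral.Phi N ℓ a ((v : ℂ) * Complex.I))
            MeasureTheory.volume (-Real.pi) Real.pi ∧
        MeasureTheory.IntegrableOn (QIntegral.tailPhi N ℓ a) (Set.Ioi 0) ∧
        ∃ F : ℂ → ℂ, QIntegral.IsRegularisation N ℓ a s F ∧
          QIntegral.integralI N ℓ a
            = ∑ i ∈ Finset.Icc 1 (N - 1), QIntegral.connCoeff N ℓ a f i * F (a i) := by
  refine ⟨fun n hn U hU hU0 hqU g hg hgq => QIntegral.exists_divided_skewSum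
    (QIntegral.norm_base_lt_one hℓ) (QIntegral.base_ne_zero ℓ) hn hU hU0 hqU hg hgq, ?_⟩
  obtain ⟨f, hf, hgen, hquasi⟩ := QIntegral.exists_coefficient_function hN hℓ
  obtain ⟨H, hH⟩ := QIntegral.exists_isLogCoefficient hN hℓ
  refine ⟨f, hf, fun x hx hx' => ?_, hquasi, fun a s hs ha1 hmem hprod hmul hdiv => ?_⟩
  · rw [hgen x hx hx', mul_div_cancel_right₀ _ (QIntegral.thetaPairs_ne_zero hx')]
  · have h : QIntegral.IsAdmissible N ℓ a := by
      refine ⟨hN, hℓ, ha1, hmem, ?_, hmul, hdiv⟩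
      rw [QIntegral.ratio, norm_div]
      exact (div_lt_one ((norm_nonneg _).trans_lt hprod)).mpr hprod
    have hHf := fun u hu => hH.eq_of_pairGeneric hℓ hf.1.continuousOn hgen (u := u) hu
    exact ⟨QIntegral.intervalIntegrable_Phi h, QIntegral.integrableOn_tailPhi h hH,
      QIntegral.regularised N ℓ a,
      QIntegral.isRegularisation_regularised hℓ hN h.ne_zero h.ratio_lt hs,
      QIntegral.integralI_eq_sum_connCoeff h hH hHf⟩
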